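/- **Setting.** Let $\mathcal A$ be a $C^*$-algebra, $\mathbb E$ a product system over $\mathbb Z_+^k$, given by $C^*$-correspondences $E_1,\dots,E_k$ over $\mathcal A$ (right Hilbert modules with a nondegenerate left action) and unitary isomorphisms $u_{i,j}:E_i\otimes E_j\to E_j\otimes E_i$ with $u_{i,i}=\mathrm{id}$ and $u_{j,i}=u_{i,j}^{-1}$. Let $\sigma$ be a representation of $\mathcal A$ on a Hilbert space $\mathcal K$ and let $A^{(i)}:E_i\to B(\mathcal K)$ be completely bounded linear maps with $A^{(i)}(a\xi b)=\sigma(a)A^{(i)}(\xi)\sigma(b)$. Let $\widetilde A^{(i)}:E_i\otimes_\sigma\mathcal K\to\mathcal K$ be the bounded operator $\xi\otimes h\mapsto A^{(i)}(\xi)h$, and $\widetilde A^{(i)}_n:E_i^{\otimes n}\otimes\mathcal K\to\mathcal K$ the operator $\xi_1\otimes\cdots\otimes\xi_n\otimes h\mapsto A^{(i)}(\xi_1)\cdots A^{(i)}(\xi_n)h$ ($\widetilde A^{(i)}_0=I$). Assume that $(\sigma,A^{(1)},\dots,A^{(k)})$ is *doubly twisted*: there are commuting unitaries $U_{ij}\in\sigma(\mathcal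 A)'$ ($i\ne j$) with $U_{ji}=U_{ij}^*$, such that $\widetilde A^{(l)}(I_{E_l}\otimes U_{ij})=U_{ij}\widetilde A^{(l)}$ for all $l$ and, for $i\neq j$, $$\widetilde A^{(i)}(I_{E_i}\otimes\widetilde A^{(j)})=U_{ij}\widetilde A^{(j)}(I_{E_j}\otimes\widetilde A^{(i)})(u_{i,j}\otimes I_{\mathcal K}),$$ $$\widetilde A^{(j)*}\widetilde A^{(i)}=(I_{E_j}\otimes U_{ij})(I_{E_j}\otimes\widetilde A^{(i)})(u_{i,j}\otimes I_{\mathcal K})(I_{E_i}\otimes\widetilde A^{(j)*}).$$ A closed subspace *reduces* $(\sigma,A^{(i)})$ if it is invariant under $\sigma(\mathcal A)$ and if it and its orthogonal complement are invariant under all $A^{(i)}(\xi)$. For a closed subspace $\mathcal S$, $\beta\subseteq\{1,\dots,k\}$ and $\mathbf m\in\mathbb Z_+^\beta$ let $\mathfrak A^\beta_{\mathbf m}(\mathcal S)$ be the closed span of the vectors obtained from vectors of $\mathcal S$ by applying products of operators $A^{(i)}(\xi)$, $i\in\beta$, with $m_i$ factors for each $i$, the indices increasing from left to right; write $\mathfrak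 A^{(i)}_n$ when $\beta=\{i\}$. Let $\mathcal N_i=\mathcal K\ominus\widetilde A^{(i)}(E_i\otimes\mathcal K)$ and $\mathcal N_\beta=\bigcap_{i\in\beta}\mathcal N_i$, with $\mathcal N_\emptyset=\mathcal K$. **Hypothesis on each $(\sigma,A)=(\sigma,A^{(i)})$, with $E=E_i$.** It is left-invertible, i.e. $\|\widetilde Ax\|\ge\delta\|x\|$ for some $\delta>0$ and all $x$, and at least one of the following holds. * It admits a Wold-type decomposition: $\mathcal K_2=\bigcap_n\operatorname{ran}\widetilde A_n$ is reducing, $\widetilde A$ maps $E\otimes\mathcal K_2$ bijectively onto $\mathcal K_2$, and $\mathcal K_2^\perp=\bigvee_{n\ge0}\mathfrak A_n(\mathcal N(\widetilde A^*))$. * It is near-isometric: $\delta\|x\|\le\|\widetilde Ax\|\le\|x\|$ for some $\delta>0$ and all $x$, and $\operatorname{ran}(\widetilde A_m^*\widetilde A_{m+1})\subseteq E^{\otimes m}\otimes\operatorname{ran}\widetilde A$ for all $m\ge1$. * $E$ acts faithfully on $\mathcal K$ (if $h\in\mathcal K$ and $\xi\otimes h=0$ for all $\xi\in E$, then $\sigma(\mathcal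 A)h=0$), and one of (1)–(3) holds: (1) $\|\widetilde A_2x\|^2+\|x\|^2\le2\|(I_E\otimes\widetilde A)x\|^2$ for $x\in E^{\otimes2}\otimes\mathcal K$; (2) $\|(I_E\otimes\widetilde A)\zeta+\kappa\|^2\le2(\|\zeta\|^2+\|\widetilde A\kappa\|^2)$ for $\zeta\in E^{\otimes2}\otimes\mathcal K$, $\kappa\in E\otimes\mathcal K$; (3) $\|\widetilde A\xi\|^2+\|\widetilde A_2^*\widetilde A\xi\|^2\le2\|\widetilde A^*\widetilde A\xi\|^2$ for $\xi\in E\otimes\mathcal K$. * (4) $\|\widetilde A\xi\|\ge\|\xi\|$ for all $\xi$, and there are $l>0$ and $l_m>0$ with $\sum_m1/l_m=\infty$ such that $\|\widetilde A_m\xi\|^2\le l_m\big(\|(I_{E^{\otimes m-1}}\otimes\widetilde A)\xi\|^2-\|\xi\|^2\big)+l\|\xi\|^2$ for all $m\ge1$ and $\xi\in E^{\otimes m}\otimes\mathcal K$; moreover $l\le1$ or $\bigcap_n\operatorname{ran}\widetilde A_n=0$. **Terminology for a decomposition.** For a subspace $\mathcal S$ that reduces $(\sigma,A^{(i)})$ for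 the relevant $i$, the restrictions to $\mathcal S$ with index in $\beta$ are *jointly generated by their wandering subspace* if $\mathcal S=\bigvee_{\mathbf m\in\mathbb Z_+^\beta}\mathfrak A^\beta_{\mathbf m}(\mathcal W)$ with $\mathcal W=\mathcal S\cap\bigcap_{i\in\beta}\mathfrak A^{(i)}_1(\mathcal S)^\perp$. The restriction $(\sigma,A^{(i)})|_{\mathcal S}$ is *induced* (in the sense of Wold-type decompositions) if it is generated by its wandering subspace (the case $\beta=\{i\}$) and $\bigcap_n\mathfrak A^{(i)}_n(\mathcal S)=0$; it is *invertible* if $\widetilde A^{(i)}$ maps $E_i\otimes\mathcal S$ bijectively onto $\mathcal S$. For $J\subseteq\{1,\dots,k\}$, a family of closed subspaces $(\mathcal L_\beta)_{\beta\subseteq J}$ is a *Wold-type decomposition for $J$* if each $\mathcal L_\beta$ reduces $(\sigma,A^{(i)})$ for all $i\in J$, $\mathcal K=\bigoplus_{\beta\subseteq J}\mathcal L_\beta$ (orthogonally), and for each $\beta\subseteq J$ the restrictions to $\mathcal L_\beta$ with index in $\beta$ are jointly generated by their wandering subspace and individually induced, while $(\sigma,A^{(i)})|_{\mathcal L_\beta}$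 is invertible for each $i\in J\setminus\beta$. **Theorem.** Under the hypothesis above, let $2\le m\le k$ and $J_m=\{1,\dots,m\}$. For $\beta\subseteq J_m$ put $$\mathcal W_\beta=\bigcap_{\mathbf i\in\mathbb Z_+^{J_m\setminus\beta}}\mathfrak A^{J_m\setminus\beta}_{\mathbf i}(\mathcal N_\beta),\qquad \mathcal K_\beta=\bigvee_{\mathbf n\in\mathbb Z_+^\beta}\mathfrak A^\beta_{\mathbf n}(\mathcal W_\beta).$$ Then the $2^m$ subspaces $(\mathcal K_\beta)_{\beta\subseteq J_m}$ form a Wold-type decomposition for $J_m$. It is unique: every Wold-type decomposition $(\mathcal L_\beta)_{\beta\subseteq J_m}$ for $J_m$ satisfies $\mathcal L_\beta=\mathcal K_\beta$ for all $\beta$. Moreover, for $\beta\subseteq J_m$, every closed subspace $\mathcal S$ that reduces $(\sigma,A^{(i)})$ for all $i\in J_m$, on which the representations with index in $\beta$ are jointly generated by their wandering subspace and those with index in $J_m\setminus\beta$ are invertible, is contained in $\mathcal K_\beta$. If $(\sigma,A^{(i)})$ is near-isometric for all $i\in\beta$, then $\mathfrak A^\beta_{\mathbf n}(\mathcal W_\beta)\perp\mathfrak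 A^\beta_{\mathbf n'}(\mathcal W_\beta)$ for $\mathbf n\ne\mathbf n'$ in $\mathbb Z_+^\beta$, so that $\mathcal K_\beta=\bigoplus_{\mathbf n}\mathfrak A^\beta_{\mathbf n}(\mathcal W_\beta)$. -/

import Mathlib

open scoped TensorProduct ComplexOrder InnerProductSpace

universe u v

set_option linter.unusedSectionVars false

noncomputable section

namespace DTCR


theorem exists_negative_compression {D : Type v} [NonUnitalCStarAlgebra D] [PartialOrder D]
    [StarOrderedRing D] (G : D) (hG : IsSelfAdjoint G) :
    ∃ N M : D, IsSelfAdjoint N ∧ N * G * N = -(star M * M) ∧ (M = 0 → 0 ≤ G) := by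
  set N := G⁻ with hN
  have hNsa : IsSelfAdjoint N := (CFC.negPart_nonneg G).isSelfAdjoint
  have h1 : N * G * N = -(N * N * N) := by
    have h2 : N * G = -(N * N) := by
      conv_lhs => rw [← CFC.posPart_sub_negPart G hG]
      rw [mul_sub, CFC.negPart_mul_posPart, zero_sub]
    rw [h2, neg_mul]
  obtain ⟨C, hC⟩ := CStarAlgebra.nonneg_iff_eq_star_mul_self.mp (CFC.negPart_nonneg G)
  have h3 : N * N * N = star (C * N) * (C * N) := by
    rw [star_mul, hNsa.star_eq, ← mul_assoc, mul_assoc N (star C) C, ← hC]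
  refine ⟨N, C * N, hNsa, by rw [h1, h3], fun h8 => ?_⟩
  have h10 : N * N * N = 0 := by rw [h3, h8]; simp
  have h11 : (star N * N) = 0 := by
    have : star (star N * N) * (star N * N) = 0 := by
      simp only [star_mul, hNsa.star_eq]
      rw [← mul_assoc, h10, zero_mul]
    exact CStarRing.star_mul_self_eq_zero_iff _ |>.mp this
  exact (CFC.negPart_eq_zero_iff G hG).mp (CStarRing.star_mul_self_eq_zero_iff _ |>.mp h11)

theorem exists_star_mul_self {D : Type v} [NonUnitalCStarAlgebra D] [PartialOrder D]
    [StarOrderedRing D] (G : D) (hG : 0 ≤ G) : ∃ C, G = star C * C :=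
  CStarAlgebra.nonneg_iff_eq_star_mul_self.mp hG

/-- A self-adjoint matrix over a C*-algebra that is positive as a quadratic form is positive. -/
theorem matrix_nonneg {A : Type v} [NonUnitalCStarAlgebra A] [PartialOrder A] [StarOrderedRing A]
    {n : ℕ} (G : CStarMatrix (Fin n) (Fin n) A) (hG : IsSelfAdjoint G)
    (h : ∀ c : Fin n → A, 0 ≤ ∑ i, ∑ j, star (c i) * G i j * c j) : 0 ≤ G := by
  obtain ⟨N, M, hNsa, h1, hM⟩ := exists_negative_compression G hG
  refine hM ?_
  have hstar : ∀ i j, star (N i j) = N j i := fun i j => by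
    conv_rhs => rw [← hNsa.star_eq]
    rfl
  ext l k
  have h5 := h (fun j => N j k)
  have h6 : ∑ i, ∑ j, star (N i k) * G i j * N j k = (N * G * N) k k := by
    simp only [CStarMatrix.mul_apply, Finset.sum_mul, hstar]
    rw [Finset.sum_comm]
  have h7 : (star M * M) k k = ∑ l, star (M l k) * M l k := by
    rw [CStarMatrix.mul_apply]; rfl
  rw [h6, h1, CStarMatrix.neg_apply, h7] at h5
  have h9 : ∑ l, star (M l k) * M l k = 0 :=
    le_antisymm (neg_nonneg.mp h5) (Finset.sum_nonneg fun l _ => star_mul_self_nonneg _)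
  have := (Finset.sum_eq_zero_iff_of_nonneg (fun l _ => star_mul_self_nonneg _)).mp h9 l
    (Finset.mem_univ l)
  exact CStarRing.star_mul_self_eq_zero_iff _ |>.mp this

/-- A positive semidefinite sesquilinear form with values in a C*-algebra. -/
structure SForm (V : Type u) [AddCommGroup V] [Module ℂ V] (B : Type v) [NonUnitalCStarAlgebra B]
    [PartialOrder B] where
  form : V →ₗ⋆[ℂ] V →ₗ[ℂ] B
  star_form : ∀ x y, star (form x y) = form y x
  nonneg : ∀ x, 0 ≤ form x x

theorem SForm.contr {A : Type*} [NonUnitalCStarAlgebra A] [PartialOrder A] [StarOrderedRing A]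
    {B : Type*} [NonUnitalCStarAlgebra B] [PartialOrder B] [StarOrderedRing B]
    {V : Type*} [AddCommGroup V] [Module ℂ V] (q : SForm V B) (T : A →ₙₐ[ℂ] Module.End ℂ V)
    (hT : ∀ a x y, q.form (T a x) y = q.form x (T (star a) y)) (a : A) (x : V) :
    q.form (T a x) (T a x) ≤ (‖a‖ ^ 2) • q.form x x := by
  have key : ∀ b : A, ‖b‖ ≤ 1 → q.form (T b x) (T b x) ≤ q.form x x := by
    intro b hb
    set c := star b * b with hc
    have hc0 : 0 ≤ c := star_mul_self_nonneg b
    have hcn : ‖c‖ ≤ 1 := by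
      rw [hc, CStarRing.norm_star_mul_self]; nlinarith [norm_nonneg b]
    have hsp : ∀ t ∈ quasispectrum ℝ c, 0 ≤ t ∧ t ≤ 1 := fun t ht =>
      ⟨quasispectrum_nonneg_of_nonneg c hc0 t ht, by
        have h1 := NonUnitalIsometricContinuousFunctionalCalculus.norm_quasispectrum_le
          c ht hc0.isSelfAdjoint
        exact (le_abs_self t).trans (h1.trans hcn)⟩
    set f : ℝ → ℝ := fun t => 1 - √(1 - t) with hf
    have hf0 : f 0 = 0 := by simp [hf]
    have hfc : ContinuousOn f (quasispectrum ℝ c) := by rw [hf]; fun_prop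
    set d := cfcₙ f c with hd
    have hdsa : IsSelfAdjoint d := cfcₙ_predicate f c
    have hdd : d + d - d * d = c := by
      rw [hd, ← cfcₙ_mul f f c, ← cfcₙ_add f f c,
        ← cfcₙ_sub (fun t => f t + f t) (fun t => f t * f t) c]
      conv_rhs => rw [← cfcₙ_id ℝ c hc0.isSelfAdjoint]
      refine cfcₙ_congr fun t ht => ?_
      have := Real.mul_self_sqrt (by linarith [(hsp t ht).2] : (0:ℝ) ≤ 1 - t)
      simp only [hf, id]
      nlinarith
    have h1 := q.nonneg (x - T d x)
    have h2 : q.form (x - T d x) (x - T d x) = q.form x x - q.form (T b x) (T b x) := by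
      rw [hT b, ← Module.End.mul_apply, ← map_mul, ← hc, ← hdd]
      simp only [map_sub, map_add, LinearMap.sub_apply, LinearMap.add_apply, hT, hdsa.star_eq,
        map_mul, Module.End.mul_apply]
      abel
    rw [h2] at h1
    exact sub_nonneg.mp h1
  by_cases ha : ‖a‖ = 0
  · have : a = 0 := norm_eq_zero.mp ha
    subst this
    simp
  · have h := key (((‖a‖⁻¹ : ℝ) : ℂ) • a) (by
      rw [norm_smul]; simp [ha])
    have h' := smul_le_smul_of_nonneg_left h (by positivity : 0 ≤ ‖a‖ ^ 2)
    refine le_trans (le_of_eq ?_) h'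
    simp only [map_smul, LinearMap.smul_apply, LinearMap.map_smulₛₗ]
    rw [← Complex.coe_smul, smul_smul, smul_smul]
    have : ((‖a‖ ^ 2 : ℝ) : ℂ) * (((‖a‖⁻¹ : ℝ) : ℂ) * (starRingEnd ℂ) ((‖a‖⁻¹ : ℝ) : ℂ)) = 1 := by
      rw [Complex.conj_ofReal]
      norm_cast
      field_simp
    rw [mul_assoc, this, one_smul]


/-- Cauchy-Schwarz. -/
theorem SForm.cauchy_schwarz {B : Type*} [NonUnitalCStarAlgebra B] [PartialOrder B]
    [StarOrderedRing B] {V : Type*} [AddCommGroup V] [Module ℂ V] (q : SForm V B)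
    (R : B → V →ₗ[ℂ] V) (hR : ∀ b x y, q.form x (R b y) = q.form x y * b) (x y : V) :
    ‖q.form x y‖ ≤ √‖q.form x x‖ * √‖q.form y y‖ := by
  have hR' : ∀ b x y, q.form (R b x) y = star b * q.form x y := fun b x y => by
    rw [← q.star_form, hR, star_mul, q.star_form]
  have key : ∀ s : ℝ, ‖q.form x x‖ < s → ‖q.form x y‖ ^ 2 ≤ s * ‖q.form y y‖ := by
    intro s hs
    have hs0 : 0 < s := (norm_nonneg _).trans_lt hs
    set a := q.form x y with ha
    have h1 := q.nonneg (R a x - (s : ℂ) • y)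
    have h2 : q.form (R a x - (s : ℂ) • y) (R a x - (s : ℂ) • y) =
        star a * q.form x x * a - (2 * s) • (star a * a) + (s ^ 2) • q.form y y := by
      have h3 : q.form y x = star a := by rw [ha, q.star_form]
      simp only [map_sub, LinearMap.sub_apply, hR, hR', map_smul, LinearMap.map_smulₛₗ,
        LinearMap.smul_apply, Complex.conj_ofReal, h3, ← ha]
      simp only [Complex.coe_smul, mul_assoc]
      module
    have h4 : star a * q.form x x * a ≤ s • (star a * a) :=
      (CStarAlgebra.star_left_conjugate_le_norm_smul (a := a) (b := q.form x x)
        (IsSelfAdjoint.of_nonneg (q.nonneg x))).trans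
        (smul_le_smul_of_nonneg_right hs.le (star_mul_self_nonneg a))
    have h5 : s • (star a * a) ≤ (s ^ 2) • q.form y y := by
      rw [h2] at h1
      have h6 : (0 : B) ≤ s • (star a * a) - (2 * s) • (star a * a) + (s ^ 2) • q.form y y :=
        h1.trans (by gcongr)
      have h7 : s • (star a * a) - (2 * s) • (star a * a) + (s ^ 2) • q.form y y
          = (s ^ 2) • q.form y y - s • (star a * a) := by module
      rw [h7] at h6
      exact sub_nonneg.mp h6
    have h8 := CStarAlgebra.norm_le_norm_of_nonneg_of_le
      (smul_nonneg hs0.le (star_mul_self_nonneg a)) h5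
    rw [norm_smul, norm_smul, CStarRing.norm_star_mul_self, Real.norm_of_nonneg hs0.le,
      Real.norm_of_nonneg (by positivity)] at h8
    nlinarith [norm_nonneg a, norm_nonneg (q.form y y)]
  have h9 : ‖q.form x y‖ ^ 2 ≤ ‖q.form x x‖ * ‖q.form y y‖ := by
    refine le_of_forall_gt_imp_ge_of_dense fun t ht => ?_
    by_cases h0 : ‖q.form y y‖ = 0
    · have := key (‖q.form x x‖ + 1) (by linarith)
      rw [h0, mul_zero] at this ht
      linarith
    · have hp : 0 < ‖q.form y y‖ := lt_of_le_of_ne (norm_nonneg _) (Ne.symm h0)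
      have := key (t / ‖q.form y y‖) (by rw [lt_div_iff₀ hp]; exact ht)
      rwa [div_mul_cancel₀ _ h0] at this
  rw [← Real.sqrt_mul (norm_nonneg _)]
  exact Real.le_sqrt_of_sq_le h9

/-- A C*-correspondence over `A`: a (complete) right Hilbert C*-module together with a
nondegenerate left action of `A` by adjointable operators. Mathlib's `CStarModule` over
`Aᵐᵒᵖ` is a right Hilbert module over `A`. -/
structure Corr (A : Type v) [NonUnitalCStarAlgebra A] [PartialOrder A] where
  carrier : Type u
  [grp : NormedAddCommGroup carrier]
  [mod : NormedSpace ℂ carrier]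
  [complete : CompleteSpace carrier]
  [rsmul : SMul Aᵐᵒᵖ carrier]
  [hilb : CStarModule Aᵐᵒᵖ carrier]
  left : A →ₙₐ[ℂ] Module.End ℂ carrier
  left_adjoint : ∀ a x y, inner Aᵐᵒᵖ (left a x) y = inner Aᵐᵒᵖ x (left (star a) y)
  essential : Dense (Submodule.span ℂ {z | ∃ a x, z = left a x} : Set carrier)

attribute [instance] Corr.grp Corr.mod Corr.complete Corr.rsmul Corr.hilb

instance {A : Type v} [NonUnitalCStarAlgebra A] [PartialOrder A] :
    CoeSort (Corr.{u} A) (Type u) := ⟨Corr.carrier⟩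

section
variable {A : Type v} [NonUnitalCStarAlgebra A] [PartialOrder A]
/-- The `A`-valued inner product `⟪x, y⟫`, conjugate linear in `x` and right `A`-linear in `y`. -/
def Corr.ip (E : Corr.{u} A) (x y : E) : A := (inner Aᵐᵒᵖ x y).unop

theorem Corr.ip_smul (E : Corr.{u} A) (x y : E) (b : A) :
    E.ip x (MulOpposite.op b • y) = E.ip x y * b := by
  simp [Corr.ip]

/-- The inner product as a sesquilinear form. -/
def Corr.sform (E : Corr.{u} A) : SForm E A where
  form := LinearMap.mk₂'ₛₗ (starRingEnd ℂ) (RingHom.id ℂ) E.ip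
    (by intros; simp [Corr.ip]) (by intros; simp [Corr.ip]) (by intros; simp [Corr.ip])
    (by intros; simp [Corr.ip])
  star_form x y := by
    change star (E.ip x y) = E.ip y x
    simp only [Corr.ip]
    rw [← MulOpposite.unop_star, CStarModule.star_inner]
  nonneg x := by
    change 0 ≤ E.ip x x
    have : (0 : Aᵐᵒᵖ) ≤ inner Aᵐᵒᵖ x x := CStarModule.inner_self_nonneg
    exact this

@[simp] theorem Corr.sform_apply (E : Corr.{u} A) (x y : E) : E.sform.form x y = E.ip x y := rfl

theorem Corr.star_ip (E : Corr.{u} A) (x y : E) : star (E.ip x y) = E.ip y x :=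
  E.sform.star_form x y

theorem Corr.norm_ip_self (E : Corr.{u} A) (x : E) : ‖E.ip x x‖ = ‖x‖ ^ 2 := by
  rw [CStarModule.norm_sq_eq Aᵐᵒᵖ]; rfl

theorem Corr.ip_left (E : Corr.{u} A) (a : A) (x y : E) :
    E.ip (E.left a x) y = E.ip x (E.left (star a) y) := by
  simp only [Corr.ip, E.left_adjoint]

theorem Corr.ip_ext (E : Corr.{u} A) {x y : E} (h : ∀ z, E.ip z x = E.ip z y) : x = y := by
  rw [← sub_eq_zero, ← CStarModule.inner_self (A := Aᵐᵒᵖ), CStarModule.inner_sub_right]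
  have : ∀ z : E, inner Aᵐᵒᵖ z x = inner Aᵐᵒᵖ z y := fun z => MulOpposite.unop_injective (h z)
  rw [this, sub_self]

/-- Right multiplication by an element of `A`. -/
def Corr.right (E : Corr.{u} A) (b : A) : E →ₗ[ℂ] E where
  toFun x := MulOpposite.op b • x
  map_add' x y := E.ip_ext fun z => by
    have h := (E.sform.form z).map_add
    simp only [Corr.sform_apply] at h
    rw [h, E.ip_smul, E.ip_smul, E.ip_smul, h, add_mul]
  map_smul' c x := E.ip_ext fun z => by
    have h := (E.sform.form z).map_smul
    simp only [Corr.sform_apply] at h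
    rw [RingHom.id_apply, h, E.ip_smul, E.ip_smul, h, smul_mul_assoc]

variable [StarOrderedRing A]

/-- Gram matrices are positive, hence of the form `star C * C`. -/
theorem Corr.gram_nonneg (E : Corr.{u} A) {n : ℕ} (ξ : Fin n → E) :
    0 ≤ (CStarMatrix.ofMatrix (Matrix.of fun i j => E.ip (ξ i) (ξ j)) :
      CStarMatrix (Fin n) (Fin n) A) := by
  refine matrix_nonneg _ ?_ fun c => ?_
  · ext i j
    exact E.star_ip _ _
  · have h := E.sform.nonneg (∑ i, E.right (c i) (ξ i))
    refine h.trans (le_of_eq ?_)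
    simp only [map_sum, LinearMap.sum_apply]
    rw [Finset.sum_comm]
    refine Finset.sum_congr rfl fun i _ => Finset.sum_congr rfl fun j _ => ?_
    change E.ip (MulOpposite.op (c i) • ξ i) (MulOpposite.op (c j) • ξ j) = _
    rw [E.ip_smul, ← E.star_ip, E.ip_smul, star_mul, E.star_ip]
    rfl

theorem Corr.gram_factor (E : Corr.{u} A) {n : ℕ} (ξ : Fin n → E) :
    ∃ C : CStarMatrix (Fin n) (Fin n) A, ∀ i j, E.ip (ξ i) (ξ j) = ∑ k, star (C k i) * C k j := by
  obtain ⟨C, hC⟩ := exists_star_mul_self _ (E.gram_nonneg ξ)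
  refine ⟨C, fun i j => ?_⟩
  have := congrFun (congrFun hC i) j
  exact this.trans (by rw [CStarMatrix.mul_apply]; rfl)

/-- The form on the algebraic tensor product `E ⊗ F` with
`⟪ξ ⊗ x, η ⊗ y⟫ = ⟪x, ρ ⟪ξ, η⟫ y⟫`. -/
def SForm.tens (E : Corr.{u} A) {B : Type*} [NonUnitalCStarAlgebra B] [PartialOrder B]
    [StarOrderedRing B] {F : Type*} [AddCommGroup F] [Module ℂ F] (p : SForm F B)
    (ρ : A →ₙₐ[ℂ] Module.End ℂ F)
    (hρ : ∀ a x y, p.form (ρ a x) y = p.form x (ρ (star a) y)) : SForm (E ⊗[ℂ] F) B :=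
  let f : E →ₗ⋆[ℂ] F →ₗ⋆[ℂ] (E ⊗[ℂ] F →ₗ[ℂ] B) :=
    LinearMap.mk₂'ₛₗ (starRingEnd ℂ) (starRingEnd ℂ)
      (fun ξ x => TensorProduct.lift
        (((p.form x).compRight ℂ) ∘ₗ (ρ : A →ₗ[ℂ] Module.End ℂ F) ∘ₗ E.sform.form ξ))
      (fun ξ ξ' x => by ext; simp) (fun c ξ x => by ext; simp)
      (fun ξ x x' => by ext; simp) (fun c ξ x => by ext; simp)
  have hf : ∀ ξ x η y, TensorProduct.lift f (ξ ⊗ₜ[ℂ] x) (η ⊗ₜ[ℂ] y)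
      = p.form x (ρ (E.ip ξ η) y) := fun ξ x η y => rfl
  { form := TensorProduct.lift f
    star_form := by
      intro z w
      induction z with
      | zero => simp
      | add z z' hz hz' => simp [hz, hz']
      | tmul ξ x =>
        induction w with
        | zero => simp
        | add w w' hw hw' => simp only [map_add, LinearMap.add_apply, star_add, hw, hw']
        | tmul η y =>
          rw [hf, hf, p.star_form, hρ, E.star_ip]
    nonneg := by
      intro z
      obtain ⟨n, ξ, x, rfl⟩ : ∃ (n : ℕ) (ξ : Fin n → E) (x : Fin n → F),
          z = ∑ i, ξ i ⊗ₜ[ℂ] x i := by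
        obtain ⟨n, s, t, h⟩ := TensorProduct.exists_sum_tmul_eq z
        exact ⟨n, s, t, h⟩
      obtain ⟨C, hC⟩ := E.gram_factor ξ
      have h : TensorProduct.lift f (∑ i, ξ i ⊗ₜ[ℂ] x i) (∑ i, ξ i ⊗ₜ[ℂ] x i)
          = ∑ k, p.form (∑ i, ρ (C k i) (x i)) (∑ i, ρ (C k i) (x i)) := by
        simp only [map_sum, LinearMap.sum_apply, hf, hC, hρ, map_mul,
          Module.End.mul_apply]
        symm
        rw [Finset.sum_comm]
        refine Finset.sum_congr rfl fun i _ => ?_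
        rw [Finset.sum_comm]
      rw [h]
      exact Finset.sum_nonneg fun k _ => p.nonneg _ }
end


section
variable {A : Type v} [NonUnitalCStarAlgebra A] [PartialOrder A] [StarOrderedRing A]

/-- A representation of `A` on a Hilbert space. -/
structure HRep (A : Type v) [NonUnitalCStarAlgebra A] where
  carrier : Type u
  [grp : NormedAddCommGroup carrier]
  [inn : InnerProductSpace ℂ carrier]
  [complete : CompleteSpace carrier]
  σ : A →⋆ₙₐ[ℂ] (carrier →L[ℂ] carrier)

attribute [instance] HRep.grp HRep.inn HRep.complete

instance {A : Type v} [NonUnitalCStarAlgebra A] :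
    CoeSort (HRep.{u} A) (Type u) := ⟨HRep.carrier⟩

/-- The inner product as a sesquilinear form. -/
def innerSForm (V : Type*) [SeminormedAddCommGroup V] [InnerProductSpace ℂ V] : SForm V ℂ where
  form := LinearMap.mk₂'ₛₗ (starRingEnd ℂ) (RingHom.id ℂ) (fun x y => inner ℂ x y)
    inner_add_left (fun c x y => inner_smul_left x y c)
    inner_add_right (fun c x y => inner_smul_right x y c)
  star_form x y := inner_conj_symm y x
  nonneg x := by
    change 0 ≤ inner ℂ x x
    exact RCLike.nonneg_iff.mpr ⟨inner_self_nonneg, inner_self_im x⟩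

section rep
variable {V : Type*} [SeminormedAddCommGroup V] [InnerProductSpace ℂ V]
  (T : A →ₙₐ[ℂ] Module.End ℂ V)
  (hT : ∀ a x y, inner ℂ (T a x) y = inner ℂ x (T (star a) y))
open UniformSpace

theorem norm_apply_le_of_adj (hT : ∀ a x y, inner ℂ (T a x) y = inner ℂ x (T (star a) y))
    (a : A) (x : V) : ‖T a x‖ ≤ ‖a‖ * ‖x‖ := by
  have h := (innerSForm V).contr T hT a x
  have h2 := (RCLike.le_iff_re_im (K := ℂ).mp h).1
  rw [← sq_le_sq₀ (norm_nonneg _) (by positivity), mul_pow,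
    ← inner_self_eq_norm_sq (𝕜 := ℂ) (T a x), ← inner_self_eq_norm_sq (𝕜 := ℂ) x]
  refine h2.trans (le_of_eq ?_)
  rw [RCLike.smul_re]
  rfl

/-- The bounded operator `T a`. -/
def bddOp (hT : ∀ a x y, inner ℂ (T a x) y = inner ℂ x (T (star a) y)) (a : A) : V →L[ℂ] V :=
  (T a).mkContinuous ‖a‖ (norm_apply_le_of_adj T hT a)

theorem bddOp_completion_coe (a : A) (x : V) :
    (bddOp T hT a).completion (x : Completion V) = (T a x : V) :=
  ContinuousLinearMap.completion_apply_coe _ _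

theorem completion_clm_ext {S T : Completion V →L[ℂ] Completion V}
    (h : ∀ x : V, S (x : Completion V) = T (x : Completion V)) : S = T :=
  ContinuousLinearMap.coeFn_injective (Completion.ext S.continuous T.continuous h)

theorem bddOp_adjoint (a : A) (x y : Completion V) :
    inner ℂ ((bddOp T hT (star a)).completion x) y = inner ℂ x ((bddOp T hT a).completion y) := by
  induction x, y using Completion.induction_on₂ with
  | hp => apply isClosed_eq <;> fun_prop
  | ih x y =>
    rw [bddOp_completion_coe, bddOp_completion_coe, Completion.inner_coe, Completion.inner_coe,
      hT, star_star]

/-- An algebraic representation on a pre-Hilbert space, extended to the completion. -/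
def completionRep : A →⋆ₙₐ[ℂ] (Completion V →L[ℂ] Completion V) where
  toFun a := (bddOp T hT a).completion
  map_smul' c a := completion_clm_ext fun z => by
    rw [_root_.smul_apply]
    simp only [bddOp_completion_coe, map_smul]
    exact Completion.coe_smul _ _
  map_zero' := completion_clm_ext fun z => by
    rw [bddOp_completion_coe, map_zero]; exact Completion.coe_zero
  map_add' a b := completion_clm_ext fun z => by
    rw [_root_.add_apply]
    simp only [bddOp_completion_coe, map_add]
    exact Completion.coe_add _ _
  map_mul' a b := completion_clm_ext fun z => by
    rw [mul_apply_eq_comp]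
    simp only [bddOp_completion_coe, map_mul, Module.End.mul_apply]
  map_star' a := (ContinuousLinearMap.eq_adjoint_iff _ _).mpr (bddOp_adjoint T hT a)

theorem completionRep_coe (a : A) (x : V) :
    completionRep T hT a (x : Completion V) = (T a x : V) :=
  bddOp_completion_coe T hT a x

end rep

/-- The representation, with values in linear maps. -/
def HRep.act (H : HRep.{u} A) : A →ₙₐ[ℂ] Module.End ℂ H where
  toFun a := (H.σ a : H →ₗ[ℂ] H)
  map_smul' := by intros; simp
  map_zero' := by simp
  map_add' := by intros; simp
  map_mul' := by intros; rw [map_mul]; rfl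

theorem HRep.act_adj (H : HRep.{u} A) (a : A) (x y : H) :
    inner ℂ (H.σ a x) y = inner ℂ x (H.σ (star a) y) := by
  rw [map_star, ContinuousLinearMap.star_eq_adjoint, ContinuousLinearMap.adjoint_inner_right]

/-- The semi-inner product of the interior tensor product `E ⊗ H`. -/
def HRep.tensForm (E : Corr.{u} A) (H : HRep.{u} A) : SForm (E ⊗[ℂ] H) ℂ :=
  SForm.tens E (innerSForm H) H.act H.act_adj

/-- The algebraic tensor product, to be completed for the semi-inner product
`⟪ξ ⊗ h, η ⊗ k⟫ = ⟪h, σ ⟪ξ, η⟫ k⟫`. -/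
def HRep.PreTens (E : Corr.{u} A) (H : HRep.{u} A) : Type u := E ⊗[ℂ] H

namespace HRep.PreTens
variable (E : Corr.{u} A) (H : HRep.{u} A)

instance : AddCommGroup (HRep.PreTens E H) := inferInstanceAs (AddCommGroup (E ⊗[ℂ] H))
instance : Module ℂ (HRep.PreTens E H) := inferInstanceAs (Module ℂ (E ⊗[ℂ] H))

/-- The identity map. -/
def of : E ⊗[ℂ] H ≃ₗ[ℂ] HRep.PreTens E H := LinearEquiv.refl ℂ _

/-- The semi-inner product. -/
abbrev core : PreInnerProductSpace.Core ℂ (HRep.PreTens E H) where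
  inner x y := (HRep.tensForm E H).form ((of E H).symm x) ((of E H).symm y)
  conj_inner_symm x y := (HRep.tensForm E H).star_form _ _
  re_inner_nonneg x := (RCLike.nonneg_iff.mp ((HRep.tensForm E H).nonneg _)).1
  add_left _ _ _ := by rw [map_add, map_add]; rfl
  smul_left _ _ _ := by rw [map_smul, LinearMap.map_smulₛₗ]; rfl

instance : SeminormedAddCommGroup (HRep.PreTens E H) :=
  InnerProductSpace.Core.toSeminormedAddCommGroup (c := core E H)
instance : InnerProductSpace ℂ (HRep.PreTens E H) := InnerProductSpace.ofCore (core E H)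

theorem inner_of (x y : E ⊗[ℂ] H) :
    inner ℂ (of E H x) (of E H y) = (HRep.tensForm E H).form x y := rfl

theorem inner_tmul (ξ η : E) (h k : H) :
    inner ℂ (of E H (ξ ⊗ₜ h)) (of E H (η ⊗ₜ k)) = inner ℂ h (H.σ (E.ip ξ η) k) := rfl

/-- The left action on the algebraic tensor product. -/
def leftAlg : A →ₙₐ[ℂ] Module.End ℂ (E ⊗[ℂ] H) where
  toFun a := (E.left a).rTensor H
  map_smul' := by intros; ext; simp [TensorProduct.smul_tmul']
  map_zero' := by ext; simp
  map_add' := by intros; ext; simp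
  map_mul' := by intros; ext; simp

theorem leftAlg_adj (a : A) (x y : E ⊗[ℂ] H) : (HRep.tensForm E H).form (leftAlg E H a x) y
    = (HRep.tensForm E H).form x (leftAlg E H (star a) y) := by
  induction x with
  | zero => simp
  | add x x' hx hx' => simp only [map_add, LinearMap.add_apply, hx, hx']
  | tmul ξ h =>
    induction y with
    | zero => simp
    | add x x' hx hx' => simp only [map_add, hx, hx']
    | tmul η k =>
      change inner ℂ h (H.σ (E.ip (E.left a ξ) η) k) = inner ℂ h (H.σ (E.ip ξ (E.left _ η)) k)
      rw [E.ip_left]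

end HRep.PreTens

/-- The interior tensor product `E ⊗_σ H`, a Hilbert space with the left action of `A`. -/
def HRep.tens (E : Corr.{u} A) (H : HRep.{u} A) : HRep.{u} A where
  carrier := UniformSpace.Completion (HRep.PreTens E H)
  σ := completionRep (V := HRep.PreTens E H) (HRep.PreTens.leftAlg E H)
    (HRep.PreTens.leftAlg_adj E H)

namespace HRep
variable (E : Corr.{u} A) (H : HRep.{u} A)

/-- The canonical map from the algebraic tensor product. -/
def tensMap : E ⊗[ℂ] H →ₗ[ℂ] tens E H :=
  (UniformSpace.Completion.toComplL (𝕜 := ℂ) (E := PreTens E H)).toLinearMap ∘ₗ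
    (PreTens.of E H).toLinearMap

/-- The elementary tensor `ξ ⊗ h`. -/
def tmul (ξ : E) (h : H) : tens E H := tensMap E H (ξ ⊗ₜ h)

theorem dense_tensMap : DenseRange (tensMap E H) :=
  UniformSpace.Completion.denseRange_coe (α := PreTens E H)

theorem inner_tensMap (x y : E ⊗[ℂ] H) :
    inner ℂ (tensMap E H x) (tensMap E H y) = (tensForm E H).form x y :=
  UniformSpace.Completion.inner_coe (𝕜 := ℂ) (PreTens.of E H x) (PreTens.of E H y)

variable {E H}

theorem inner_tmul (ξ η : E) (h k : H) :
    inner ℂ (tmul E H ξ h) (tmul E H η k) = inner ℂ h (H.σ (E.ip ξ η) k) :=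
  inner_tensMap E H _ _

theorem tens_σ_tmul (a : A) (ξ : E) (h : H) :
    (tens E H).σ a (tmul E H ξ h) = tmul E H (E.left a ξ) h := by
  exact completionRep_coe (V := PreTens E H) _ _ a (PreTens.of E H (ξ ⊗ₜ h))

theorem tens_ext {F : Type*} [AddCommMonoid F] [TopologicalSpace F] [T2Space F] [Module ℂ F]
    {S T : tens E H →L[ℂ] F} (h : ∀ ξ x, S (tmul E H ξ x) = T (tmul E H ξ x)) : S = T := by
  have h1 : (S : tens E H →ₗ[ℂ] F) ∘ₗ tensMap E H = (T : tens E H →ₗ[ℂ] F) ∘ₗ tensMap E H :=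
    TensorProduct.ext' h
  refine ContinuousLinearMap.coeFn_injective ?_
  refine (dense_tensMap E H).equalizer S.continuous T.continuous ?_
  ext z
  exact LinearMap.congr_fun h1 z

end HRep

/-- A pre-Hilbert module with a left action, not necessarily complete or separated. -/
structure PreCorr (A : Type v) [NonUnitalCStarAlgebra A] [PartialOrder A] where
  carrier : Type u
  [grp : AddCommGroup carrier]
  [mod : Module ℂ carrier]
  q : SForm carrier A
  right : A → carrier →ₗ[ℂ] carrier
  form_right : ∀ b x y, q.form x (right b y) = q.form x y * b
  left : A →ₙₐ[ℂ] Module.End ℂ carrier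
  form_left : ∀ a x y, q.form (left a x) y = q.form x (left (star a) y)

attribute [instance] PreCorr.grp PreCorr.mod

namespace PreCorr
variable (P : PreCorr.{u} A)

instance : Norm P.carrier := ⟨fun x => √‖P.q.form x x‖⟩

theorem norm_def (x : P.carrier) : ‖x‖ = √‖P.q.form x x‖ := rfl

theorem norm_sq (x : P.carrier) : ‖x‖ ^ 2 = ‖P.q.form x x‖ := Real.sq_sqrt (norm_nonneg _)

theorem form_le (x y : P.carrier) : ‖P.q.form x y‖ ≤ ‖x‖ * ‖y‖ :=
  P.q.cauchy_schwarz P.right P.form_right x y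

theorem normCore : SeminormedSpace.Core ℂ P.carrier where
  norm_nonneg _ := Real.sqrt_nonneg _
  norm_smul c x := by
    have h1 : ‖P.q.form (c • x) (c • x)‖ = ‖c‖ ^ 2 * ‖P.q.form x x‖ := by
      rw [map_smul, LinearMap.map_smulₛₗ, LinearMap.smul_apply, norm_smul, norm_smul,
        RCLike.norm_conj]
      ring
    rw [norm_def, norm_def, h1, Real.sqrt_mul (sq_nonneg _), Real.sqrt_sq (norm_nonneg _)]
  norm_triangle x y := by
    have h0 : (0:ℝ) ≤ ‖x‖ := Real.sqrt_nonneg _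
    have h0' : (0:ℝ) ≤ ‖y‖ := Real.sqrt_nonneg _
    rw [norm_def]
    refine Real.sqrt_le_iff.mpr ⟨by positivity, ?_⟩
    have h1 : P.q.form (x + y) (x + y) =
        P.q.form x x + P.q.form x y + (P.q.form y x + P.q.form y y) := by
      simp only [map_add, LinearMap.add_apply]; abel
    have h2 := P.form_le x y
    have h3 := P.form_le y x
    have h4 := norm_add₄_le (a := P.q.form x x) (b := P.q.form x y) (c := P.q.form y x)
      (d := P.q.form y y)
    have h5 := P.norm_sq x
    have h6 := P.norm_sq y
    rw [h1, ← add_assoc]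
    nlinarith

instance : SeminormedAddCommGroup P.carrier := SeminormedAddCommGroup.ofCore P.normCore

instance : NormedSpace ℂ P.carrier where
  norm_smul_le c x := (P.normCore.norm_smul c x).le

/-- The inner product on the pre-Hilbert module. -/
def formL : P.carrier →L⋆[ℂ] P.carrier →L[ℂ] A :=
  LinearMap.mkContinuous₂ P.q.form 1 fun x y => by rw [one_mul]; exact P.form_le x y

instance : Inner A P.carrier := ⟨fun x y => P.q.form x y⟩

open UniformSpace

theorem inner_coe (x y : P.carrier) :
    inner A (x : Completion P.carrier) (y : Completion P.carrier) = P.q.form x y :=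
  (Completion.isDenseInducing_coe.prodMap Completion.isDenseInducing_coe).extend_eq
    (f := Function.uncurry (inner A : P.carrier → P.carrier → A))
    ((P.formL.continuous.comp continuous_fst).clm_apply continuous_snd) (x, y)

theorem continuous_inner :
    Continuous (Function.uncurry (inner A (E := Completion P.carrier))) := by
  let inner' : P.carrier →+ P.carrier →+ A :=
    { toFun := fun x => (P.q.form x).toAddMonoidHom
      map_zero' := by ext x; simp
      map_add' := fun x y => by ext z; simp }
  have : Continuous fun p : P.carrier × P.carrier => inner' p.1 p.2 :=
    (P.formL.continuous.comp continuous_fst).clm_apply continuous_snd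
  rw [Completion.toInner, inner, Function.uncurry_curry _]
  change Continuous
      (((Completion.isDenseInducing_toCompl P.carrier).prodMap
        (Completion.isDenseInducing_toCompl P.carrier)).extend fun p : P.carrier × P.carrier =>
        inner' p.1 p.2)
  exact (Completion.isDenseInducing_toCompl P.carrier).extend_Z_bilin
    (Completion.isDenseInducing_toCompl P.carrier) this

@[fun_prop]
theorem _root_.Continuous.preCorr_inner {α : Type*} [TopologicalSpace α]
    {f g : α → Completion P.carrier} (hf : Continuous f) (hg : Continuous g) :
    Continuous (fun x : α => inner A (f x) (g x)) :=
  P.continuous_inner.comp (hf.prodMk hg :)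

theorem norm_left_le (a : A) (x : P.carrier) : ‖P.left a x‖ ≤ ‖a‖ * ‖x‖ := by
  rw [← sq_le_sq₀ (norm_nonneg _) (by positivity), mul_pow, norm_sq, norm_sq]
  refine (CStarAlgebra.norm_le_norm_of_nonneg_of_le (P.q.nonneg _)
    (P.q.contr P.left P.form_left a x)).trans (le_of_eq ?_)
  rw [norm_smul, Real.norm_of_nonneg (sq_nonneg _)]

theorem norm_right_le (b : A) (x : P.carrier) : ‖P.right b x‖ ≤ ‖b‖ * ‖x‖ := by
  rw [← sq_le_sq₀ (norm_nonneg _) (by positivity), mul_pow, norm_sq, norm_sq, P.form_right,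
    ← P.q.star_form, P.form_right, star_mul, P.q.star_form]
  refine (norm_mul_le _ _).trans ?_
  calc _ ≤ (‖b‖ * ‖P.q.form x x‖) * ‖b‖ := by
        gcongr
        exact (norm_mul_le _ _).trans (by rw [norm_star])
    _ = _ := by ring

/-- The left action. -/
def leftL (a : A) : P.carrier →L[ℂ] P.carrier := (P.left a).mkContinuous ‖a‖ (P.norm_left_le a)
/-- The right action. -/
def rightL (b : A) : P.carrier →L[ℂ] P.carrier := (P.right b).mkContinuous ‖b‖ (P.norm_right_le b)

theorem leftL_coe (a : A) (x : P.carrier) :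
    (P.leftL a).completion (x : Completion P.carrier) = (P.left a x : P.carrier) :=
  ContinuousLinearMap.completion_apply_coe _ _

theorem rightL_coe (a : A) (x : P.carrier) :
    (P.rightL a).completion (x : Completion P.carrier) = (P.right a x : P.carrier) :=
  ContinuousLinearMap.completion_apply_coe _ _

/-- The completed module. -/
def Compl : Type u := Completion P.carrier

instance : NormedAddCommGroup P.Compl := inferInstanceAs (NormedAddCommGroup (Completion P.carrier))
instance : NormedSpace ℂ P.Compl := inferInstanceAs (NormedSpace ℂ (Completion P.carrier))
instance : CompleteSpace P.Compl := inferInstanceAs (CompleteSpace (Completion P.carrier))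
instance : SMul Aᵐᵒᵖ P.Compl := ⟨fun b x => (P.rightL b.unop).completion x⟩

/-- The inner product of the completion. -/
def ip (x y : P.Compl) : A := inner A (E := Completion P.carrier) x y

theorem ip_coe (x y : P.carrier) :
    P.ip (x : Completion P.carrier) (y : Completion P.carrier) = P.q.form x y := P.inner_coe x y

@[fun_prop]
theorem _root_.Continuous.preCorr_ip {α : Type*} [TopologicalSpace α]
    {f g : α → Completion P.carrier} (hf : Continuous f) (hg : Continuous g) :
    Continuous (fun x : α => P.ip (f x) (g x)) :=
  P.continuous_inner.comp (hf.prodMk hg :)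

theorem norm_eq (x : P.Compl) : ‖x‖ = √‖P.ip x x‖ := by
  induction x using Completion.induction_on with
  | hp =>
    refine isClosed_eq (continuous_norm (E := Completion P.carrier)) ?_
    exact Real.continuous_sqrt.comp (Continuous.preCorr_ip P continuous_id continuous_id).norm
  | ih x => rw [ip_coe]; exact Completion.norm_coe x

theorem ip_nonneg (x : P.Compl) : 0 ≤ P.ip x x := by
  induction x using Completion.induction_on with
  | hp =>
    exact CStarAlgebra.isClosed_nonneg.preimage
      (Continuous.preCorr_ip P continuous_id continuous_id)
  | ih x => rw [ip_coe]; exact P.q.nonneg x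

theorem ip_add (x y z : P.Compl) : P.ip x (y + z) = P.ip x y + P.ip x z := by
  induction x, y, z using Completion.induction_on₃ with
  | hp =>
    refine isClosed_eq ?_ ?_
    · exact Continuous.preCorr_ip P (by fun_prop) (Continuous.add (by fun_prop) (by fun_prop))
    · exact (Continuous.preCorr_ip P (by fun_prop) (by fun_prop)).add
        (Continuous.preCorr_ip P (by fun_prop) (by fun_prop))
  | ih x y z =>
    refine (congrArg (P.ip _) (Completion.coe_add y z).symm).trans ?_
    rw [ip_coe, ip_coe, ip_coe, map_add]

theorem ip_csmul (c : ℂ) (x y : P.Compl) : P.ip x (c • y) = c • P.ip x y := by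
  induction x, y using Completion.induction_on₂ with
  | hp =>
    refine isClosed_eq ?_ ?_
    · exact Continuous.preCorr_ip P (by fun_prop) (continuous_snd.const_smul c)
    · exact (Continuous.preCorr_ip P (by fun_prop) (by fun_prop)).const_smul c
  | ih x y =>
    refine (congrArg (P.ip _) (Completion.coe_smul c y).symm).trans ?_
    rw [ip_coe, ip_coe, map_smul]

theorem ip_right (b : A) (x y : P.Compl) :
    P.ip x ((P.rightL b).completion y) = P.ip x y * b := by
  induction x, y using Completion.induction_on₂ with
  | hp =>
    refine isClosed_eq ?_ ?_
    · exact Continuous.preCorr_ip P (by fun_prop) (by fun_prop)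
    · exact (Continuous.preCorr_ip P (by fun_prop) (by fun_prop)).mul continuous_const
  | ih x y => rw [rightL_coe, ip_coe, ip_coe, P.form_right]

theorem ip_left (a : A) (x y : P.Compl) :
    P.ip ((P.leftL a).completion x) y = P.ip x ((P.leftL (star a)).completion y) := by
  induction x, y using Completion.induction_on₂ with
  | hp =>
    refine isClosed_eq ?_ ?_
    · exact Continuous.preCorr_ip P (by fun_prop) (by fun_prop)
    · exact Continuous.preCorr_ip P (by fun_prop) (by fun_prop)
  | ih x y => rw [leftL_coe, leftL_coe, ip_coe, ip_coe, P.form_left]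

theorem star_ip (x y : P.Compl) : star (P.ip x y) = P.ip y x := by
  induction x, y using Completion.induction_on₂ with
  | hp =>
    refine isClosed_eq ?_ ?_
    · exact (Continuous.preCorr_ip P (by fun_prop) (by fun_prop)).star
    · exact Continuous.preCorr_ip P (by fun_prop) (by fun_prop)
  | ih x y => rw [ip_coe, ip_coe, P.q.star_form]

instance : CStarModule Aᵐᵒᵖ P.Compl where
  inner x y := MulOpposite.op (P.ip x y)
  inner_add_right {x y z} := congrArg MulOpposite.op (P.ip_add x y z)
  inner_self_nonneg {x} := P.ip_nonneg x
  inner_self {x} := by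
    constructor
    · intro h
      have h' : P.ip x x = 0 := MulOpposite.op_injective h
      rw [← norm_eq_zero, P.norm_eq, h', norm_zero, Real.sqrt_zero]
    · rintro rfl
      have := P.ip_csmul 0 0 0
      rw [zero_smul, zero_smul] at this
      rw [this]; rfl
  inner_op_smul_right {b x y} := congrArg MulOpposite.op (P.ip_right b.unop x y)
  inner_smul_right_complex {c x y} := congrArg MulOpposite.op (P.ip_csmul c x y)
  star_inner x y := congrArg MulOpposite.op (P.star_ip x y)
  norm_eq_sqrt_norm_inner_self x := P.norm_eq x

theorem clm_ext {S T : Completion P.carrier →L[ℂ] Completion P.carrier}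
    (h : ∀ x : P.carrier, S (x : Completion P.carrier) = T (x : Completion P.carrier)) : S = T :=
  ContinuousLinearMap.coeFn_injective (Completion.ext S.continuous T.continuous h)

/-- The left action on the completion, by bounded operators. -/
def leftHom : A →ₙₐ[ℂ] (Completion P.carrier →L[ℂ] Completion P.carrier) where
  toFun a := (P.leftL a).completion
  map_smul' c a := P.clm_ext fun z => by
    rw [_root_.smul_apply]
    simp only [leftL_coe, map_smul]
    exact Completion.coe_smul _ _
  map_zero' := P.clm_ext fun z => by
    rw [leftL_coe, map_zero]; exact Completion.coe_zero
  map_add' a b := P.clm_ext fun z => by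
    rw [_root_.add_apply]
    simp only [leftL_coe, map_add]
    exact Completion.coe_add _ _
  map_mul' a b := P.clm_ext fun z => by
    rw [mul_apply_eq_comp]
    simp only [leftL_coe, map_mul, Module.End.mul_apply]

/-- The left action on the completion. -/
def leftEnd : A →ₙₐ[ℂ] Module.End ℂ P.Compl where
  toFun a := (P.leftHom a : Completion P.carrier →ₗ[ℂ] Completion P.carrier)
  map_smul' c a := by rw [map_smul]; rfl
  map_zero' := by rw [map_zero]; rfl
  map_add' a b := by rw [map_add]; rfl
  map_mul' a b := by rw [map_mul]; rfl

theorem leftEnd_coe (a : A) (x : P.carrier) :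
    P.leftEnd a (x : Completion P.carrier) = ((P.left a x : P.carrier) : Completion P.carrier) :=
  P.leftL_coe a x

/-- The correspondence obtained by completion. -/
def completion (h : Dense (Submodule.span ℂ {z | ∃ a x, z = P.leftEnd a x} : Set P.Compl)) :
    Corr.{u} A where
  carrier := P.Compl
  left := P.leftEnd
  left_adjoint a x y := congrArg MulOpposite.op (P.ip_left a x y)
  essential := h

end PreCorr

theorem Corr.norm_left_le (E : Corr.{u} A) (a : A) (x : E) : ‖E.left a x‖ ≤ ‖a‖ * ‖x‖ := by
  rw [← sq_le_sq₀ (norm_nonneg _) (by positivity), mul_pow, ← E.norm_ip_self, ← E.norm_ip_self]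
  refine (CStarAlgebra.norm_le_norm_of_nonneg_of_le (E.sform.nonneg _)
    (E.sform.contr E.left E.ip_left a x)).trans (le_of_eq ?_)
  rw [norm_smul, Real.norm_of_nonneg (sq_nonneg _)]; rfl

theorem Corr.norm_ip_le (E : Corr.{u} A) (x y : E) : ‖E.ip x y‖ ≤ ‖x‖ * ‖y‖ := by
  have h := E.sform.cauchy_schwarz E.right (fun b x y => E.ip_smul x y b) x y
  simp only [Corr.sform_apply, E.norm_ip_self, Real.sqrt_sq (norm_nonneg _)] at h
  exact h

namespace Corr
variable (E F : Corr.{u} A)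

/-- The algebraic tensor product of two correspondences, with
`⟪ξ ⊗ x, η ⊗ y⟫ = ⟪x, ⟪ξ, η⟫ y⟫`. -/
def preTens : PreCorr.{u} A where
  carrier := E ⊗[ℂ] F
  q := SForm.tens E F.sform F.left F.ip_left
  right b := (F.right b).lTensor E
  form_right b z w := by
    induction z with
    | zero => simp
    | add z z' hz hz' => simp only [map_add, LinearMap.add_apply, hz, hz', add_mul]
    | tmul ξ x =>
      induction w with
      | zero => simp
      | add w w' hw hw' => simp only [map_add, hw, hw', add_mul]
      | tmul η y =>
        change F.ip x (F.left (E.ip ξ η) (F.right b y)) = F.ip x (F.left (E.ip ξ η) y) * b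
        have h := F.ip_left (star (E.ip ξ η)) x
        rw [star_star] at h
        rw [← h, ← h]
        exact F.ip_smul _ _ _
  left :=
    { toFun := fun a => (E.left a).rTensor F
      map_smul' := by intros; ext; simp [TensorProduct.smul_tmul']
      map_zero' := by ext; simp
      map_add' := by intros; ext; simp
      map_mul' := by intros; ext; simp }
  form_left a z w := by
    induction z with
    | zero => simp
    | add z z' hz hz' => simp only [map_add, LinearMap.add_apply, hz, hz']
    | tmul ξ x =>
      induction w with
      | zero => simp
      | add w w' hw hw' => simp only [map_add, hw, hw']
      | tmul η y =>
        change F.ip x (F.left (E.ip (E.left a ξ) η) y) = F.ip x (F.left (E.ip ξ (E.left _ η)) y)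
        rw [E.ip_left]

theorem norm_preTens_tmul_le (ξ : E) (x : F) :
    ‖(show (preTens E F).carrier from ξ ⊗ₜ[ℂ] x)‖ ≤ ‖ξ‖ * ‖x‖ := by
  rw [← sq_le_sq₀ (norm_nonneg _) (by positivity), PreCorr.norm_sq]
  change ‖F.ip x (F.left (E.ip ξ ξ) x)‖ ≤ _
  refine (F.norm_ip_le _ _).trans ?_
  have := F.norm_left_le (E.ip ξ ξ) x
  rw [E.norm_ip_self] at this
  nlinarith [norm_nonneg x]

/-- The elementary tensor, linear and continuous in the left variable. -/
def preTmulL (x : F) : E →L[ℂ] UniformSpace.Completion (preTens E F).carrier :=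
  (UniformSpace.Completion.toComplL (𝕜 := ℂ) (E := (preTens E F).carrier)) ∘L
  LinearMap.mkContinuous (F := (preTens E F).carrier) ((TensorProduct.mk ℂ E F).flip x) ‖x‖
    (fun ξ => by rw [mul_comm]; exact norm_preTens_tmul_le E F ξ x)

theorem preTens_dense :
    Dense (Submodule.span ℂ {z | ∃ a x, z = (preTens E F).leftEnd a x} :
      Set (preTens E F).Compl) := by
  set S : Submodule ℂ (UniformSpace.Completion (preTens E F).carrier) :=
    Submodule.span ℂ {z | ∃ a x, z = (preTens E F).leftEnd a x} with hS
  have h1 : ∀ (ξ : E) (x : F), preTmulL E F x ξ ∈ S.topologicalClosure := fun ξ x => by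
    have h2 : (Submodule.span ℂ {z | ∃ a x, z = E.left a x}) ≤
        S.comap (preTmulL E F x : E →ₗ[ℂ] _) := by
      refine Submodule.span_le.mpr ?_
      rintro _ ⟨a, η, rfl⟩
      refine Submodule.subset_span ⟨a, preTmulL E F x η, ?_⟩
      exact ((preTens E F).leftEnd_coe a (η ⊗ₜ[ℂ] x)).symm
    exact map_mem_closure (preTmulL E F x).continuous (E.essential ξ) h2
  have h3 : ∀ z : (preTens E F).carrier,
      (z : UniformSpace.Completion (preTens E F).carrier) ∈ S.topologicalClosure := fun z => by
    have h4 : ∀ z : E ⊗[ℂ] F, UniformSpace.Completion.toComplL (𝕜 := ℂ)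
        (E := (preTens E F).carrier) z ∈ S.topologicalClosure := fun z => by
      induction z with
      | zero => exact (map_zero (UniformSpace.Completion.toComplL (𝕜 := ℂ)
          (E := (preTens E F).carrier))) ▸ zero_mem _
      | add z w hz hw => exact (map_add (UniformSpace.Completion.toComplL (𝕜 := ℂ)
          (E := (preTens E F).carrier)) z w) ▸ add_mem hz hw
      | tmul ξ x => exact h1 ξ x
    exact h4 z
  intro z
  have h5 := (isClosed_closure (s := (S : Set (UniformSpace.Completion (preTens E F).carrier))))
  exact UniformSpace.Completion.induction_on z h5 h3

/-- The interior tensor product `E ⊗_A F` of two correspondences. -/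
def tens : Corr.{u} A := (preTens E F).completion (preTens_dense E F)

/-- The elementary tensor `ξ ⊗ x`. -/
def tmul (ξ : E) (x : F) : tens E F :=
  ((show (preTens E F).carrier from ξ ⊗ₜ[ℂ] x : (preTens E F).carrier) :
    UniformSpace.Completion (preTens E F).carrier)

theorem ip_tmul (ξ η : E) (x y : F) :
    (tens E F).ip (tmul E F ξ x) (tmul E F η y) = F.ip x (F.left (E.ip ξ η) y) :=
  (preTens E F).ip_coe _ _

theorem tens_left_tmul (a : A) (ξ : E) (x : F) :
    (tens E F).left a (tmul E F ξ x) = tmul E F (E.left a ξ) x :=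
  (preTens E F).leftEnd_coe a _

theorem tens_right_tmul (b : A) (ξ : E) (x : F) :
    (tens E F).right b (tmul E F ξ x) = tmul E F ξ (F.right b x) :=
  (preTens E F).rightL_coe b _

/-- The elementary tensors as a linear map. -/
def tensMap : E ⊗[ℂ] F →ₗ[ℂ] tens E F :=
  (UniformSpace.Completion.toComplL (𝕜 := ℂ) (E := (preTens E F).carrier)).toLinearMap

theorem tensMap_tmul (ξ : E) (x : F) : tensMap E F (ξ ⊗ₜ x) = tmul E F ξ x := rfl

theorem dense_tensMap : DenseRange (tensMap E F) :=
  UniformSpace.Completion.denseRange_coe (α := (preTens E F).carrier)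

end Corr

/-- A unitary isomorphism of correspondences: a bijective bimodule map that preserves the inner
products. -/
structure Corr.Iso (E F : Corr.{u} A) where
  toEquiv : E ≃ₗ[ℂ] F
  ip_map : ∀ x y, F.ip (toEquiv x) (toEquiv y) = E.ip x y
  left_map : ∀ a x, toEquiv (E.left a x) = F.left a (toEquiv x)
  right_map : ∀ a x, toEquiv (E.right a x) = F.right a (toEquiv x)

/-- The identity. -/
def Corr.Iso.refl (E : Corr.{u} A) : Corr.Iso E E where
  toEquiv := LinearEquiv.refl ℂ E
  ip_map _ _ := rfl
  left_map _ _ := rfl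
  right_map _ _ := rfl

/-- The inverse. -/
def Corr.Iso.symm {E F : Corr.{u} A} (u : Corr.Iso E F) : Corr.Iso F E where
  toEquiv := u.toEquiv.symm
  ip_map x y := by rw [← u.ip_map]; simp
  left_map a x := by rw [LinearEquiv.symm_apply_eq, u.left_map]; simp
  right_map a x := by rw [LinearEquiv.symm_apply_eq, u.right_map]; simp

/-- A product system over `ℤ₊^k`, given by its fibres `E i` over the `k` generators and unitary
isomorphisms `u i j : E i ⊗ E j → E j ⊗ E i` with `u j i = (u i j)⁻¹` and `u i i = id`. -/
structure ProductSystem (A : Type v) [NonUnitalCStarAlgebra A] [PartialOrder A]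
    [StarOrderedRing A] (k : ℕ) where
  E : Fin k → Corr.{u} A
  u : ∀ i j, Corr.Iso ((E i).tens (E j)) ((E j).tens (E i))
  u_self : ∀ i, u i i = Corr.Iso.refl _
  u_symm : ∀ i j, u j i = (u i j).symm

theorem approx_lemma {D : Type*} [NonUnitalCStarAlgebra D] [PartialOrder D]
    [StarOrderedRing D] (G : D) (hG : 0 ≤ G) (ε : ℝ) (hε : 0 < ε) :
    ∃ b s p : D, star b = b ∧ star s = s ∧ star p = p ∧ b * s = p ∧ s * s = G ∧
      ‖b * G * b‖ ≤ 1 ∧ ‖G - p * G - G * p + p * G * p‖ ≤ ε := by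
  have hsa : IsSelfAdjoint G := hG.isSelfAdjoint
  have hsp : ∀ t ∈ quasispectrum ℝ G, 0 ≤ t := fun t ht => quasispectrum_nonneg_of_nonneg G hG t ht
  set g : ℝ → ℝ := fun t => √t / (t + ε) with hg
  set q : ℝ → ℝ := fun t => t / (t + ε) with hq
  have hg0 : g 0 = 0 := by simp [hg]
  have hq0 : q 0 = 0 := by simp [hq]
  have hne : ∀ t ∈ quasispectrum ℝ G, t + ε ≠ 0 := fun t ht => by linarith [hsp t ht]
  have hgc : ContinuousOn g (quasispectrum ℝ G) :=
    Real.continuous_sqrt.continuousOn.div (by fun_prop) hne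
  have hqc : ContinuousOn q (quasispectrum ℝ G) := continuousOn_id.div (by fun_prop) hne
  have hsc : ContinuousOn (fun t => √t) (quasispectrum ℝ G) := by fun_prop
  have hs0 : (fun t => √t) (0:ℝ) = 0 := by simp
  have hid : cfcₙ (fun t : ℝ => t) G = G := cfcₙ_id ℝ G hsa
  have h1 : cfcₙ g G * cfcₙ (fun t => √t) G = cfcₙ q G := by
    rw [← cfcₙ_mul g (fun t => √t) G hgc hg0 hsc hs0]
    refine cfcₙ_congr fun t ht => ?_
    simp only [hg, hq]
    rw [div_mul_eq_mul_div, Real.mul_self_sqrt (hsp t ht)]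
  have h2 : cfcₙ (fun t => √t) G * cfcₙ (fun t => √t) G = G := by
    rw [← cfcₙ_mul (fun t => √t) (fun t => √t) G hsc hs0 hsc hs0]
    conv_rhs => rw [← hid]
    exact cfcₙ_congr fun t ht => Real.mul_self_sqrt (hsp t ht)
  have h3 : cfcₙ g G * G * cfcₙ g G = cfcₙ (fun t => g t * t * g t) G := by
    conv_lhs => enter [1, 2]; rw [← hid]
    rw [← cfcₙ_mul g (fun t => t) G hgc hg0 continuousOn_id rfl,
      ← cfcₙ_mul (fun t => g t * t) g G (hgc.mul continuousOn_id) (by simp) hgc hg0]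
  have hqG : cfcₙ q G * G = cfcₙ (fun t => q t * t) G := by
    conv_lhs => enter [2]; rw [← hid]
    rw [← cfcₙ_mul q (fun t => t) G hqc hq0 continuousOn_id rfl]
  have hGq : G * cfcₙ q G = cfcₙ (fun t => t * q t) G := by
    conv_lhs => enter [1]; rw [← hid]
    rw [← cfcₙ_mul (fun t => t) q G continuousOn_id rfl hqc hq0]
  have h4 : G - cfcₙ q G * G - G * cfcₙ q G + cfcₙ q G * G * cfcₙ q G =
      cfcₙ (fun t => t - q t * t - t * q t + q t * t * q t) G := by
    have c1 : ContinuousOn (fun t => q t * t) (quasispectrum ℝ G) := hqc.mul continuousOn_id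
    have c2 : ContinuousOn (fun t => t * q t) (quasispectrum ℝ G) := continuousOn_id.mul hqc
    rw [hqG, hGq, ← cfcₙ_mul (fun t => q t * t) q G c1 (by simp) hqc hq0]
    conv_lhs => enter [1, 1, 1]; rw [← hid]
    rw [← cfcₙ_sub (fun t => t) (fun t => q t * t) G continuousOn_id rfl c1 (by simp),
      ← cfcₙ_sub (fun t => t - q t * t) (fun t => t * q t) G (continuousOn_id.sub c1) (by simp)
        c2 (by simp),
      ← cfcₙ_add (fun t => t - q t * t - t * q t) (fun t => q t * t * q t) G
        ((continuousOn_id.sub c1).sub c2) (by simp) (c1.mul hqc) (by simp)]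
  refine ⟨cfcₙ g G, cfcₙ (fun t => √t) G, cfcₙ q G, (cfcₙ_predicate g G).star_eq,
    (cfcₙ_predicate (fun t => √t) G).star_eq, (cfcₙ_predicate q G).star_eq, h1, h2, ?_, ?_⟩
  · rw [h3]
    refine norm_cfcₙ_le fun t ht => ?_
    have ht0 := hsp t ht
    have h5 : g t * t * g t = (t / (t + ε)) ^ 2 := by
      simp only [hg]
      rw [div_mul_eq_mul_div, div_mul_div_comm, div_pow, mul_right_comm, Real.mul_self_sqrt ht0]
      ring
    have h6 : t / (t + ε) ≤ 1 := (div_le_one (by linarith)).mpr (by linarith)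
    have h7 : 0 ≤ t / (t + ε) := by positivity
    rw [h5, Real.norm_of_nonneg (sq_nonneg _)]
    nlinarith
  · rw [h4]
    refine norm_cfcₙ_le fun t ht => ?_
    have ht0 := hsp t ht
    have h5 : t - q t * t - t * q t + q t * t * q t = ε * (t / (t + ε) * (ε / (t + ε))) := by
      simp only [hq]
      field_simp
      ring
    have h6 : t / (t + ε) ≤ 1 := (div_le_one (by linarith)).mpr (by linarith)
    have h7 : 0 ≤ t / (t + ε) := by positivity
    have h8 : ε / (t + ε) ≤ 1 := (div_le_one (by linarith)).mpr (by linarith)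
    have h9 : 0 ≤ ε / (t + ε) := by positivity
    rw [h5, Real.norm_of_nonneg (by positivity)]
    have : t / (t + ε) * (ε / (t + ε)) ≤ 1 := by nlinarith
    nlinarith

/-- A completely bounded covariant representation of the correspondence `E` on the Hilbert space
of the representation `σ` carried by `H`. In the complete boundedness, `∑ₗ ⟪ξ l i, ξ l j⟫` is the
Gram matrix of `ξ ∈ M_n(E)`, whose norm is the square of the norm of `ξ` in `M_n(E)`, and the
matrix `(op (ξ i j))` acts on the Hilbert space sum of `n` copies of `H`. -/
structure CovRep (E : Corr.{u} A) (H : HRep.{u} A) where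
  op : E →ₗ[ℂ] (H →L[ℂ] H)
  op_left : ∀ a ξ, op (E.left a ξ) = H.σ a ∘L op ξ
  op_right : ∀ b ξ, op (E.right b ξ) = op ξ ∘L H.σ b
  completely_bounded : ∃ C : ℝ, 0 ≤ C ∧ ∀ (n : ℕ) (ξ : Fin n → Fin n → E) (h : Fin n → H),
    ∑ i, ‖∑ j, op (ξ i j) (h j)‖ ^ 2 ≤
      C ^ 2 * ‖(CStarMatrix.ofMatrix (Matrix.of fun i j => ∑ l, E.ip (ξ l i) (ξ l j)) :
        CStarMatrix (Fin n) (Fin n) A)‖ * ∑ j, ‖h j‖ ^ 2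

section tildeBound
variable {E : Corr.{u} A} {H : HRep.{u} A}

/-- The Gram matrix. -/
def Corr.gram (E : Corr.{u} A) {n : ℕ} (ξ : Fin n → E) : CStarMatrix (Fin n) (Fin n) A :=
  CStarMatrix.ofMatrix (Matrix.of fun i j => E.ip (ξ i) (ξ j))

theorem Corr.gram_apply {n : ℕ} (ξ : Fin n → E) (i j : Fin n) :
    E.gram ξ i j = E.ip (ξ i) (ξ j) := rfl

/-- A row vector times a matrix. -/
def Corr.rowMul {n : ℕ} (ξ : Fin n → E) (c : CStarMatrix (Fin n) (Fin n) A) : Fin n → E :=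
  fun j => ∑ i, E.right (c i j) (ξ i)

/-- A matrix times a column vector. -/
def HRep.colMul {n : ℕ} (c : CStarMatrix (Fin n) (Fin n) A) (h : Fin n → H) : Fin n → H :=
  fun i => ∑ j, H.σ (c i j) (h j)

theorem HRep.colMul_mul {n : ℕ} (c d : CStarMatrix (Fin n) (Fin n) A) (h : Fin n → H) :
    HRep.colMul (c * d) h = HRep.colMul c (HRep.colMul d h) := by
  funext i
  simp only [HRep.colMul, CStarMatrix.mul_apply, map_sum, map_mul, _root_.sum_apply,
    mul_apply_eq_comp]
  rw [Finset.sum_comm]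

theorem Corr.ip_right' (x y : E) (b : A) : E.ip x (E.right b y) = E.ip x y * b := E.ip_smul x y b

theorem Corr.ip_right_left (x y : E) (b : A) : E.ip (E.right b x) y = star b * E.ip x y := by
  rw [← E.star_ip, E.ip_right', star_mul, E.star_ip]

theorem Corr.ip_sum_right {ι : Type*} (s : Finset ι) (x : E) (y : ι → E) :
    E.ip x (∑ i ∈ s, y i) = ∑ i ∈ s, E.ip x (y i) := map_sum (E.sform.form x) y s

theorem Corr.ip_sum_left {ι : Type*} (s : Finset ι) (x : ι → E) (y : E) :
    E.ip (∑ i ∈ s, x i) y = ∑ i ∈ s, E.ip (x i) y := by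
  rw [← E.star_ip, E.ip_sum_right, star_sum]
  simp only [E.star_ip]

theorem Corr.ip_sub_right (x y z : E) : E.ip x (y - z) = E.ip x y - E.ip x z :=
  map_sub (E.sform.form x) y z

theorem Corr.ip_sub_left (x y z : E) : E.ip (x - y) z = E.ip x z - E.ip y z := by
  rw [← E.star_ip, E.ip_sub_right, star_sub, E.star_ip, E.star_ip]

theorem Corr.gram_rowMul {n : ℕ} (ξ : Fin n → E) (c : CStarMatrix (Fin n) (Fin n) A) :
    E.gram (Corr.rowMul ξ c) = star c * E.gram ξ * c := by
  ext i j
  simp only [Corr.gram_apply, Corr.rowMul, E.ip_sum_left, E.ip_sum_right, Corr.ip_right',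
    Corr.ip_right_left, CStarMatrix.mul_apply, CStarMatrix.star_apply, Finset.sum_mul]
  rw [Finset.sum_comm]

theorem Corr.gram_sub_rowMul {n : ℕ} (ξ : Fin n → E) (c : CStarMatrix (Fin n) (Fin n) A) :
    E.gram (ξ - Corr.rowMul ξ c) =
      E.gram ξ - star c * E.gram ξ - E.gram ξ * c + star c * E.gram ξ * c := by
  rw [← Corr.gram_rowMul]
  ext i j
  simp only [Corr.gram_apply, Pi.sub_apply, CStarMatrix.add_apply, CStarMatrix.sub_apply,
    CStarMatrix.mul_apply, CStarMatrix.star_apply, E.ip_sub_left, E.ip_sub_right]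
  have h1 : E.ip (ξ i) (Corr.rowMul ξ c j) = ∑ k, E.ip (ξ i) (ξ k) * c k j := by
    simp only [Corr.rowMul, E.ip_sum_right, Corr.ip_right']
  have h2 : E.ip (Corr.rowMul ξ c i) (ξ j) = ∑ k, star (c k i) * E.ip (ξ k) (ξ j) := by
    simp only [Corr.rowMul, E.ip_sum_left, Corr.ip_right_left]
  rw [h1, h2]
  abel

/-- The row operator `h ↦ ∑ A(ξ j) h j`. -/
def CovRep.row (V : CovRep E H) {n : ℕ} (ξ : Fin n → E) (h : Fin n → H) : H :=
  ∑ j, V.op (ξ j) (h j)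

theorem CovRep.row_rowMul (V : CovRep E H) {n : ℕ} (ξ : Fin n → E)
    (c : CStarMatrix (Fin n) (Fin n) A) (h : Fin n → H) :
    V.row (Corr.rowMul ξ c) h = V.row ξ (HRep.colMul c h) := by
  simp only [CovRep.row, Corr.rowMul, HRep.colMul, map_sum, _root_.sum_apply,
    V.op_right, ContinuousLinearMap.comp_apply]
  rw [Finset.sum_comm]

theorem CovRep.row_bound (V : CovRep E H) : ∃ C : ℝ, 0 ≤ C ∧ ∀ (n : ℕ) (ξ : Fin n → E)
    (h : Fin n → H), ‖V.row ξ h‖ ^ 2 ≤ C ^ 2 * ‖E.gram ξ‖ * ∑ j, ‖h j‖ ^ 2 := by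
  obtain ⟨C, hC0, hC⟩ := V.completely_bounded
  refine ⟨C, hC0, fun n ξ h => ?_⟩
  rcases n with _ | n
  · simp [CovRep.row]
  have h1 := hC (n + 1) (fun i j => if i = 0 then ξ j else 0) h
  have h2 : (CStarMatrix.ofMatrix (Matrix.of fun i j => ∑ l : Fin (n + 1),
      E.ip (if l = 0 then ξ i else 0) (if l = 0 then ξ j else 0)) :
        CStarMatrix (Fin (n + 1)) (Fin (n + 1)) A) = E.gram ξ := by
    ext i j
    change ∑ l : Fin (n + 1), E.ip (if l = 0 then ξ i else 0) (if l = 0 then ξ j else 0) = _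
    rw [Finset.sum_eq_single 0]
    · simp only [if_true]; rfl
    · intro l _ hl
      simp only [hl, if_false]
      exact map_zero (E.sform.form 0)
    · simp
  rw [h2] at h1
  refine le_trans ?_ h1
  have h3 := Finset.single_le_sum (f := fun i : Fin (n + 1) =>
    ‖∑ j, V.op (if i = 0 then ξ j else 0) (h j)‖ ^ 2) (fun i _ => sq_nonneg _)
    (Finset.mem_univ 0)
  simpa [CovRep.row] using h3

theorem HRep.tensForm_sum {n : ℕ} (ξ : Fin n → E) (h : Fin n → H) :
    ((‖HRep.tensMap E H (∑ i, ξ i ⊗ₜ h i)‖ ^ 2 : ℝ) : ℂ) =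
      ∑ i, ∑ j, inner ℂ (h i) (H.σ (E.gram ξ i j) (h j)) := by
  have h1 := inner_self_eq_norm_sq_to_K (𝕜 := ℂ) (HRep.tensMap E H (∑ i, ξ i ⊗ₜ h i))
  rw [Complex.ofReal_pow]
  refine h1.symm.trans ?_
  simp only [map_sum, inner_sum, sum_inner]
  rw [Finset.sum_comm]
  exact Finset.sum_congr rfl fun i _ => Finset.sum_congr rfl fun j _ =>
    HRep.inner_tmul (ξ i) (ξ j) (h i) (h j)

theorem HRep.sum_colMul {n : ℕ} (s : CStarMatrix (Fin n) (Fin n) A) (h : Fin n → H) :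
    ((∑ k, ‖HRep.colMul s h k‖ ^ 2 : ℝ) : ℂ) =
      ∑ i, ∑ j, inner ℂ (h i) (H.σ ((star s * s) i j) (h j)) := by
  have h1 : ∀ k, ((‖HRep.colMul s h k‖ ^ 2 : ℝ) : ℂ) =
      ∑ i, ∑ j, inner ℂ (h i) (H.σ (star (s k i) * s k j) (h j)) := fun k => by
    rw [Complex.ofReal_pow]
    refine (inner_self_eq_norm_sq_to_K (𝕜 := ℂ) (HRep.colMul s h k)).symm.trans ?_
    simp only [HRep.colMul, inner_sum, sum_inner, map_mul, mul_apply_eq_comp]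
    rw [Finset.sum_comm]
    simp only [HRep.act_adj]
  rw [Complex.ofReal_sum]
  simp only [h1, CStarMatrix.mul_apply, CStarMatrix.star_apply, map_sum,
    _root_.sum_apply, inner_sum]
  rw [Finset.sum_comm]
  refine Finset.sum_congr rfl fun i _ => ?_
  rw [Finset.sum_comm]

theorem CovRep.tilde_bound (V : CovRep E H) : ∃ C : ℝ, ∀ (n : ℕ) (ξ : Fin n → E)
    (h : Fin n → H), ‖V.row ξ h‖ ≤ C * ‖HRep.tensMap E H (∑ i, ξ i ⊗ₜ h i)‖ := by
  obtain ⟨C, hC0, hC⟩ := V.row_bound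
  refine ⟨C, fun n ξ h => ?_⟩
  have hC' : ∀ (η : Fin n → E) (k : Fin n → H) (B : ℝ), ‖E.gram η‖ ≤ B →
      ‖V.row η k‖ ≤ C * (√B * √(∑ j, ‖k j‖ ^ 2)) := fun η k B hB => by
    have h1 : 0 ≤ ∑ j, ‖k j‖ ^ 2 := Finset.sum_nonneg fun _ _ => sq_nonneg _
    have hB0 := (norm_nonneg _).trans hB
    rw [← sq_le_sq₀ (norm_nonneg _) (by positivity), mul_pow, mul_pow, Real.sq_sqrt hB0,
      Real.sq_sqrt h1, ← mul_assoc]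
    exact (hC n η k).trans (by gcongr)
  set N := ‖HRep.tensMap E H (∑ i, ξ i ⊗ₜ h i)‖ with hN
  set K := √(∑ j, ‖h j‖ ^ 2) with hK
  have key : ∀ δ : ℝ, 0 < δ → ‖V.row ξ h‖ ≤ C * N + C * K * δ := fun δ hδ => by
    obtain ⟨b, s, p, hb, hs, hp, hbs, hss, h1, h2⟩ := approx_lemma (E.gram ξ) (E.gram_nonneg ξ)
      (δ ^ 2) (by positivity)
    have e1 : V.row ξ h = V.row (Corr.rowMul ξ b) (HRep.colMul s h) +
        V.row (ξ - Corr.rowMul ξ p) h := by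
      rw [CovRep.row_rowMul, ← HRep.colMul_mul, hbs, ← CovRep.row_rowMul]
      simp only [CovRep.row, Pi.sub_apply, map_sub, _root_.sub_apply,
        Finset.sum_sub_distrib]
      abel
    have e2 : √(∑ j, ‖HRep.colMul s h j‖ ^ 2) = N := by
      have h3 := HRep.sum_colMul s h
      rw [hs, hss, ← HRep.tensForm_sum] at h3
      have h4 := Complex.ofReal_injective h3
      rw [h4, Real.sqrt_sq (norm_nonneg _)]
    have e3 := hC' (Corr.rowMul ξ b) (HRep.colMul s h) 1 (by rw [Corr.gram_rowMul, hb]; exact h1)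
    have e4 := hC' (ξ - Corr.rowMul ξ p) h (δ ^ 2) (by rw [Corr.gram_sub_rowMul, hp]; exact h2)
    rw [e2, Real.sqrt_one, one_mul] at e3
    rw [Real.sqrt_sq hδ.le] at e4
    rw [e1]
    refine (norm_add_le _ _).trans ?_
    linarith [mul_comm δ K, mul_assoc C K δ]
  refine le_of_forall_pos_le_add fun ε hε => ?_
  have hKC : 0 ≤ C * K := mul_nonneg hC0 (Real.sqrt_nonneg _)
  have := key (ε / (C * K + 1)) (by positivity)
  refine this.trans ?_
  have h5 : C * K * (ε / (C * K + 1)) ≤ ε := by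
    rw [mul_div_assoc', div_le_iff₀ (by positivity)]
    nlinarith
  linarith

end tildeBound

namespace CovRep
variable {E : Corr.{u} A} {H : HRep.{u} A} (V : CovRep E H)

/-- `ξ ⊗ h ↦ A(ξ) h` on the algebraic tensor product. -/
def tildeAlg : E ⊗[ℂ] H →ₗ[ℂ] H :=
  TensorProduct.lift ((ContinuousLinearMap.coeLM ℂ) ∘ₗ V.op)

theorem tildeAlg_bound : ∃ C : ℝ, ∀ z, ‖V.tildeAlg z‖ ≤ C * ‖HRep.tensMap E H z‖ := by
  obtain ⟨C, hC⟩ := V.tilde_bound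
  refine ⟨C, fun z => ?_⟩
  obtain ⟨n, ξ, h, rfl⟩ := TensorProduct.exists_sum_tmul_eq z
  refine le_trans (le_of_eq ?_) (hC n ξ h)
  simp [tildeAlg, row]

/-- The operator `Ã : E ⊗_σ H → H` with `Ã(ξ ⊗ h) = A(ξ) h`. -/
def tilde : HRep.tens E H →L[ℂ] H := V.tildeAlg.extendOfNorm (HRep.tensMap E H)

theorem tilde_tmul (ξ : E) (h : H) : V.tilde (HRep.tmul E H ξ h) = V.op ξ h := by
  refine (LinearMap.extendOfNorm_eq (HRep.dense_tensMap E H) V.tildeAlg_bound _).trans ?_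
  simp [tildeAlg]

theorem tilde_σ (a : A) (z : HRep.tens E H) :
    V.tilde ((HRep.tens E H).σ a z) = H.σ a (V.tilde z) := by
  have h : V.tilde ∘L (HRep.tens E H).σ a = H.σ a ∘L V.tilde := HRep.tens_ext fun ξ x => by
    rw [ContinuousLinearMap.comp_apply, ContinuousLinearMap.comp_apply, HRep.tens_σ_tmul,
      V.tilde_tmul, V.tilde_tmul, V.op_left]
    rfl
  exact congrArg (fun T => T z) h

end CovRep

namespace HRep
section
variable {E : Corr.{u} A} {H : HRep.{u} A}

theorem norm_σ_le (a : A) (h : H) : ‖H.σ a h‖ ≤ ‖a‖ * ‖h‖ :=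
  norm_apply_le_of_adj H.act H.act_adj a h

theorem norm_tmul_le (ξ : E) (h : H) : ‖tmul E H ξ h‖ ≤ ‖ξ‖ * ‖h‖ := by
  rw [← sq_le_sq₀ (norm_nonneg _) (by positivity), ← inner_self_eq_norm_sq (𝕜 := ℂ), inner_tmul]
  refine (RCLike.re_le_norm _).trans ((norm_inner_le_norm _ _).trans ?_)
  have := H.norm_σ_le (E.ip ξ ξ) h
  rw [E.norm_ip_self] at this
  nlinarith [norm_nonneg h]

/-- The elementary tensors as a bilinear map. -/
def tmulL : E →L[ℂ] H →L[ℂ] tens E H :=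
  LinearMap.mkContinuous₂ ((TensorProduct.mk ℂ E H).compr₂ (tensMap E H)) 1
    fun ξ h => by rw [one_mul]; exact norm_tmul_le ξ h

theorem tmulL_apply (ξ : E) (h : H) : tmulL ξ h = tmul E H ξ h := rfl

theorem dense_of_tmul (S : Submodule ℂ (tens E H))
    (h : ∀ ξ x, tmul E H ξ x ∈ S.topologicalClosure) : Dense (S : Set (tens E H)) := by
  have h1 : ∀ z, tensMap E H z ∈ S.topologicalClosure := fun z => by
    induction z with
    | zero => simp
    | add z w hz hw => rw [map_add]; exact add_mem hz hw
    | tmul ξ x => exact h ξ x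
  intro z
  have h2 : closure (Set.range (tensMap E H)) ⊆ S.topologicalClosure :=
    closure_minimal (by rintro _ ⟨z, rfl⟩; exact h1 z) S.isClosed_topologicalClosure
  exact h2 (dense_tensMap E H z)
end

section amp
variable (E : Corr.{u} A) {H H' : HRep.{u} A}

/-- The operator `I_E ⊗ T : E ⊗ H → E ⊗ H'`, for `T` that intertwines the representations. -/
def amp (T : H →L[ℂ] H') : tens E H →L[ℂ] tens E H' :=
  ((tensMap E H') ∘ₗ (T : H →ₗ[ℂ] H').lTensor E).extendOfNorm (tensMap E H)

theorem amp_bound (T : H →L[ℂ] H') (hT : ∀ a x, T (H.σ a x) = H'.σ a (T x)) (z : E ⊗[ℂ] H) :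
    ‖tensMap E H' ((T : H →ₗ[ℂ] H').lTensor E z)‖ ≤ ‖T‖ * ‖tensMap E H z‖ := by
  obtain ⟨n, ξ, h, rfl⟩ := TensorProduct.exists_sum_tmul_eq z
  obtain ⟨s, hs⟩ := exists_star_mul_self _ (E.gram_nonneg ξ)
  have h1 : ∀ (K : HRep.{u} A) (k : Fin n → K),
      ‖tensMap E K (∑ i, ξ i ⊗ₜ k i)‖ ^ 2 = ∑ i, ‖colMul s k i‖ ^ 2 := fun K k =>
    Complex.ofReal_injective (by
      rw [tensForm_sum, sum_colMul, ← hs]; rfl)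
  have h2 : (T : H →ₗ[ℂ] H').lTensor E (∑ i, ξ i ⊗ₜ h i) = ∑ i, ξ i ⊗ₜ T (h i) := by simp
  have h3 : ∀ i, colMul s (fun i => T (h i)) i = T (colMul s h i) := fun i => by
    simp only [colMul, map_sum, hT]
  rw [← sq_le_sq₀ (norm_nonneg _) (by positivity), mul_pow, h2, h1 H' (fun i => T (h i)), h1,
    Finset.mul_sum]
  refine Finset.sum_le_sum fun i _ => ?_
  rw [h3, ← mul_pow]
  exact pow_le_pow_left₀ (norm_nonneg _) (T.le_opNorm _) 2

theorem amp_tmul (T : H →L[ℂ] H') (hT : ∀ a x, T (H.σ a x) = H'.σ a (T x)) (ξ : E) (h : H) :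
    amp E T (tmul E H ξ h) = tmul E H' ξ (T h) :=
  LinearMap.extendOfNorm_eq (dense_tensMap E H) ⟨‖T‖, amp_bound E T hT⟩ (ξ ⊗ₜ h)

theorem amp_σ (T : H →L[ℂ] H') (hT : ∀ a x, T (H.σ a x) = H'.σ a (T x)) (a : A)
    (z : tens E H) : amp E T ((tens E H).σ a z) = (tens E H').σ a (amp E T z) := by
  have h : amp E T ∘L (tens E H).σ a = (tens E H').σ a ∘L amp E T := tens_ext fun ξ x => by
    simp only [ContinuousLinearMap.comp_apply, tens_σ_tmul, amp_tmul E T hT]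
  exact congrArg (fun T => T z) h
end amp

section assoc
variable (E F : Corr.{u} A) (H : HRep.{u} A)

/-- `(ξ ⊗ x) ⊗ h` on the algebraic tensor product. -/
def assocL : (E ⊗[ℂ] F) ⊗[ℂ] H →ₗ[ℂ] tens (E.tens F) H :=
  tensMap (E.tens F) H ∘ₗ (Corr.tensMap E F).rTensor H

/-- `ξ ⊗ (x ⊗ h)` on the algebraic tensor product. -/
def assocR : E ⊗[ℂ] (F ⊗[ℂ] H) →ₗ[ℂ] tens E (tens F H) :=
  tensMap E (tens F H) ∘ₗ (tensMap F H).lTensor E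

theorem dense_assocL : DenseRange (assocL E F H) := by
  have h := dense_of_tmul (E := E.tens F) (H := H) (LinearMap.range (assocL E F H)) fun z h => by
    refine (Corr.dense_tensMap E F).induction_on (p := fun z => tmul (E.tens F) H z h ∈
      (LinearMap.range (assocL E F H)).topologicalClosure) z ?_ fun t => ?_
    · exact (Submodule.isClosed_topologicalClosure _).preimage
        ((ContinuousLinearMap.flip tmulL h).continuous)
    · exact Submodule.le_topologicalClosure _ ⟨t ⊗ₜ h, rfl⟩
  exact h

theorem dense_assocR : DenseRange (assocR E F H) := by
  have h := dense_of_tmul (E := E) (H := tens F H) (LinearMap.range (assocR E F H)) fun ξ z => by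
    refine (dense_tensMap F H).induction_on (p := fun z => tmul E (tens F H) ξ z ∈
      (LinearMap.range (assocR E F H)).topologicalClosure) z ?_ fun t => ?_
    · exact (Submodule.isClosed_topologicalClosure _).preimage (tmulL ξ).continuous
    · exact Submodule.le_topologicalClosure _ ⟨ξ ⊗ₜ t, rfl⟩
  exact h

theorem assoc_inner (z w : (E ⊗[ℂ] F) ⊗[ℂ] H) :
    inner ℂ (assocR E F H (TensorProduct.assoc ℂ E F H z))
      (assocR E F H (TensorProduct.assoc ℂ E F H w)) =
    inner ℂ (assocL E F H z) (assocL E F H w) := by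
  induction z with
  | zero => simp
  | add z z' hz hz' => simp only [map_add, inner_add_left, hz, hz']
  | tmul t h =>
    induction w with
    | zero => simp
    | add w w' hw hw' => simp only [map_add, inner_add_right, hw, hw']
    | tmul r k =>
      induction t with
      | zero => simp
      | add t t' ht ht' => simp only [TensorProduct.add_tmul, map_add, inner_add_left, ht, ht']
      | tmul ξ x =>
        induction r with
        | zero => simp
        | add r r' hr hr' =>
          simp only [TensorProduct.add_tmul, map_add, inner_add_right, hr, hr']
        | tmul η y =>
          change inner ℂ (tmul E (tens F H) ξ (tmul F H x h)) (tmul E (tens F H) η (tmul F H y k))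
            = inner ℂ (tmul (E.tens F) H (Corr.tmul E F ξ x) h)
              (tmul (E.tens F) H (Corr.tmul E F η y) k)
          rw [inner_tmul, tens_σ_tmul, inner_tmul, inner_tmul, Corr.ip_tmul]

/-- The canonical unitary `(E ⊗ F) ⊗ H ≃ E ⊗ (F ⊗ H)`. -/
def assoc : tens (E.tens F) H ≃ₗᵢ[ℂ] tens E (tens F H) :=
  (TensorProduct.assoc ℂ E F H).extendOfIsometry (assocL E F H) (assocR E F H)
    (dense_assocL E F H) (dense_assocR E F H) fun z => by
      have h := congrArg RCLike.re (assoc_inner E F H z z)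
      rw [inner_self_eq_norm_sq, inner_self_eq_norm_sq] at h
      exact (sq_eq_sq₀ (norm_nonneg _) (norm_nonneg _)).mp h

theorem assoc_tmul (ξ : E) (x : F) (h : H) :
    assoc E F H (tmul (E.tens F) H (Corr.tmul E F ξ x) h) = tmul E (tens F H) ξ (tmul F H x h) :=
  LinearEquiv.extendOfIsometry_eq _ _ _ (dense_assocL E F H) (dense_assocR E F H) _
    ((ξ ⊗ₜ x) ⊗ₜ h)

end assoc

section iso
variable {E F : Corr.{u} A} (w : Corr.Iso E F) (H : HRep.{u} A)

theorem iso_inner (z z' : E ⊗[ℂ] H) :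
    inner ℂ (tensMap F H (w.toEquiv.rTensor H z)) (tensMap F H (w.toEquiv.rTensor H z')) =
    inner ℂ (tensMap E H z) (tensMap E H z') := by
  induction z with
  | zero => simp
  | add z z' hz hz' => simp only [map_add, inner_add_left, hz, hz']
  | tmul t h =>
    induction z' with
    | zero => simp
    | add w w' hw hw' => simp only [map_add, inner_add_right, hw, hw']
    | tmul r k =>
      change inner ℂ (tmul F H (w.toEquiv t) h) (tmul F H (w.toEquiv r) k) =
        inner ℂ (tmul E H t h) (tmul E H r k)
      rw [inner_tmul, inner_tmul, w.ip_map]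

/-- The unitary `w ⊗ I_H : E ⊗ H ≃ F ⊗ H`. -/
def ampIso : tens E H ≃ₗᵢ[ℂ] tens F H :=
  (w.toEquiv.rTensor H).extendOfIsometry (tensMap E H) (tensMap F H)
    (dense_tensMap E H) (dense_tensMap F H) fun z => by
      have h := congrArg RCLike.re (iso_inner w H z z)
      rw [inner_self_eq_norm_sq, inner_self_eq_norm_sq] at h
      exact (sq_eq_sq₀ (norm_nonneg _) (norm_nonneg _)).mp h

theorem ampIso_tmul (ξ : E) (h : H) :
    ampIso w H (tmul E H ξ h) = tmul F H (w.toEquiv ξ) h :=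
  LinearEquiv.extendOfIsometry_eq _ _ _ (dense_tensMap E H) (dense_tensMap F H) _ (ξ ⊗ₜ h)

end iso

/-- For `w : E ⊗ F ≃ F ⊗ E`, the unitary `w ⊗ I_H : E ⊗ F ⊗ H ≃ F ⊗ E ⊗ H`. -/
def flipIso {E F : Corr.{u} A} (w : Corr.Iso (E.tens F) (F.tens E)) (H : HRep.{u} A) :
    tens E (tens F H) ≃ₗᵢ[ℂ] tens F (tens E H) :=
  (assoc E F H).symm.trans ((ampIso w H).trans (assoc F E H))

end HRep

theorem HRep.adjoint_σ {H H' : HRep.{u} A} (T : H →L[ℂ] H')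
    (hT : ∀ a x, T (H.σ a x) = H'.σ a (T x)) (a : A) (y : H') :
    ContinuousLinearMap.adjoint T (H'.σ a y) = H.σ a (ContinuousLinearMap.adjoint T y) := by
  refine ext_inner_right ℂ fun x => ?_
  rw [ContinuousLinearMap.adjoint_inner_left, H'.act_adj, ← hT, H.act_adj,
    ContinuousLinearMap.adjoint_inner_left]

/-- The Hilbert space `E^{⊗ n} ⊗ H`, realized as `E ⊗ (E ⊗ ⋯ ⊗ (E ⊗ H))`. -/
def HRep.pow (E : Corr.{u} A) (H : HRep.{u} A) : ℕ → HRep.{u} A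
  | 0 => H
  | n + 1 => HRep.tens E (HRep.pow E H n)

/-- The elementary tensors `ξ₁ ⊗ ⋯ ⊗ ξₙ ⊗ h` with `h ∈ S`. -/
def HRep.powSet (E : Corr.{u} A) (H : HRep.{u} A) (S : Set H) : (n : ℕ) → Set (HRep.pow E H n)
  | 0 => S
  | n + 1 => {z | ∃ ξ : E, ∃ w ∈ HRep.powSet E H S n, z = HRep.tmul E (HRep.pow E H n) ξ w}

/-- The subspace `E^{⊗ n} ⊗ S` of `E^{⊗ n} ⊗ H`. -/
def HRep.powSub (E : Corr.{u} A) (H : HRep.{u} A) (n : ℕ) (S : Submodule ℂ H) :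
    Submodule ℂ (HRep.pow E H n) :=
  (Submodule.span ℂ (HRep.powSet E H S n)).topologicalClosure

/-- The subspace `E ⊗ S` of `E ⊗ H`. -/
def HRep.tensSub (E : Corr.{u} A) (H : HRep.{u} A) (S : Submodule ℂ H) :
    Submodule ℂ (HRep.tens E H) :=
  (Submodule.span ℂ {z | ∃ ξ : E, ∃ h ∈ S, z = HRep.tmul E H ξ h}).topologicalClosure

namespace CovRep
variable {E : Corr.{u} A} {H : HRep.{u} A} (V : CovRep E H)

/-- The operators `Ãₙ : E^{⊗ n} ⊗ H → H`, with `Ã₀ = I` and `Ãₙ₊₁ = Ã (I_E ⊗ Ãₙ)`. -/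
def tildePow : (n : ℕ) → HRep.pow E H n →L[ℂ] H
  | 0 => ContinuousLinearMap.id ℂ H
  | n + 1 => V.tilde ∘L HRep.amp E (tildePow n)

/-- The operators `I_{E^{⊗ n}} ⊗ Ã : E^{⊗ (n + 1)} ⊗ H → E^{⊗ n} ⊗ H`. -/
def lastPow : (n : ℕ) → HRep.pow E H (n + 1) →L[ℂ] HRep.pow E H n
  | 0 => V.tilde
  | n + 1 => HRep.amp E (lastPow n)

theorem tildePow_σ (n : ℕ) (a : A) (z : HRep.pow E H n) :
    V.tildePow n ((HRep.pow E H n).σ a z) = H.σ a (V.tildePow n z) := by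
  induction n generalizing a with
  | zero => rfl
  | succ n ih =>
    exact (congrArg V.tilde (HRep.amp_σ E (V.tildePow n) (fun a x => ih a x) a z)).trans
      (V.tilde_σ a (HRep.amp E (V.tildePow n) z))

theorem tildePow_succ_tmul (n : ℕ) (ξ : E) (z : HRep.pow E H n) :
    V.tildePow (n + 1) (HRep.tmul E (HRep.pow E H n) ξ z) = V.op ξ (V.tildePow n z) := by
  change V.tilde (HRep.amp E (V.tildePow n) (HRep.tmul E (HRep.pow E H n) ξ z)) = _
  rw [HRep.amp_tmul E (V.tildePow n) (V.tildePow_σ n), V.tilde_tmul]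

theorem lastPow_σ (n : ℕ) (a : A) (z : HRep.pow E H (n + 1)) :
    V.lastPow n ((HRep.pow E H (n + 1)).σ a z) = (HRep.pow E H n).σ a (V.lastPow n z) := by
  induction n generalizing a with
  | zero => exact V.tilde_σ a z
  | succ n ih => exact HRep.amp_σ E (V.lastPow n) (fun a x => ih a x) a z

theorem lastPow_succ_tmul (n : ℕ) (ξ : E) (z : HRep.pow E H (n + 1)) :
    V.lastPow (n + 1) (HRep.tmul E (HRep.pow E H (n + 1)) ξ z) =
      HRep.tmul E (HRep.pow E H n) ξ (V.lastPow n z) :=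
  HRep.amp_tmul E (V.lastPow n) (V.lastPow_σ n) ξ z

/-- The vectors `A(ξ₁) ⋯ A(ξₙ) h` with `h ∈ S`. -/
def products (S : Set H) : ℕ → Set H
  | 0 => S
  | n + 1 => {z | ∃ ξ : E, ∃ w ∈ products S n, z = V.op ξ w}

/-- The closed subspace `𝔄ₙ(S)`. -/
def frak (n : ℕ) (S : Submodule ℂ H) : Submodule ℂ H :=
  (Submodule.span ℂ (V.products S n)).topologicalClosure

/-- The closed subspace `S` reduces `(σ, A)`. -/
def Reduces (S : Submodule ℂ H) : Prop :=
  IsClosed (S : Set H) ∧ (∀ a, ∀ h ∈ S, H.σ a h ∈ S) ∧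
    ∀ ξ, (∀ h ∈ S, V.op ξ h ∈ S) ∧ ∀ h ∈ Sᗮ, V.op ξ h ∈ Sᗮ

/-- The restriction of `(σ, A)` to `S` is invertible: `Ã` maps `E ⊗ S` bijectively onto `S`. -/
def InvertibleOn (S : Submodule ℂ H) : Prop :=
  Set.BijOn V.tilde (HRep.tensSub E H S) S

/-- The wandering subspace `H ⊖ Ã(E ⊗ H)`. -/
def wandering : Submodule ℂ H := (LinearMap.range (V.tilde : HRep.tens E H →ₗ[ℂ] H))ᗮ

/-- The intersection of the ranges of the operators `Ãₙ`. -/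
def core : Submodule ℂ H := ⨅ n, LinearMap.range (V.tildePow n : HRep.pow E H n →ₗ[ℂ] H)

/-- `(σ, A)` is left-invertible: `Ã` is bounded below. -/
def LeftInvertible : Prop := ∃ δ : ℝ, 0 < δ ∧ ∀ x, δ * ‖x‖ ≤ ‖V.tilde x‖

/-- `(σ, A)` admits a Wold-type decomposition: the space is the orthogonal sum of the closed
subspace generated by the wandering subspace and of the intersection of the ranges of the `Ãₙ`,
both are reducing, and the restriction to the second one is invertible. -/
def AdmitsWold : Prop :=
  V.Reduces V.core ∧ V.InvertibleOn V.core ∧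
    (⨆ n, V.frak n V.wandering).topologicalClosure = V.coreᗮ

/-- `(σ, A)` is near-isometric. -/
def NearIsometric : Prop :=
  (∃ δ : ℝ, 0 < δ ∧ ∀ x, δ * ‖x‖ ≤ ‖V.tilde x‖ ∧ ‖V.tilde x‖ ≤ ‖x‖) ∧
    ∀ m, 1 ≤ m → ∀ z, ContinuousLinearMap.adjoint (V.tildePow m) (V.tildePow (m + 1) z) ∈
      HRep.powSub E H m (LinearMap.range (V.tilde : HRep.tens E H →ₗ[ℂ] H))

/-- The operator `Ã₂ = Ã (I_E ⊗ Ã)` on `E ⊗ E ⊗ H`. -/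
def tilde₂ : HRep.tens E (HRep.tens E H) →L[ℂ] H := V.tilde ∘L HRep.amp E V.tilde

/-- `(σ, A)` is concave. -/
def Concave : Prop :=
  ∀ x, ‖V.tilde₂ x‖ ^ 2 + ‖x‖ ^ 2 ≤ 2 * ‖HRep.amp E V.tilde x‖ ^ 2

/-- `‖(I_E ⊗ Ã) ζ + κ‖² ≤ 2 (‖ζ‖² + ‖Ã κ‖²)`. -/
def ShimorinCondition : Prop :=
  ∀ ζ κ, ‖HRep.amp E V.tilde ζ + κ‖ ^ 2 ≤ 2 * (‖ζ‖ ^ 2 + ‖V.tilde κ‖ ^ 2)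

/-- `‖Ã ξ‖² + ‖Ã₂* Ã ξ‖² ≤ 2 ‖Ã* Ã ξ‖²`. -/
def DualCondition : Prop :=
  ∀ ξ, ‖V.tilde ξ‖ ^ 2 + ‖ContinuousLinearMap.adjoint V.tilde₂ (V.tilde ξ)‖ ^ 2 ≤
    2 * ‖ContinuousLinearMap.adjoint V.tilde (V.tilde ξ)‖ ^ 2

/-- `(σ, A)` is expansive and satisfies the growth condition
`‖Ãₘ ξ‖² ≤ lₘ (‖(I_{E^{⊗ (m - 1)}} ⊗ Ã) ξ‖² - ‖ξ‖²) + l ‖ξ‖²` for `m ≥ 1` (below `m = n + 1`) and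
`ξ ∈ E^{⊗ m} ⊗ H`, where `l > 0`, `lₘ > 0` and `∑ 1 / lₘ = ∞`. If `l > 1`, then `(σ, A)` has to be
analytic. -/
def GrowthCondition : Prop :=
  (∀ ξ, ‖ξ‖ ≤ ‖V.tilde ξ‖) ∧ ∃ (c : ℝ) (l : ℕ → ℝ), 0 < c ∧ (∀ m, 0 < l m) ∧
    ¬ Summable (fun m => (l m)⁻¹) ∧
    (∀ (n : ℕ) (ξ : HRep.pow E H (n + 1)), ‖V.tildePow (n + 1) ξ‖ ^ 2 ≤
      l (n + 1) * (‖V.lastPow n ξ‖ ^ 2 - ‖ξ‖ ^ 2) + c * ‖ξ‖ ^ 2) ∧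
    (c ≤ 1 ∨ V.core = ⊥)

end CovRep

/-- A vector annihilated by all tensors `ξ ⊗ ·` is annihilated by `σ`. -/
def HRep.Faithful (E : Corr.{u} A) (H : HRep.{u} A) : Prop :=
  ∀ h : H, (∀ ξ : E, HRep.tmul E H ξ h = 0) → ∀ a, H.σ a h = 0

/-- The hypothesis on each `(σ, A⁽ⁱ⁾)`: it is left-invertible, and it admits a Wold-type
decomposition or satisfies one of the conditions that are known to provide one. -/
def CovRep.WoldHypothesis {E : Corr.{u} A} {H : HRep.{u} A} (V : CovRep E H) : Prop :=
  V.LeftInvertible ∧ (V.AdmitsWold ∨ V.NearIsometric ∨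
    (HRep.Faithful E H ∧ (V.Concave ∨ V.ShimorinCondition ∨ V.DualCondition)) ∨
      V.GrowthCondition)

/-- A doubly twisted completely bounded covariant representation `(σ, A⁽¹⁾, …, A⁽ᵏ⁾)` of the
product system, with its twist `U`. The diagonal entries of `U` play no role. -/
structure DoublyTwistedRep {k : ℕ} (X : ProductSystem.{u} A k) (H : HRep.{u} A) where
  V : ∀ i, CovRep (X.E i) H
  U : Fin k → Fin k → (H →L[ℂ] H)
  U_unitary : ∀ i j, i ≠ j → U i j ∈ unitary (H →L[ℂ] H)
  U_star : ∀ i j, i ≠ j → U j i = star (U i j)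
  U_comm : ∀ i j p q, i ≠ j → p ≠ q → U i j * U p q = U p q * U i j
  U_σ : ∀ i j, i ≠ j → ∀ a, U i j * H.σ a = H.σ a * U i j
  U_tilde : ∀ i j, i ≠ j → ∀ l,
    (V l).tilde ∘L HRep.amp (X.E l) (U i j) = U i j ∘L (V l).tilde
  twisted : ∀ i j, i ≠ j → (V i).tilde ∘L HRep.amp (X.E i) (V j).tilde =
    U i j ∘L (V j).tilde ∘L HRep.amp (X.E j) (V i).tilde ∘L
      (HRep.flipIso (X.u i j) H : HRep.tens (X.E i) (HRep.tens (X.E j) H) →L[ℂ]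
        HRep.tens (X.E j) (HRep.tens (X.E i) H))
  doubly : ∀ i j, i ≠ j → ContinuousLinearMap.adjoint (V j).tilde ∘L (V i).tilde =
    HRep.amp (X.E j) (U i j) ∘L HRep.amp (X.E j) (V i).tilde ∘L
      (HRep.flipIso (X.u i j) H : HRep.tens (X.E i) (HRep.tens (X.E j) H) →L[ℂ]
        HRep.tens (X.E j) (HRep.tens (X.E i) H)) ∘L
      HRep.amp (X.E i) (ContinuousLinearMap.adjoint (V j).tilde)

namespace DoublyTwistedRep
variable {k : ℕ} {X : ProductSystem.{u} A k} {H : HRep.{u} A} (R : DoublyTwistedRep X H)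

/-- The vectors `A⁽ⁱ¹⁾(ξ₁) ⋯ A⁽ⁱʳ⁾(ξᵣ) h` with `h ∈ S`, for a word `i₁ ⋯ iᵣ`. -/
def products (S : Set H) : List (Fin k) → Set H
  | [] => S
  | i :: w => {z | ∃ ξ : X.E i, ∃ y ∈ products S w, z = (R.V i).op ξ y}

/-- The word in which each `i ∈ β`, in increasing order, is repeated `m i` times. -/
def word (β : Finset (Fin k)) (m : Fin k → ℕ) : List (Fin k) :=
  (β.sort (· ≤ ·)).flatMap fun i => List.replicate (m i) i

/-- The closed subspace `𝔄^β_m(S)`; only the entries `m i` with `i ∈ β` matter. -/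
def frak (β : Finset (Fin k)) (m : Fin k → ℕ) (S : Submodule ℂ H) : Submodule ℂ H :=
  (Submodule.span ℂ (R.products S (word β m))).topologicalClosure

/-- The subspace `𝒩_β`, the whole space for `β = ∅`. -/
def wandering (β : Finset (Fin k)) : Submodule ℂ H := ⨅ i ∈ β, (R.V i).wandering

/-- The inner intersection `⋂ 𝔄^{J ∖ β}_n(𝒩_β)` in the formula for `𝒦_β`. -/
def innerSpace (J β : Finset (Fin k)) : Submodule ℂ H :=
  ⨅ n : Fin k → ℕ, R.frak (J \ β) n (R.wandering β)

/-- The subspace `𝒦_β`. -/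
def woldSpace (J β : Finset (Fin k)) : Submodule ℂ H :=
  (⨆ m : Fin k → ℕ, R.frak β m (R.innerSpace J β)).topologicalClosure

/-- The wandering subspace of the restriction to `S` of the representations with index in `β`. -/
def wanderingIn (β : Finset (Fin k)) (S : Submodule ℂ H) : Submodule ℂ H :=
  S ⊓ ⨅ i ∈ β, ((R.V i).frak 1 S)ᗮ

/-- The restriction to `S` of the representations with index in `β` is generated by its wandering
subspace. -/
def GeneratedOn (β : Finset (Fin k)) (S : Submodule ℂ H) : Prop :=
  (⨆ m : Fin k → ℕ, R.frak β m (R.wanderingIn β S)).topologicalClosure = S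

/-- The restriction of `(σ, A⁽ⁱ⁾)` to `S` is induced in the sense of Wold-type decompositions: it
is generated by its wandering subspace and it is pure. -/
def InducedOn (i : Fin k) (S : Submodule ℂ H) : Prop :=
  R.GeneratedOn {i} S ∧ ⨅ n, (R.V i).frak n S = ⊥

/-- The family `(L β)_{β ⊆ J}` is a Wold-type decomposition for the representations with index in
`J`: the `L β` are reducing subspaces, the space is their orthogonal sum, and on `L β` the
representations with index in `β` are jointly generated by their wandering subspace and
individually induced, and those with index in `J ∖ β` are invertible. -/
def IsWoldDecomposition (J : Finset (Fin k)) (L : Finset (Fin k) → Submodule ℂ H) : Prop :=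
  (∀ β ⊆ J, ∀ i ∈ J, (R.V i).Reduces (L β)) ∧
  (∀ β ⊆ J, ∀ γ ⊆ J, β ≠ γ → L β ⟂ L γ) ∧
  (⨆ β ∈ J.powerset, L β) = ⊤ ∧
  ∀ β ⊆ J, R.GeneratedOn β (L β) ∧ (∀ i ∈ β, R.InducedOn i (L β)) ∧
    ∀ i ∈ J \ β, (R.V i).InvertibleOn (L β)

end DoublyTwistedRep

end

end DTCR

end

/-! The proof has two layers: a Wold decomposition for a single representation, and a bookkeeping of
commuting reducing subspaces.

For one left-invertible representation write `T` for `Ã` and let `L = (T*T)⁻¹T*`, which intertwines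
the representations of `A`, inverts `T` from the left and makes `TL` the projection onto the range
of `T`. Everything reduces to `WoldOrth`: a vector is orthogonal to all that the wandering subspace
generates if and only if it lies in the core, the intersection of the ranges of the iterates `Tₙ`.
The iterates of `L` invert those of `T`, so the ranges are closed, and `I - TL` splits off wandering
vectors one tensor factor at a time. A near-isometric `T` satisfies `WoldOrth` because `Tₙ` of the
wandering part is orthogonal to the range of `Tₙ₊₁`. Under the growth condition the divergence of `∑
1/lₘ` yields infinitely many `n` at which `TₙLₙx` is controlled. Concavity implies growth with `lₘ =
m`, once faithfulness has turned it into expansivity. The remaining two conditions say or imply that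
the Cauchy dual `L*` is concave, and `WoldOrth` passes from `L*` to `T`, since duality exchanges
cores and orthogonal complements of generated subspaces. Finally `admitsWold_of_woldOrth` recovers
the full Wold decomposition from `WoldOrth`.

For several representations, the twisted relation lets an operator with index `j` pass through
`𝔄⁽ⁱ⁾ₙ`, and the doubly twisted relation makes it preserve the wandering subspace of index `i ≠ j`.
Hence the core of each representation reduces all of them (`reduces_core`). The projections onto the
cores therefore commute, and the space is the orthogonal sum of the pieces `part J β` obtained by
choosing, for each `i ∈ J`, the orthogonal complement of the core if `i ∈ β` and the core otherwise.
On such a piece the representations with index in `β` are pure; generating by one wandering subspace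
after another (`le_iSup_frak`) shows that they are jointly generated, which identifies the piece
with `𝒦_β` (`innerSpace_eq`, `woldSpace_eq`). Maximality follows because invertibility places a
subspace inside the core. Uniqueness follows from maximality, as the `𝒦_β` are mutually orthogonal
and any competing family already spans the space. -/

noncomputable section

namespace DTCR

variable {A : Type v} [NonUnitalCStarAlgebra A] [PartialOrder A] [StarOrderedRing A]

/-! ### Amplifications `I_E ⊗ T` of intertwining operators. -/

namespace HRep

/-- `T` intertwines the representations of `A`. -/
def Intertwines {H H' : HRep.{u} A} (T : H →L[ℂ] H') : Prop :=
  ∀ a x, T (H.σ a x) = H'.σ a (T x)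

namespace Intertwines
variable {H H' H'' : HRep.{u} A}

theorem id (H : HRep.{u} A) : Intertwines (ContinuousLinearMap.id ℂ H) := fun _ _ => rfl

theorem comp {S : H' →L[ℂ] H''} {T : H →L[ℂ] H'} (hS : Intertwines S) (hT : Intertwines T) :
    Intertwines (S ∘L T) := fun a x => by
  rw [ContinuousLinearMap.comp_apply, hT, hS]; rfl

theorem sub {S T : H →L[ℂ] H'} (hS : Intertwines S) (hT : Intertwines T) :
    Intertwines (S - T) := fun a x => by
  simp only [_root_.sub_apply, hT a x, hS a x, map_sub]

theorem adjoint {T : H →L[ℂ] H'} (hT : Intertwines T) :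
    Intertwines (ContinuousLinearMap.adjoint T) := adjoint_σ T hT

theorem amp (E : Corr.{u} A) {T : H →L[ℂ] H'} (hT : Intertwines T) :
    Intertwines (HRep.amp E T) := amp_σ E T hT

end Intertwines

section amp
variable {E : Corr.{u} A} {H H₁ H₂ H₃ : HRep.{u} A}

theorem mem_of_tmul_mem {S : Submodule ℂ (tens E H)} (hS : IsClosed (S : Set (tens E H)))
    (h : ∀ ξ x, tmul E H ξ x ∈ S) (z : tens E H) : z ∈ S := by
  have h1 := dense_of_tmul S fun ξ x => S.le_topologicalClosure (h ξ x)
  have h2 := h1.closure_eq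
  rw [hS.closure_eq] at h2
  exact (h2 ▸ Set.mem_univ z : z ∈ (S : Set (tens E H)))

theorem map_mem_of_tmul {F : Type*} [NormedAddCommGroup F] [NormedSpace ℂ F]
    (T : tens E H →L[ℂ] F) {S : Submodule ℂ F} (hS : IsClosed (S : Set F))
    (h : ∀ ξ x, T (tmul E H ξ x) ∈ S) (z : tens E H) : T z ∈ S :=
  mem_of_tmul_mem (S := S.comap (T : tens E H →ₗ[ℂ] F)) (hS.preimage T.continuous) h z

theorem amp_comp {S : H₁ →L[ℂ] H₂} {T : H →L[ℂ] H₁} (hS : Intertwines S) (hT : Intertwines T) :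
    amp E (S ∘L T) = amp E S ∘L amp E T := tens_ext fun ξ x => by
  rw [amp_tmul E _ (hS.comp hT), ContinuousLinearMap.comp_apply, ContinuousLinearMap.comp_apply,
    amp_tmul E T hT, amp_tmul E S hS]

theorem amp_id : amp E (ContinuousLinearMap.id ℂ H) = ContinuousLinearMap.id ℂ (tens E H) :=
  tens_ext fun ξ x => by rw [amp_tmul E _ (Intertwines.id H)]; rfl

theorem tmul_sub (ξ : E) (x y : H) : tmul E H ξ (x - y) = tmul E H ξ x - tmul E H ξ y :=
  map_sub (tmulL ξ) x y

theorem tmul_add (ξ : E) (x y : H) : tmul E H ξ (x + y) = tmul E H ξ x + tmul E H ξ y :=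
  map_add (tmulL ξ) x y

theorem amp_sub {S T : H →L[ℂ] H₁} (hS : Intertwines S) (hT : Intertwines T) :
    amp E (S - T) = amp E S - amp E T := tens_ext fun ξ x => by
  rw [amp_tmul E _ (hS.sub hT), _root_.sub_apply, _root_.sub_apply, amp_tmul E T hT,
    amp_tmul E S hS, tmul_sub]

/-- Quadratic inequalities between intertwining operators are inherited by `I_E ⊗ ·`. -/
theorem amp_quadratic {R : H →L[ℂ] H₁} {S : H →L[ℂ] H₂} {Q : H →L[ℂ] H₃} (hR : Intertwines R)
    (hS : Intertwines S) (hQ : Intertwines Q) {a b c : ℝ}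
    (h : ∀ x, 0 ≤ a * ‖R x‖ ^ 2 + b * ‖S x‖ ^ 2 + c * ‖Q x‖ ^ 2) (z : tens E H) :
    0 ≤ a * ‖amp E R z‖ ^ 2 + b * ‖amp E S z‖ ^ 2 + c * ‖amp E Q z‖ ^ 2 := by
  refine (dense_tensMap E H).induction_on (p := fun z =>
    0 ≤ a * ‖amp E R z‖ ^ 2 + b * ‖amp E S z‖ ^ 2 + c * ‖amp E Q z‖ ^ 2) z ?_ fun t => ?_
  · exact isClosed_le continuous_const (by fun_prop)
  obtain ⟨n, ξ, k, rfl⟩ := TensorProduct.exists_sum_tmul_eq t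
  -- Writing the Gram matrix of the `ξ i` as `s* s` turns the norm of `∑ ξ i ⊗ k i` into a Hilbert
  -- sum of vectors `s k`, on which an intertwiner acts entrywise; the inequality is then summed
  -- over the entries.
  obtain ⟨s, hs⟩ := exists_star_mul_self _ (E.gram_nonneg ξ)
  have h1 : ∀ (K : HRep.{u} A) (k : Fin n → K),
      ‖tensMap E K (∑ i, ξ i ⊗ₜ k i)‖ ^ 2 = ∑ i, ‖colMul s k i‖ ^ 2 := fun K k =>
    Complex.ofReal_injective (by
      rw [tensForm_sum, sum_colMul, ← hs]; rfl)
  have h2 : ∀ (K : HRep.{u} A) (T : H →L[ℂ] K), Intertwines T →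
      ‖amp E T (tensMap E H (∑ i, ξ i ⊗ₜ k i))‖ ^ 2 = ∑ i, ‖T (colMul s k i)‖ ^ 2 := by
    intro K T hT
    have h3 : amp E T (tensMap E H (∑ i, ξ i ⊗ₜ k i)) = tensMap E K (∑ i, ξ i ⊗ₜ T (k i)) := by
      simp only [map_sum]
      exact Finset.sum_congr rfl fun i _ => amp_tmul E T hT (ξ i) (k i)
    rw [h3, h1]
    refine Finset.sum_congr rfl fun i _ => ?_
    simp only [colMul, map_sum, hT _ _]
  rw [h2 _ R hR, h2 _ S hS, h2 _ Q hQ, Finset.mul_sum, Finset.mul_sum, Finset.mul_sum,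
    ← Finset.sum_add_distrib, ← Finset.sum_add_distrib]
  exact Finset.sum_nonneg fun i _ => h _

theorem amp_bounded_below {T : H →L[ℂ] H₁} (hT : Intertwines T) {c : ℝ}
    (h : ∀ x, c * ‖x‖ ^ 2 ≤ ‖T x‖ ^ 2) (z : tens E H) : c * ‖z‖ ^ 2 ≤ ‖amp E T z‖ ^ 2 := by
  have h1 := amp_quadratic (E := E) (a := 1) (b := -c) (c := 0) hT (Intertwines.id H)
    (Intertwines.id H) (fun x => by
      have := h x
      simp only [ContinuousLinearMap.id_apply]; linarith) z
  rw [amp_id] at h1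
  simp only [ContinuousLinearMap.id_apply] at h1; linarith

/-- Nondegeneracy of the left action: the vectors `aη ⊗ x` span a dense subspace of `E ⊗ H`, and `z`
is orthogonal to them because `σ(a*) z = 0`. -/
theorem dense_left (z : tens E H) (h : ∀ a, (tens E H).σ a z = 0) : z = 0 := by
  have h1 : ∀ w : tens E H, inner ℂ z w = 0 := fun w => by
    refine mem_of_tmul_mem (S := LinearMap.ker (innerSL ℂ z : tens E H →ₗ[ℂ] ℂ))
      (ContinuousLinearMap.isClosed_ker _) (fun ξ x => ?_) w
    have h2 : (Submodule.span ℂ {z | ∃ a x, z = E.left a x}) ≤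
        LinearMap.ker ((innerSL ℂ z : tens E H →ₗ[ℂ] ℂ) ∘ₗ
          ((ContinuousLinearMap.flip tmulL x : E →L[ℂ] tens E H) : E →ₗ[ℂ] tens E H)) := by
      refine Submodule.span_le.mpr ?_
      rintro _ ⟨a, η, rfl⟩
      change inner ℂ z (tmul E H (E.left a η) x) = 0
      rw [← tens_σ_tmul, ← star_star a, ← act_adj, h, inner_zero_left]
    have h3 := map_mem_closure (ContinuousLinearMap.flip (tmulL (E := E) (H := H)) x).continuous
      (E.essential ξ) (t := LinearMap.ker (innerSL ℂ z : tens E H →ₗ[ℂ] ℂ))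
      (fun _ hw => h2 hw)
    rwa [(ContinuousLinearMap.isClosed_ker (innerSL ℂ z)).closure_eq] at h3
  exact inner_self_eq_zero.mp (h1 z)

/-- If every nonzero vector has a nonzero tensor with some element of `E`, then lower bounds of
`I_E ⊗ T` descend to `T`. -/
theorem bounded_below_of_amp (hE : ∀ x : H, (∀ ξ : E, tmul E H ξ x = 0) → x = 0)
    {T : H →L[ℂ] H₁} (hT : Intertwines T) {c : ℝ}
    (h : ∀ z : tens E H, c * ‖z‖ ^ 2 ≤ ‖amp E T z‖ ^ 2) (x : H) :
    c * ‖x‖ ^ 2 ≤ ‖T x‖ ^ 2 := by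
  -- The claim is that `G = T*T - c` is positive. The hypothesis says so after tensoring with `E`,
  -- so the negative part of `G` is tested there.
  set G : H →L[ℂ] H := ContinuousLinearMap.adjoint T ∘L T - (c : ℂ) • 1 with hG
  have hGi : Intertwines G := fun a y => by
    simp only [hG, _root_.sub_apply, ContinuousLinearMap.comp_apply, _root_.smul_apply, hT a y,
      hT.adjoint a (T y), map_sub, map_smul, one_apply_eq_self]
  have hGsa : IsSelfAdjoint G := by
    refine IsSelfAdjoint.sub ?_ ?_
    · exact T.isPositive_adjoint_comp_self.isSelfAdjoint
    · exact IsSelfAdjoint.smul (Complex.conj_ofReal c) (IsSelfAdjoint.one _)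
  have hGin : ∀ y, RCLike.re (inner ℂ (G y) y) = ‖T y‖ ^ 2 - c * ‖y‖ ^ 2 := fun y => by
    simp only [hG, _root_.sub_apply, ContinuousLinearMap.comp_apply, _root_.smul_apply,
      one_apply_eq_self, inner_sub_left, ContinuousLinearMap.adjoint_inner_left, inner_smul_left,
      map_sub, Complex.conj_ofReal]
    rw [inner_self_eq_norm_sq (𝕜 := ℂ)]
    have : RCLike.re ((c : ℂ) * inner ℂ y y) = c * ‖y‖ ^ 2 := by
      rw [← inner_self_eq_norm_sq (𝕜 := ℂ) y]
      simp
    rw [this]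
  -- `Q` is the square root of the negative part of `G`, so `GQ = -Q³`. Being a function of `G`, it
  -- commutes with the representation.
  set f : ℝ → ℝ := fun t => √(max (-t) 0) with hf
  set Q := cfc f G with hQ
  have hfc : ContinuousOn f (spectrum ℝ G) := by rw [hf]; fun_prop
  have hQsa : IsSelfAdjoint Q := cfc_predicate f G
  have hGQ : G * Q = -(Q * Q * Q) := by
    conv_lhs => enter [1]; rw [← cfc_id ℝ G hGsa]
    rw [hQ, ← cfc_mul id f G, ← cfc_mul f f G, ← cfc_mul (fun t => f t * f t) f G, ← cfc_neg]
    refine cfc_congr fun t _ => ?_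
    simp only [hf, id]
    rw [Real.mul_self_sqrt (le_max_right _ _)]
    rcases le_total t 0 with ht | ht
    · rw [max_eq_left (by linarith)]; ring
    · rw [max_eq_right (by linarith)]; simp
  have hQi : Intertwines Q := fun a y => by
    have h1 : Commute G (H.σ a) := ContinuousLinearMap.ext fun w => hGi a w
    have h2 : Commute Q (H.σ a) := h1.cfc_real f
    exact congrArg (fun S : H →L[ℂ] H => S y) h2.eq
  have hQadj : ∀ y w, inner ℂ (Q y) w = inner ℂ y (Q w) := fun y w => by
    rw [← ContinuousLinearMap.adjoint_inner_right, ← ContinuousLinearMap.star_eq_adjoint,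
      hQsa.star_eq]
  -- At `ξ ⊗ Qy` the nonnegative quantity `‖ξ ⊗ TQy‖² - c‖ξ ⊗ Qy‖²` equals `-‖ξ ⊗ Q²y‖²`, so every
  -- `ξ ⊗ Q²y` vanishes.
  have hQQ : ∀ y, Q (Q y) = 0 := fun y => by
    refine hE _ fun ξ => ?_
    have h1 := h (tmul E H ξ (Q y))
    rw [amp_tmul E T hT] at h1
    have h3 : ∀ (K : HRep.{u} A) (k : K), ‖tmul E K ξ k‖ ^ 2 =
        RCLike.re (inner ℂ k (K.σ (E.ip ξ ξ) k)) := fun K k => by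
      rw [← inner_self_eq_norm_sq (𝕜 := ℂ), inner_tmul]
    have h4 : ‖tmul E H₁ ξ (T (Q y))‖ ^ 2 - c * ‖tmul E H ξ (Q y)‖ ^ 2 =
        RCLike.re (inner ℂ (G (Q y)) (H.σ (E.ip ξ ξ) (Q y))) := by
      rw [h3, h3, ← hT, ← ContinuousLinearMap.adjoint_inner_left]
      simp only [hG, _root_.sub_apply, ContinuousLinearMap.comp_apply, _root_.smul_apply,
        one_apply_eq_self, inner_sub_left, inner_smul_left, map_sub, Complex.conj_ofReal]
      simp
    have h5 : G (Q y) = -(Q (Q (Q y))) := congrArg (fun S : H →L[ℂ] H => S y) hGQ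
    have h6 : RCLike.re (inner ℂ (G (Q y)) (H.σ (E.ip ξ ξ) (Q y))) =
        -‖tmul E H ξ (Q (Q y))‖ ^ 2 := by
      rw [h5, h3, inner_neg_left, hQadj, hQi, map_neg]
    have h7 : ‖tmul E H ξ (Q (Q y))‖ ^ 2 ≤ 0 := by linarith
    exact norm_eq_zero.mp (pow_eq_zero_iff two_ne_zero |>.mp (le_antisymm h7 (sq_nonneg _)))
  have hQ0 : Q * Q = 0 := ContinuousLinearMap.ext hQQ
  have hpos : 0 ≤ G := by
    have h8 : cfc (fun t => f t * f t) G = 0 := by rw [cfc_mul f f G]; exact hQ0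
    have h9 : G = cfc (fun t : ℝ => max t 0) G := by
      conv_lhs => rw [← cfc_id ℝ G hGsa, ← add_zero (cfc id G), ← h8]
      rw [← cfc_add G id (fun t => f t * f t) continuousOn_id (hfc.mul hfc)]
      refine cfc_congr fun t _ => ?_
      simp only [hf, id]
      rw [Real.mul_self_sqrt (le_max_right _ _)]
      rcases le_total t 0 with ht | ht
      · rw [max_eq_left (by linarith), max_eq_right ht]; ring
      · rw [max_eq_right (by linarith), max_eq_left ht]; ring
    rw [h9]
    exact cfc_nonneg fun t _ => le_max_right t 0
  have := ((ContinuousLinearMap.nonneg_iff_isPositive G).mp hpos).re_inner_nonneg_left x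
  rw [hGin] at this
  linarith

end amp
end HRep

/-! ### Iterates, left inverses and Cauchy duals of operators `E ⊗ H → H`. -/

namespace HRep
variable {E : Corr.{u} A} {H : HRep.{u} A}

theorem inner_amp {H' : HRep.{u} A} {T : H →L[ℂ] H'} (hT : Intertwines T) (z : tens E H)
    (w : tens E H') :
    inner ℂ (amp E T z) w = inner ℂ z (amp E (ContinuousLinearMap.adjoint T) w) := by
  have h1 : ContinuousLinearMap.adjoint (amp E T) = amp E (ContinuousLinearMap.adjoint T) :=
    tens_ext fun η y => by
      refine ext_inner_left ℂ fun v => ?_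
      rw [ContinuousLinearMap.adjoint_inner_right, amp_tmul E _ hT.adjoint]
      have h0 := mem_of_tmul_mem (S := LinearMap.ker
        ((innerSL ℂ (tmul E H' η y) ∘L amp E T -
          innerSL ℂ (tmul E H η (ContinuousLinearMap.adjoint T y)) : tens E H →L[ℂ] ℂ) :
          tens E H →ₗ[ℂ] ℂ)) (ContinuousLinearMap.isClosed_ker _) (fun ξ x => by
        change inner ℂ (tmul E H' η y) (amp E T (tmul E H ξ x)) -
          inner ℂ (tmul E H η (ContinuousLinearMap.adjoint T y)) (tmul E H ξ x) = 0
        rw [amp_tmul E T hT, inner_tmul, inner_tmul, ContinuousLinearMap.adjoint_inner_left, hT,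
          sub_self]) v
      have h1 : inner ℂ (tmul E H' η y) (amp E T v) -
          inner ℂ (tmul E H η (ContinuousLinearMap.adjoint T y)) v = 0 := h0
      have h2 := congrArg (starRingEnd ℂ) h1
      rwa [map_sub, map_zero, inner_conj_symm, inner_conj_symm, sub_eq_zero] at h2
  rw [← h1, ContinuousLinearMap.adjoint_inner_right]

/-- The operators `I_{E^{⊗ n}} ⊗ T : E^{⊗ (n + 1)} ⊗ H → E^{⊗ n} ⊗ H`. -/
def down (T : tens E H →L[ℂ] H) : (n : ℕ) → pow E H (n + 1) →L[ℂ] pow E H n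
  | 0 => T
  | n + 1 => amp E (down T n)

/-- The operators `I_{E^{⊗ n}} ⊗ L : E^{⊗ n} ⊗ H → E^{⊗ (n + 1)} ⊗ H`. -/
def up (L : H →L[ℂ] tens E H) : (n : ℕ) → pow E H n →L[ℂ] pow E H (n + 1)
  | 0 => L
  | n + 1 => amp E (up L n)

/-- The iterates `E^{⊗ n} ⊗ H → H` of `T : E ⊗ H → H`. -/
def tpow (T : tens E H →L[ℂ] H) : (n : ℕ) → pow E H n →L[ℂ] H
  | 0 => ContinuousLinearMap.id ℂ H
  | n + 1 => T ∘L amp E (tpow T n)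

/-- The iterates `H → E^{⊗ n} ⊗ H` of `L : H → E ⊗ H`. -/
def upPow (L : H →L[ℂ] tens E H) : (n : ℕ) → H →L[ℂ] pow E H n
  | 0 => ContinuousLinearMap.id ℂ H
  | n + 1 => up L n ∘L upPow L n

theorem Intertwines.down {T : tens E H →L[ℂ] H} (hT : Intertwines T) :
    ∀ n, Intertwines (HRep.down T n)
  | 0 => hT
  | n + 1 => (Intertwines.down hT n).amp E

theorem Intertwines.up {L : H →L[ℂ] tens E H} (hL : Intertwines L) :
    ∀ n, Intertwines (HRep.up L n)
  | 0 => hL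
  | n + 1 => (Intertwines.up hL n).amp E

theorem Intertwines.tpow {T : tens E H →L[ℂ] H} (hT : Intertwines T) :
    ∀ n, Intertwines (HRep.tpow T n)
  | 0 => Intertwines.id H
  | n + 1 => hT.comp ((Intertwines.tpow hT n).amp E)

/-- The definition peels off the first tensor factor; here the last one is applied first. This form
shows that the ranges decrease and lets `upPow` undo `tpow` stepwise. -/
theorem tpow_succ {T : tens E H →L[ℂ] H} (hT : Intertwines T) :
    ∀ n, tpow T (n + 1) = tpow T n ∘L down T n
  | 0 => by
    change T ∘L amp E (ContinuousLinearMap.id ℂ H) = ContinuousLinearMap.id ℂ H ∘L T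
    rw [amp_id]; rfl
  | n + 1 => by
    change T ∘L amp E (tpow T (n + 1)) = (T ∘L amp E (tpow T n)) ∘L amp E (down T n)
    rw [tpow_succ hT n, amp_comp (hT.tpow n) (hT.down n)]; rfl

theorem inner_down_of_powSet {T : tens E H →L[ℂ] H} (hT : Intertwines T) {K : Set H}
    (hK : ∀ k ∈ K, ∀ z, inner ℂ k (T z) = 0) :
    ∀ n, ∀ w ∈ powSet E H K n, ∀ z, inner ℂ w (down T n z) = 0
  | 0, w, hw, z => hK w hw z
  | n + 1, w, hw, z => by
    obtain ⟨ξ, w', hw', rfl⟩ := hw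
    refine mem_of_tmul_mem (S := LinearMap.ker
      ((innerSL ℂ (tmul E (pow E H n) ξ w') ∘L down T (n + 1) : pow E H (n + 2) →L[ℂ] ℂ) :
        pow E H (n + 2) →ₗ[ℂ] ℂ)) (ContinuousLinearMap.isClosed_ker _) (fun η y => ?_) z
    change inner ℂ (tmul E (pow E H n) ξ w') (amp E (down T n) (tmul E (pow E H (n + 1)) η y)) = 0
    rw [amp_tmul E _ (hT.down n), inner_tmul, ← hT.down n,
      inner_down_of_powSet hT hK n w' hw']

theorem inner_eq_zero_of_powSub {K : Submodule ℂ H} {n : ℕ} {z : pow E H n}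
    (h : ∀ w ∈ powSet E H K n, inner ℂ w z = 0) {w : pow E H n} (hw : w ∈ powSub E H n K) :
    inner ℂ w z = 0 := by
  have h1 : powSub E H n K ≤ (ℂ ∙ z)ᗮ := by
    refine Submodule.topologicalClosure_minimal _ (Submodule.span_le.mpr fun w hw => ?_)
      (Submodule.isClosed_orthogonal _)
    exact Submodule.mem_orthogonal_singleton_iff_inner_left.mpr (h w hw)
  exact Submodule.mem_orthogonal_singleton_iff_inner_left.mp (h1 hw)

/-- The orthogonal complement of the range of `T`. -/
def wand (T : tens E H →L[ℂ] H) : Submodule ℂ H := (LinearMap.range (T : tens E H →ₗ[ℂ] H))ᗮ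

theorem mem_wand_iff (T : tens E H →L[ℂ] H) (x : H) :
    x ∈ wand T ↔ ∀ z, inner ℂ x (T z) = 0 := by
  rw [wand, Submodule.mem_orthogonal']
  exact ⟨fun hx z => hx _ ⟨z, rfl⟩, fun hx _ ⟨z, hz⟩ => hz ▸ hx z⟩

/-- `L` is the intertwining left inverse of `T` for which `T L` is the orthogonal projection onto
the range of `T`. -/
structure IsLeftInverse (T : tens E H →L[ℂ] H) (L : H →L[ℂ] tens E H) : Prop where
  map : Intertwines T
  inv : Intertwines L
  left_inv : ∀ z, L (T z) = z
  proj : ∀ x z, inner ℂ (x - T (L x)) (T z) = 0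

/-- The lower bound makes `T*T` coercive, hence invertible, and `L = (T*T)⁻¹T*` works. The inverse
intertwines because `T*T` does. -/
theorem exists_isLeftInverse {T : tens E H →L[ℂ] H} (hT : Intertwines T) {δ : ℝ} (hδ : 0 < δ)
    (h : ∀ z, δ * ‖z‖ ≤ ‖T z‖) : ∃ L, IsLeftInverse T L := by
  set G := ContinuousLinearMap.adjoint T ∘L T with hG
  have hGi : Intertwines G := hT.adjoint.comp hT
  have hu : IsUnit G := by
    refine ContinuousLinearMap.isUnit_of_forall_le_norm_inner_map G (c := ⟨δ ^ 2, by positivity⟩)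
      (by exact pow_pos hδ 2) fun z => ?_
    change ‖z‖ ^ 2 * δ ^ 2 ≤ ‖inner ℂ (ContinuousLinearMap.adjoint T (T z)) z‖
    rw [ContinuousLinearMap.adjoint_inner_left, inner_self_eq_norm_sq_to_K]
    have h1 : ‖((‖T z‖ : ℂ)) ^ 2‖ = ‖T z‖ ^ 2 := by simp
    have h2 := pow_le_pow_left₀ (by positivity) (h z) 2
    refine le_trans (le_of_eq ?_) (h2.trans (le_of_eq h1.symm))
    ring
  obtain ⟨w, hw⟩ := hu
  set B : tens E H →L[ℂ] tens E H := ↑w⁻¹ with hB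
  have hBG : ∀ z, B (G z) = z := fun z => by
    have : B * G = 1 := by rw [← hw]; exact w.inv_mul
    exact congrArg (fun S : tens E H →L[ℂ] tens E H => S z) this
  have hGB : ∀ z, G (B z) = z := fun z => by
    have : G * B = 1 := by rw [← hw]; exact w.mul_inv
    exact congrArg (fun S : tens E H →L[ℂ] tens E H => S z) this
  have hBi : Intertwines B := fun a z => by
    conv_lhs => rw [← hGB z, ← hGi a, hBG]
  refine ⟨B ∘L ContinuousLinearMap.adjoint T, hT, hBi.comp hT.adjoint, fun z => hBG z,
    fun x z => ?_⟩
  rw [← ContinuousLinearMap.adjoint_inner_left, map_sub]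
  have : ContinuousLinearMap.adjoint T (T (B (ContinuousLinearMap.adjoint T x))) =
    ContinuousLinearMap.adjoint T x := hGB _
  rw [ContinuousLinearMap.comp_apply, this, sub_self, inner_zero_left]

namespace IsLeftInverse
variable {T : tens E H →L[ℂ] H} {L : H →L[ℂ] tens E H} (h : IsLeftInverse T L)
include h

theorem up_down : ∀ n z, up L n (down T n z) = z
  | 0, z => h.left_inv z
  | n + 1, z => by
    change (amp E (up L n) ∘L amp E (down T n)) z = z
    rw [← amp_comp (h.inv.up n) (h.map.down n)]
    have : up L n ∘L down T n = ContinuousLinearMap.id ℂ _ :=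
      ContinuousLinearMap.ext (up_down n)
    rw [this, amp_id]; rfl

theorem upPow_tpow : ∀ n z, upPow L n (tpow T n z) = z
  | 0, z => rfl
  | n + 1, z => by
    rw [tpow_succ h.map]
    change up L n (upPow L n (tpow T n (down T n z))) = z
    rw [upPow_tpow n, h.up_down]

theorem mem_range_iff (n : ℕ) (x : H) :
    x ∈ LinearMap.range (tpow T n : pow E H n →ₗ[ℂ] H) ↔ tpow T n (upPow L n x) = x := by
  constructor
  · rintro ⟨z, rfl⟩
    change tpow T n (upPow L n (tpow T n z)) = tpow T n z
    rw [h.upPow_tpow]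
  · exact fun hx => ⟨_, hx⟩

/-- The range is the fixed point set of the continuous idempotent `Tₙ Lₙ`. -/
theorem isClosed_range (n : ℕ) :
    IsClosed (LinearMap.range (tpow T n : pow E H n →ₗ[ℂ] H) : Set H) := by
  have : (LinearMap.range (tpow T n : pow E H n →ₗ[ℂ] H) : Set H) =
      {x | tpow T n (upPow L n x) = x} := Set.ext (h.mem_range_iff n)
  rw [this]
  exact isClosed_eq (by fun_prop) continuous_id

/-- The defect `I - TL` amplifies one tensor factor at a time, since `I - (I ⊗ S)(I ⊗ R) = I ⊗ (I -
SR)`. -/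
theorem sub_mem_powSub {K : Submodule ℂ H} (hK : ∀ x, x - T (L x) ∈ K) :
    ∀ n z, z - down T n (up L n z) ∈ powSub E H n K
  | 0, z => Submodule.le_topologicalClosure _ (Submodule.subset_span (hK z))
  | n + 1, z => by
    have h1 : ∀ z, z - down T (n + 1) (up L (n + 1) z) =
        amp E (ContinuousLinearMap.id ℂ _ - down T n ∘L up L n) z := fun z => by
      rw [amp_sub (Intertwines.id _) ((h.map.down n).comp (h.inv.up n)), amp_id,
        amp_comp (h.map.down n) (h.inv.up n)]
      rfl
    rw [h1]
    refine map_mem_of_tmul _ (Submodule.isClosed_topologicalClosure _) (fun ξ y => ?_) z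
    refine (amp_tmul E _ ((Intertwines.id _).sub ((h.map.down n).comp (h.inv.up n))) ξ y).symm ▸ ?_
    refine map_mem_closure (tmulL ξ).continuous (sub_mem_powSub hK n y) fun w hw => ?_
    refine Submodule.span_induction (p := fun w _ => tmulL ξ w ∈
      Submodule.span ℂ (powSet E H K (n + 1))) ?_ ?_ ?_ ?_ hw
    · exact fun w hw => Submodule.subset_span ⟨ξ, w, hw, rfl⟩
    · rw [map_zero]; exact zero_mem _
    · intro x y _ _ hx hy; rw [map_add]; exact add_mem hx hy
    · intro c x _ hx; rw [map_smul]; exact Submodule.smul_mem _ c hx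

end IsLeftInverse

/-- `x` is orthogonal to everything generated by the wandering subspace of `T`. -/
def OrthGen (T : tens E H →L[ℂ] H) (x : H) : Prop :=
  ∀ n, ∀ w ∈ powSet E H (wand T) n, inner ℂ (tpow T n w) x = 0

/-- The intersection of the ranges of the iterates of `T`. -/
def coreSub (T : tens E H →L[ℂ] H) : Submodule ℂ H :=
  ⨅ n, LinearMap.range (tpow T n : pow E H n →ₗ[ℂ] H)

/-- The intersection of the ranges of the iterates of `T` is the orthogonal complement of the
subspace generated by the wandering subspace. -/
def WoldOrth (T : tens E H →L[ℂ] H) : Prop := ∀ x, OrthGen T x ↔ x ∈ coreSub T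

theorem inner_down_of_wand {T : tens E H →L[ℂ] H} (hT : Intertwines T) {n : ℕ} {w : pow E H n}
    (hw : w ∈ powSub E H n (wand T)) (z : pow E H (n + 1)) : inner ℂ w (down T n z) = 0 :=
  inner_eq_zero_of_powSub (fun w hw => inner_down_of_powSet hT
    (fun k hk z => (mem_wand_iff T k).mp hk z) n w hw z) hw

namespace IsLeftInverse
variable {T : tens E H →L[ℂ] H} {L : H →L[ℂ] tens E H} (h : IsLeftInverse T L)
include h

theorem sub_mem_wand (n : ℕ) (z : pow E H n) :
    z - down T n (up L n z) ∈ powSub E H n (wand T) :=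
  h.sub_mem_powSub (fun x => (mem_wand_iff T _).mpr (h.proj x)) n z

/-- `I ⊗ TL` is the orthogonal projection onto the range of `I ⊗ T`, and its defect lies in `E^{⊗
n}` tensored with the wandering subspace, to which `z` is orthogonal. -/
theorem down_up_of_orth {n : ℕ} {z : pow E H n}
    (hz : ∀ w ∈ powSet E H (wand T) n, inner ℂ w z = 0) : down T n (up L n z) = z := by
  have h1 := h.sub_mem_wand n z
  have h2 := inner_eq_zero_of_powSub hz h1
  have h3 := inner_down_of_wand h.map h1 (up L n z)
  have h4 : inner ℂ (z - down T n (up L n z)) (z - down T n (up L n z)) = 0 := by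
    rw [inner_sub_right, h2, h3, sub_zero]
  exact (sub_eq_zero.mp (inner_self_eq_zero.mp h4)).symm

theorem norm_sq_down_up_le (n : ℕ) (z : pow E H n) : ‖down T n (up L n z)‖ ^ 2 ≤ ‖z‖ ^ 2 := by
  have h3 := inner_down_of_wand h.map (h.sub_mem_wand n z) (up L n z)
  have h4 := norm_add_sq_eq_norm_sq_add_norm_sq_of_inner_eq_zero _ _ h3
  rw [sub_add_cancel] at h4
  nlinarith [mul_self_nonneg ‖z - down T n (up L n z)‖]

/-- Passing from `TₙLₙy` to `Tₙ₊₁Lₙ₊₁y` changes the vector by `Tₙ` of something in `E^{⊗ n}`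
tensored with the wandering subspace, which `x` does not see. -/
theorem inner_tpow_upPow {x : H} (hx : OrthGen T x) (y : H) :
    ∀ n, inner ℂ (tpow T n (upPow L n y)) x = inner ℂ y x
  | 0 => rfl
  | n + 1 => by
    rw [← inner_tpow_upPow hx y n, tpow_succ h.map]
    change inner ℂ (tpow T n (down T n (up L n (upPow L n y)))) x = _
    rw [← sub_eq_zero, ← neg_eq_zero, neg_sub, ← inner_sub_left, ← map_sub]
    rw [← ContinuousLinearMap.adjoint_inner_right]
    refine inner_eq_zero_of_powSub (fun w hw => ?_) (h.sub_mem_wand n _)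
    rw [ContinuousLinearMap.adjoint_inner_right]
    exact hx n w hw

theorem inner_TL (x y : H) : inner ℂ (T (L x)) y = inner ℂ x (T (L y)) := by
  have h1 := h.proj x (L y)
  have h2 := h.proj y (L x)
  rw [inner_sub_left, sub_eq_zero] at h1 h2
  rw [h1, ← inner_conj_symm, h2, inner_conj_symm]

/-- The Cauchy dual of `T` is the adjoint of its left inverse. -/
theorem dual : IsLeftInverse (ContinuousLinearMap.adjoint L) (ContinuousLinearMap.adjoint T) where
  map := h.inv.adjoint
  inv := h.map.adjoint
  left_inv z := ext_inner_right ℂ fun w => by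
    rw [ContinuousLinearMap.adjoint_inner_left, ContinuousLinearMap.adjoint_inner_left, h.left_inv]
  proj x z := by
    rw [ContinuousLinearMap.adjoint_inner_right, map_sub]
    have : L (ContinuousLinearMap.adjoint L (ContinuousLinearMap.adjoint T x)) = L x := by
      have h1 : ContinuousLinearMap.adjoint L (ContinuousLinearMap.adjoint T x) = T (L x) :=
        ext_inner_right ℂ fun w => by
          rw [ContinuousLinearMap.adjoint_inner_left, ContinuousLinearMap.adjoint_inner_left,
            h.inner_TL]
      rw [h1, h.left_inv]
    rw [this, sub_self, inner_zero_left]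

/-- `T = L*(T*T)` and, conversely, a vector orthogonal to the range of `T` is killed by `L`; so `T`
and `L*` have the same complement of the range. -/
theorem wand_dual : wand (ContinuousLinearMap.adjoint L) = wand T := by
  ext x
  rw [mem_wand_iff, mem_wand_iff]
  constructor
  · intro hx z
    have h1 : T z = ContinuousLinearMap.adjoint L (ContinuousLinearMap.adjoint T (T z)) :=
      ext_inner_right ℂ fun w => by
        rw [ContinuousLinearMap.adjoint_inner_left, ContinuousLinearMap.adjoint_inner_left,
          ← h.inner_TL, h.left_inv]
    rw [h1, hx]
  · intro hx z
    have h1 : L x = 0 := by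
      have h2 := hx (L x)
      have h3 : T (L x) = 0 := by
        rw [← inner_self_eq_zero (𝕜 := ℂ), h.inner_TL, h.left_inv, h2]
      rw [← h.left_inv (L x), h3, map_zero]
    rw [ContinuousLinearMap.adjoint_inner_right, h1, inner_zero_left]

theorem inner_down_dual : ∀ n (z : pow E H (n + 1)) (w : pow E H n),
    inner ℂ (down (ContinuousLinearMap.adjoint L) n z) w = inner ℂ z (up L n w)
  | 0, z, w => ContinuousLinearMap.adjoint_inner_left L w z
  | n + 1, z, w => by
    have h1 : ContinuousLinearMap.adjoint (down (ContinuousLinearMap.adjoint L) n) = up L n :=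
      ((ContinuousLinearMap.eq_adjoint_iff _ _).mpr fun x y => by
        rw [← inner_conj_symm, ← inner_down_dual n y x, inner_conj_symm]).symm
    have h2 := inner_amp (h.dual.map.down n) z w
    rw [h1] at h2
    exact h2

theorem inner_tpow_dual : ∀ n (z : pow E H n) (x : H),
    inner ℂ (tpow (ContinuousLinearMap.adjoint L) n z) x = inner ℂ z (upPow L n x)
  | 0, z, x => rfl
  | n + 1, z, x => by
    rw [tpow_succ h.dual.map]
    change inner ℂ (tpow _ n (down _ n z)) x = inner ℂ z (up L n (upPow L n x))
    rw [inner_tpow_dual n, h.inner_down_dual]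

/-- Pairing `x` with the `n`-th iterate of `L*` is pairing `Lₙx` with the tensor. Hence
orthogonality to what the dual generates means that each `Lₙx` is orthogonal to the wandering
tensors, that is, lies in the range of `I ⊗ T`; inductively this says `TₙLₙx = x` for all `n`. -/
theorem orthGen_dual_iff (x : H) :
    OrthGen (ContinuousLinearMap.adjoint L) x ↔ x ∈ coreSub T := by
  simp only [OrthGen, h.wand_dual, h.inner_tpow_dual, coreSub, Submodule.mem_iInf]
  constructor
  · intro hx n
    induction n with
    | zero => exact ⟨x, rfl⟩
    | succ n ih =>
      have h1 := (h.mem_range_iff n x).mp ih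
      refine (h.mem_range_iff (n + 1) x).mpr ?_
      rw [tpow_succ h.map]
      change tpow T n (down T n (up L n (upPow L n x))) = x
      rw [h.down_up_of_orth (hx n), h1]
  · intro hx n w hw
    obtain ⟨z, hz⟩ := hx (n + 1)
    rw [tpow_succ h.map] at hz
    rw [← hz]
    change inner ℂ w (upPow L n (tpow T n (down T n z))) = 0
    rw [h.upPow_tpow]
    exact inner_down_of_wand h.map (Submodule.le_topologicalClosure _ (Submodule.subset_span hw)) z

/-- The Cauchy dual of the Cauchy dual is `T`, so the exchange of cores and generated complements
can be applied in both directions, with the hypothesis in between. -/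
theorem woldOrth_of_dual (hd : WoldOrth (ContinuousLinearMap.adjoint L)) : WoldOrth T := by
  intro x
  have h1 := h.dual.orthGen_dual_iff x
  rw [ContinuousLinearMap.adjoint_adjoint] at h1
  rw [h1, ← h.orthGen_dual_iff, hd]

theorem isClosed_coreSub : IsClosed (coreSub T : Set H) := by
  rw [coreSub, Submodule.coe_iInf]
  exact isClosed_iInter h.isClosed_range

theorem range_antitone :
    Antitone fun n => LinearMap.range (tpow T n : pow E H n →ₗ[ℂ] H) := by
  refine antitone_nat_of_succ_le fun n => ?_
  rintro _ ⟨z, rfl⟩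
  refine ⟨down T n z, ?_⟩
  change tpow T n (down T n z) = tpow T (n + 1) z
  rw [tpow_succ h.map]; rfl

theorem coreSub_orthogonal : (coreSub T)ᗮ =
    (⨆ n, (LinearMap.range (tpow T n : pow E H n →ₗ[ℂ] H))ᗮ).topologicalClosure := by
  rw [← Submodule.orthogonal_orthogonal_eq_closure, ← Submodule.iInf_orthogonal, coreSub]
  congr 2
  funext n
  have := (h.isClosed_range n).completeSpace_coe
  exact (Submodule.orthogonal_orthogonal _).symm

end IsLeftInverse

end HRep

/-! ### Growth conditions, concavity and expansivity. -/

namespace HRep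
variable {E : Corr.{u} A} {H : HRep.{u} A}

theorem down_bounded_below {T : tens E H →L[ℂ] H} (hT : Intertwines T) {c : ℝ}
    (h : ∀ z, c * ‖z‖ ^ 2 ≤ ‖T z‖ ^ 2) : ∀ n z, c * ‖z‖ ^ 2 ≤ ‖down T n z‖ ^ 2
  | 0, z => h z
  | n + 1, z => amp_bounded_below (hT.down n) (down_bounded_below hT h n) z

theorem tpow_expansive {T : tens E H →L[ℂ] H} (hT : Intertwines T)
    (h : ∀ z, 1 * ‖z‖ ^ 2 ≤ ‖T z‖ ^ 2) : ∀ n z, ‖z‖ ^ 2 ≤ ‖tpow T n z‖ ^ 2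
  | 0, z => le_rfl
  | n + 1, z => by
    rw [tpow_succ hT]
    have h1 := down_bounded_below hT h n z
    rw [one_mul] at h1
    exact h1.trans (tpow_expansive hT h n _)

/-- `S*S - I` is positive and its quadratic form vanishes at `z`, so it annihilates `z`. This is
proved by varying `z` along the real line through `w`. -/
theorem inner_eq_of_expansive {H₁ H₂ : HRep.{u} A} (S : H₁ →L[ℂ] H₂)
    (h : ∀ z, ‖z‖ ^ 2 ≤ ‖S z‖ ^ 2) {z : H₁} (hz : ‖S z‖ ^ 2 ≤ ‖z‖ ^ 2) (w : H₁) :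
    inner ℂ (S w) (S z) = inner ℂ w z := by
  have h1 : ∀ w, RCLike.re (inner ℂ (S w) (S z)) = RCLike.re (inner ℂ w z) := by
    intro w
    by_contra hne
    set r := RCLike.re (inner ℂ (S w) (S z)) - RCLike.re (inner ℂ w z) with hr
    set q := ‖S w‖ ^ 2 - ‖w‖ ^ 2 with hq
    have hr0 : r ≠ 0 := sub_ne_zero.mpr hne
    have key : ∀ t : ℝ, 0 ≤ t ^ 2 * q + 2 * t * r := fun t => by
      have h2 := h (((t : ℝ) : ℂ) • w + z)
      rw [map_add, map_smul, norm_add_sq (𝕜 := ℂ), norm_add_sq (𝕜 := ℂ), norm_smul, norm_smul,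
        inner_smul_left, inner_smul_left, Complex.conj_ofReal, mul_pow, mul_pow] at h2
      simp only [Complex.norm_real, Real.norm_eq_abs, sq_abs,
        RCLike.re_to_complex, Complex.re_ofReal_mul] at h2
      simp only [RCLike.re_to_complex] at hr
      rw [hr, hq]
      nlinarith
    -- The quadratic `t²q + 2tr` is negative at `t = -r/(q + 1)`; adding one to `q` avoids a case
    -- distinction at `q = 0`.
    have hq0 : 0 ≤ q := sub_nonneg.mpr (h w)
    have h3 := key (-r / (q + 1))
    have h4 : (-r / (q + 1)) ^ 2 * q + 2 * (-r / (q + 1)) * r =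
        -(r ^ 2 * (q + 2)) / (q + 1) ^ 2 := by
      field_simp
      ring
    rw [h4] at h3
    have h5 : 0 < r ^ 2 * (q + 2) / (q + 1) ^ 2 := by positivity
    rw [neg_div] at h3
    linarith
  refine Complex.ext (h1 w) ?_
  have h6 := h1 (Complex.I • w)
  rw [map_smul, inner_smul_left, inner_smul_left] at h6
  simpa using h6

/-- The growth condition implies that the range core and the subspace generated by the wandering
subspace are complementary. -/
theorem IsLeftInverse.woldOrth_of_growth {T : tens E H →L[ℂ] H} {L : H →L[ℂ] tens E H}
    (h : IsLeftInverse T L) (hexp : ∀ z, 1 * ‖z‖ ^ 2 ≤ ‖T z‖ ^ 2) {c : ℝ} {l : ℕ → ℝ}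
    (hc : 0 < c) (hl : ∀ m, 0 < l m) (hsum : ¬ Summable fun m => (l m)⁻¹)
    (hg : ∀ n ξ, ‖tpow T (n + 1) ξ‖ ^ 2 ≤
      l (n + 1) * (‖down T n ξ‖ ^ 2 - ‖ξ‖ ^ 2) + c * ‖ξ‖ ^ 2)
    (hcl : c ≤ 1 ∨ coreSub T = ⊥) : WoldOrth T := by
  -- At arbitrarily large indices the first term of the growth estimate is negligible for `Lₙ₊₁x`.
  -- The defects `d n` are summable, since `‖Lₙx‖²` drops by at least `d n` at each step. If the
  -- estimate failed for all large `n`, then `ε ≤ lₙ₊₁ d n`, and `∑ 1/lₘ` would converge.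
  have hfreq : ∀ x : H, ∀ ε > 0, ∀ N, ∃ n ≥ N,
      ‖tpow T (n + 1) (upPow L (n + 1) x)‖ ^ 2 ≤ ε + c * ‖upPow L (n + 1) x‖ ^ 2 := by
    intro x ε hε N
    set z : ∀ n, pow E H n := fun n => upPow L n x with hz
    set d : ℕ → ℝ := fun n => ‖down T n (z (n + 1))‖ ^ 2 - ‖z (n + 1)‖ ^ 2 with hd
    have hd0 : ∀ n, 0 ≤ d n := fun n => by
      have := down_bounded_below h.map hexp n (z (n + 1))
      rw [one_mul] at this
      exact sub_nonneg.mpr this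
    have hstep : ∀ n, ‖z (n + 1)‖ ^ 2 + d n ≤ ‖z n‖ ^ 2 := fun n => by
      have h1 : ‖down T n (z (n + 1))‖ ^ 2 ≤ ‖z n‖ ^ 2 := h.norm_sq_down_up_le n (z n)
      simp only [hd]; linarith
    have hpart : ∀ n, ∑ i ∈ Finset.range n, d i + ‖z n‖ ^ 2 ≤ ‖z 0‖ ^ 2 := fun n => by
      induction n with
      | zero => simp
      | succ n ih => rw [Finset.sum_range_succ]; linarith [hstep n]
    have hds : Summable d := summable_of_sum_range_le hd0 (c := ‖z 0‖ ^ 2)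
      fun n => by linarith [hpart n, sq_nonneg ‖z n‖]
    by_contra! hcon
    refine hsum ((summable_nat_add_iff (N + 1)).mp ?_)
    refine Summable.of_nonneg_of_le (fun n => (inv_pos.mpr (hl _)).le) (fun n => ?_)
      (((summable_nat_add_iff N).mpr hds).mul_left ε⁻¹)
    have h1 := hcon (n + N) (by omega)
    have h2 := hg (n + N) (z (n + N + 1))
    have h3 : ε ≤ l (n + N + 1) * d (n + N) := by simp only [hd]; linarith
    have h4 := hl (n + N + 1)
    rw [show n + (N + 1) = n + N + 1 by ring, inv_le_iff_one_le_mul₀ h4]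
    rw [mul_assoc, ← div_eq_inv_mul, le_div_iff₀ hε]
    linarith
  have hdecr : ∀ (x : H) n, ‖upPow L (n + 1) x‖ ^ 2 ≤ ‖upPow L n x‖ ^ 2 := fun x n => by
    have h1 := down_bounded_below h.map hexp n (upPow L (n + 1) x)
    rw [one_mul] at h1
    exact h1.trans (h.norm_sq_down_up_le n (upPow L n x))
  have hanti : ∀ x : H, Antitone fun n => ‖upPow L n x‖ ^ 2 := fun x =>
    antitone_nat_of_succ_le (hdecr x)
  -- For `c ≤ 1` a core vector satisfies `‖x‖ ≤ ‖Lₙx‖` with `x = TₙLₙx`. Equality in expansivity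
  -- gives `Tₙ*x = Lₙx`, and `Lₙx` lies in the range of `I ⊗ T`, orthogonal to wandering tensors.
  have hcore : ∀ x ∈ coreSub T, OrthGen T x := by
    rcases hcl with hcl | hcl
    · intro x hx n w hw
      have hx' := fun n => (h.mem_range_iff n x).mp ((Submodule.mem_iInf _).mp hx n)
      have h1 : ‖x‖ ^ 2 ≤ ‖upPow L n x‖ ^ 2 := by
        refine le_of_forall_pos_le_add fun ε hε => ?_
        obtain ⟨p, hp, h2⟩ := hfreq x ε hε n
        rw [hx'] at h2
        have h3 : ‖upPow L (p + 1) x‖ ^ 2 ≤ ‖upPow L n x‖ ^ 2 := hanti x (by omega : n ≤ p + 1)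
        nlinarith [sq_nonneg ‖upPow L (p + 1) x‖]
      have h4 := inner_eq_of_expansive (tpow T n) (tpow_expansive h.map hexp n)
        (z := upPow L n x) (by rw [hx']; exact h1) w
      rw [hx'] at h4
      rw [h4]
      have h5 : upPow L n x = down T n (upPow L (n + 1) x) := by
        conv_lhs => rw [← hx' (n + 1), tpow_succ h.map]
        exact h.upPow_tpow n _
      rw [h5]
      exact inner_down_of_wand h.map
        (Submodule.le_topologicalClosure _ (Submodule.subset_span hw)) _
    · intro x hx n w _
      rw [hcl, Submodule.mem_bot] at hx
      rw [hx, inner_zero_right]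
  -- The vectors `v = TₙLₙx` are bounded along the good indices, satisfy `⟪v, x⟫ = ‖x‖²`, and are
  -- eventually orthogonal to each complement of a range. Those complements span a dense subspace of
  -- the complement of the core, which forces `x = 0`.
  have hzero : ∀ x, OrthGen T x → x ∈ (coreSub T)ᗮ → x = 0 := by
    intro x hx hxc
    rw [h.coreSub_orthogonal] at hxc
    set C := √(1 + c * ‖x‖ ^ 2) with hC
    have hC0 : 0 < C := Real.sqrt_pos.mpr (by positivity)
    have key : ∀ ε > 0, ‖x‖ ^ 2 ≤ C * ε := by
      intro ε hε
      obtain ⟨y, hy, hxy⟩ := Metric.mem_closure_iff.mp hxc ε hε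
      obtain ⟨p, hp⟩ := (Submodule.mem_iSup_of_directed _ (Monotone.directed_le
        fun a b hab => Submodule.orthogonal_le (h.range_antitone hab))).mp hy
      obtain ⟨n, hn, h2⟩ := hfreq x 1 one_pos p
      set v := tpow T (n + 1) (upPow L (n + 1) x) with hv
      have hvC : ‖v‖ ≤ C := by
        refine Real.le_sqrt_of_sq_le (h2.trans ?_)
        have h3 : ‖upPow L (n + 1) x‖ ^ 2 ≤ ‖x‖ ^ 2 := hanti x (Nat.zero_le (n + 1))
        nlinarith
      have h3 : inner ℂ v y = 0 :=
        hp v (h.range_antitone (by omega : p ≤ n + 1) ⟨_, rfl⟩)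
      have h4 : inner ℂ v (x - y) = inner ℂ x x := by
        rw [inner_sub_right, h3, sub_zero, hv, h.inner_tpow_upPow hx]
      have h5 := norm_inner_le_norm (𝕜 := ℂ) v (x - y)
      rw [h4, inner_self_eq_norm_sq_to_K] at h5
      have h6 : ‖((‖x‖ : ℂ)) ^ 2‖ = ‖x‖ ^ 2 := by simp
      rw [dist_eq_norm] at hxy
      refine (h6.symm.le.trans h5).trans ?_
      exact mul_le_mul hvC hxy.le (norm_nonneg _) hC0.le
    have h7 : ‖x‖ ^ 2 ≤ 0 := by
      refine le_of_forall_pos_le_add fun ε hε => ?_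
      have := key (ε / C) (by positivity)
      rw [mul_div_cancel₀ _ hC0.ne'] at this
      linarith
    exact norm_eq_zero.mp (pow_eq_zero_iff two_ne_zero |>.mp (le_antisymm h7 (sq_nonneg _)))
  intro x
  refine ⟨fun hx => ?_, hcore x⟩
  have := h.isClosed_coreSub.completeSpace_coe
  obtain ⟨y, hy, z, hz, rfl⟩ := (coreSub T).exists_add_mem_mem_orthogonal x
  have h1 : OrthGen T z := fun n w hw => by
    have h2 := hx n w hw
    rwa [inner_add_right, hcore y hy n w hw, zero_add] at h2
  rw [hzero z h1 hz, add_zero]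
  exact hy

/-- `Faithful` only yields `σ(A)h = 0`. On a space with at least one tensor factor this already
means zero, by nondegeneracy of the left action, and the statement is transported there by the
injective `Tₙ₊₁`. -/
theorem faithful_pow (hE : Faithful E H) {T : tens E H →L[ℂ] H} {L : H →L[ℂ] tens E H}
    (h : IsLeftInverse T L) (n : ℕ) (x : pow E H (n + 1))
    (hx : ∀ ξ : E, tmul E (pow E H (n + 1)) ξ x = 0) : x = 0 := by
  refine dense_left x fun a => ?_
  have h1 : H.σ a (tpow T (n + 1) x) = 0 := hE _ (fun ξ => by
    rw [← amp_tmul E _ (h.map.tpow (n + 1)), hx, map_zero]) a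
  have h2 := congrArg (upPow L (n + 1)) h1
  rw [← h.map.tpow (n + 1), h.upPow_tpow, map_zero] at h2
  exact h2

/-- Iterated concavity bounds `‖Tₙ₊₁z‖²` by an affine function of `n`, which is the growth condition
with `lₘ = m` and `c = 1`. Nonnegativity of that bound for every `n` also yields the required
expansivity. -/
theorem IsLeftInverse.woldOrth_of_concave {T : tens E H →L[ℂ] H} {L : H →L[ℂ] tens E H}
    (h : IsLeftInverse T L) (hE : Faithful E H)
    (hT : ∀ x : tens E (tens E H), ‖T (amp E T x)‖ ^ 2 + ‖x‖ ^ 2 ≤ 2 * ‖amp E T x‖ ^ 2) :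
    WoldOrth T := by
  have hconc : ∀ n (z : pow E H (n + 2)),
      ‖down T n (down T (n + 1) z)‖ ^ 2 + ‖z‖ ^ 2 ≤ 2 * ‖down T (n + 1) z‖ ^ 2 := by
    intro n
    induction n with
    | zero => exact hT
    | succ n ih =>
      intro z
      have h1 := amp_quadratic (E := E) (a := 2) (b := -1) (c := -1) (h.map.down (n + 1))
        ((h.map.down n).comp (h.map.down (n + 1))) (Intertwines.id _) (fun x => by
          have h2 := ih x
          simp only [ContinuousLinearMap.comp_apply, ContinuousLinearMap.id_apply]
          linarith) z
      rw [amp_comp (h.map.down n) (h.map.down (n + 1)), amp_id] at h1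
      have h3 : 0 ≤ 2 * ‖down T (n + 2) z‖ ^ 2 + -1 * ‖down T (n + 1) (down T (n + 2) z)‖ ^ 2
        + -1 * ‖z‖ ^ 2 := h1
      linarith
  have hgrow : ∀ n (z : pow E H (n + 1)),
      ‖tpow T (n + 1) z‖ ^ 2 ≤ (n + 1) * ‖down T n z‖ ^ 2 - n * ‖z‖ ^ 2 := by
    intro n
    induction n with
    | zero =>
      intro z
      rw [tpow_succ h.map]
      refine le_of_eq ?_
      change ‖T z‖ ^ 2 = ((0 : ℕ) + 1) * ‖T z‖ ^ 2 - (0 : ℕ) * ‖z‖ ^ 2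
      simp
    | succ n ih =>
      intro z
      rw [tpow_succ h.map]
      change ‖tpow T (n + 1) (down T (n + 1) z)‖ ^ 2 ≤ _
      have h1 := ih (down T (n + 1) z)
      have h2 := hconc n z
      push_cast
      nlinarith [(n.cast_nonneg : (0 : ℝ) ≤ n)]
  -- Faithfulness enters here: lower bounds for `I_{E^{⊗ n}} ⊗ T` descend to `T` with the same
  -- constant.
  have hdesc : ∀ (c : ℝ) n, (∀ z, c * ‖z‖ ^ 2 ≤ ‖down T n z‖ ^ 2) →
      ∀ z, c * ‖z‖ ^ 2 ≤ ‖T z‖ ^ 2 := by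
    intro c n
    induction n with
    | zero => exact fun h => h
    | succ n ih =>
      exact fun h1 => ih (bounded_below_of_amp (faithful_pow hE h n) (h.map.down n) h1)
  -- Dropping the left side of `hgrow` gives the lower bound `n/(n + 1)` for `I_{E^{⊗ n}} ⊗ T`,
  -- hence for `T`; then `n → ∞`.
  have hexp : ∀ z, 1 * ‖z‖ ^ 2 ≤ ‖T z‖ ^ 2 := by
    intro z
    have h1 : ∀ n : ℕ, n * (‖z‖ ^ 2 - ‖T z‖ ^ 2) ≤ ‖T z‖ ^ 2 := fun n => by
      have hn : (0 : ℝ) < n + 1 := by positivity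
      have h2 := hdesc (n / (n + 1)) n (fun z => by
        have := hgrow n z
        have h3 := sq_nonneg ‖tpow T (n + 1) z‖
        rw [div_mul_eq_mul_div, div_le_iff₀ hn]
        linarith) z
      rw [div_mul_eq_mul_div, div_le_iff₀ hn] at h2
      linarith
    by_contra! hlt
    obtain ⟨n, hn⟩ := exists_nat_gt (‖T z‖ ^ 2 / (‖z‖ ^ 2 - ‖T z‖ ^ 2))
    rw [div_lt_iff₀ (by linarith)] at hn
    linarith [h1 n]
  refine h.woldOrth_of_growth hexp (c := 1) (l := fun m => if m = 0 then 1 else m) one_pos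
    (fun m => ?_) ?_ (fun n z => ?_) (Or.inl le_rfl)
  · split_ifs with hm
    · exact one_pos
    · exact_mod_cast Nat.pos_of_ne_zero hm
  · intro hs
    have h1 := (summable_nat_add_iff 1).mpr hs
    refine Real.not_summable_natCast_inv ((summable_nat_add_iff 1).mp ?_)
    refine h1.congr fun n => ?_
    simp
  · have := hgrow n z
    simp only [Nat.add_eq_zero_iff, one_ne_zero, and_false, if_false]
    push_cast
    linarith

/-- An estimate for `x` and `κ = (T* T)⁻¹ (I_E ⊗ S) x` is an instance of concavity of the Cauchy
dual `S`. -/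
theorem IsLeftInverse.woldOrth_of_concave_dual {T : tens E H →L[ℂ] H} {L : H →L[ℂ] tens E H}
    (h : IsLeftInverse T L) (hE : Faithful E H)
    (hT : ∀ (x : tens E (tens E H)) (κ : tens E H),
      ContinuousLinearMap.adjoint T (T κ) = amp E (ContinuousLinearMap.adjoint L) x →
      ‖T κ‖ ^ 2 + ‖x‖ ^ 2 ≤ 2 * ‖amp E (ContinuousLinearMap.adjoint L) x‖ ^ 2) :
    WoldOrth T := by
  refine h.woldOrth_of_dual (h.dual.woldOrth_of_concave hE fun x => ?_)
  set w := amp E (ContinuousLinearMap.adjoint L) x with hw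
  have h1 : T (L (ContinuousLinearMap.adjoint L w)) = ContinuousLinearMap.adjoint L w := by
    refine ext_inner_right ℂ fun v => ?_
    rw [h.inner_TL, ContinuousLinearMap.adjoint_inner_left, h.left_inv,
      ContinuousLinearMap.adjoint_inner_left]
  have h2 := hT x (L (ContinuousLinearMap.adjoint L w)) (by rw [h1, ← hw, h.dual.left_inv])
  -- For `κ = LL*w` one has `Tκ = L*w`, because `L*w` is in the range of `T`. So the estimate is
  -- concavity of `L*` at `x`.
  rwa [h1] at h2

theorem amp_adjoint_amp_dual {T : tens E H →L[ℂ] H} {L : H →L[ℂ] tens E H}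
    (h : IsLeftInverse T L) (x : tens E (tens E H)) :
    amp E (ContinuousLinearMap.adjoint T) (amp E (ContinuousLinearMap.adjoint L) x) = x := by
  change (amp E (ContinuousLinearMap.adjoint T) ∘L amp E (ContinuousLinearMap.adjoint L)) x = x
  rw [← amp_comp h.map.adjoint h.inv.adjoint]
  have : ContinuousLinearMap.adjoint T ∘L ContinuousLinearMap.adjoint L =
      ContinuousLinearMap.id ℂ _ := ContinuousLinearMap.ext h.dual.left_inv
  rw [this, amp_id]; rfl

end HRep

/-! ### The conditions (2), (3) and (4) for a covariant representation. -/

namespace CovRep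
open HRep
variable {E : Corr.{u} A} {H : HRep.{u} A} (V : CovRep E H)

theorem intertwines_tilde : Intertwines V.tilde := V.tilde_σ

theorem tildePow_eq : ∀ n, V.tildePow n = tpow V.tilde n
  | 0 => rfl
  | n + 1 => by
    change V.tilde ∘L amp E (V.tildePow n) = _
    rw [tildePow_eq n]; rfl

theorem lastPow_eq : ∀ n, V.lastPow n = down V.tilde n
  | 0 => rfl
  | n + 1 => by
    change amp E (V.lastPow n) = _
    rw [lastPow_eq n]; rfl

theorem core_eq : V.core = coreSub V.tilde := by
  simp only [core, coreSub, tildePow_eq]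

/-- Let `w = (I ⊗ L*)x` and let `κ` satisfy `T*Tκ = w`. Then the pairing of `(I ⊗ T)x + κ` with `w`
is `N = ‖Tκ‖² + ‖x‖²`. Cauchy-Schwarz and the condition give `N² ≤ 2N‖w‖²`, which is concavity of
the dual after cancelling `N`. -/
theorem woldOrth_of_shimorinCondition {L : H →L[ℂ] tens E H} (h : IsLeftInverse V.tilde L)
    (hE : Faithful E H) (hV : V.ShimorinCondition) : WoldOrth V.tilde := by
  refine h.woldOrth_of_concave_dual hE fun x κ hκ => ?_
  set w := amp E (ContinuousLinearMap.adjoint L) x with hw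
  set N := ‖V.tilde κ‖ ^ 2 + ‖x‖ ^ 2 with hN
  have h1 : inner ℂ (amp E V.tilde x + κ) w = ((N : ℝ) : ℂ) := by
    rw [inner_add_left]
    have h2 : inner ℂ (amp E V.tilde x) w = ((‖x‖ : ℂ)) ^ 2 := by
      rw [inner_amp h.map, hw, amp_adjoint_amp_dual h, inner_self_eq_norm_sq_to_K]; rfl
    have h3 : inner ℂ κ w = ((‖V.tilde κ‖ : ℂ)) ^ 2 := by
      rw [← hκ, ContinuousLinearMap.adjoint_inner_right, inner_self_eq_norm_sq_to_K]; rfl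
    rw [h2, h3, hN]
    push_cast
    ring
  have h4 := norm_inner_le_norm (𝕜 := ℂ) (amp E V.tilde x + κ) w
  have hN0 : 0 ≤ N := by positivity
  rw [h1, Complex.norm_real, Real.norm_of_nonneg hN0] at h4
  have h5 := hV x κ
  have h6 : N ^ 2 ≤ 2 * N * ‖w‖ ^ 2 := by
    calc N ^ 2 ≤ (‖amp E V.tilde x + κ‖ * ‖w‖) ^ 2 := pow_le_pow_left₀ hN0 h4 2
      _ = ‖amp E V.tilde x + κ‖ ^ 2 * ‖w‖ ^ 2 := mul_pow _ _ _
      _ ≤ _ := by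
        refine mul_le_mul_of_nonneg_right (h5.trans (le_of_eq ?_)) (sq_nonneg _)
        rw [hN]; ring
  rcases hN0.eq_or_lt with h0 | h0
  · rw [← h0]; positivity
  · nlinarith

/-- With `T*Tκ = (I ⊗ L*)x` one finds `Ã₂*Tκ = (I ⊗ T*L*)x = x`, so the condition at `κ` is
literally concavity of the Cauchy dual at `x`. -/
theorem woldOrth_of_dualCondition {L : H →L[ℂ] tens E H} (h : IsLeftInverse V.tilde L)
    (hE : Faithful E H) (hV : V.DualCondition) : WoldOrth V.tilde := by
  refine h.woldOrth_of_concave_dual hE fun x κ hκ => ?_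
  have h1 := hV κ
  have h2 : ContinuousLinearMap.adjoint V.tilde₂ (V.tilde κ) = x := by
    refine ext_inner_right ℂ fun v => ?_
    rw [ContinuousLinearMap.adjoint_inner_left]
    change inner ℂ (V.tilde κ) (V.tilde (amp E V.tilde v)) = _
    rw [← ContinuousLinearMap.adjoint_inner_left, hκ, ← inner_conj_symm, inner_amp h.map,
      amp_adjoint_amp_dual h, inner_conj_symm]
  rwa [h2, hκ] at h1

theorem woldOrth_of_growthCondition {L : H →L[ℂ] tens E H} (h : IsLeftInverse V.tilde L)
    (hV : V.GrowthCondition) : WoldOrth V.tilde := by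
  obtain ⟨hexp, c, l, hc, hl, hs, hg, hcl⟩ := hV
  refine h.woldOrth_of_growth (fun z => ?_) hc hl hs (fun n ξ => ?_) ?_
  · rw [one_mul]; exact pow_le_pow_left₀ (norm_nonneg _) (hexp z) 2
  · have := hg n ξ
    rwa [tildePow_eq, lastPow_eq] at this
  · rwa [core_eq] at hcl

end CovRep

/-! ### From orthogonality to the Wold decomposition of one representation. -/

namespace HRep
variable {E : Corr.{u} A} {H : HRep.{u} A}

theorem tmul_mem_tensSub {S : Submodule ℂ H} (ξ : E) {h : H} (hh : h ∈ S) :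
    tmul E H ξ h ∈ tensSub E H S :=
  Submodule.le_topologicalClosure _ (Submodule.subset_span ⟨ξ, h, hh, rfl⟩)

theorem map_tensSub_le {S S' : Submodule ℂ H} (hS' : IsClosed (S' : Set H))
    (T : tens E H →L[ℂ] H) (h : ∀ ξ, ∀ x ∈ S, T (tmul E H ξ x) ∈ S') {z : tens E H}
    (hz : z ∈ tensSub E H S) : T z ∈ S' := by
  have h1 : tensSub E H S ≤ S'.comap (T : tens E H →ₗ[ℂ] H) := by
    refine Submodule.topologicalClosure_minimal _ (Submodule.span_le.mpr ?_)
      (hS'.preimage T.continuous)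
    rintro _ ⟨ξ, x, hx, rfl⟩
    exact h ξ x hx
  exact h1 hz

/-- `E ⊗ S` and `E ⊗ Sᗮ` are orthogonal because `S` is `σ`-invariant, and together they span `E ⊗
H`; the component of `z` off `E ⊗ S` is thus orthogonal to everything. -/
theorem mem_tensSub_of_inner {S : Submodule ℂ H} (hS : IsClosed (S : Set H))
    (hσ : ∀ a, ∀ h ∈ S, H.σ a h ∈ S) {z : tens E H}
    (hz : ∀ ξ, ∀ h ∈ Sᗮ, inner ℂ (tmul E H ξ h) z = 0) : z ∈ tensSub E H S := by
  have hc : IsClosed (tensSub E H S : Set (tens E H)) := Submodule.isClosed_topologicalClosure _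
  have := hc.completeSpace_coe
  have := hS.completeSpace_coe
  obtain ⟨z₁, h₁, z₂, h₂, rfl⟩ := (tensSub E H S).exists_add_mem_mem_orthogonal z
  have h3 : ∀ ξ, ∀ h ∈ Sᗮ, inner ℂ (tmul E H ξ h) z₁ = 0 := fun ξ h hh => by
    have h4 : tensSub E H S ≤ (ℂ ∙ tmul E H ξ h)ᗮ := by
      refine Submodule.topologicalClosure_minimal _ (Submodule.span_le.mpr ?_)
        (Submodule.isClosed_orthogonal _)
      rintro _ ⟨η, k, hk, rfl⟩
      refine Submodule.mem_orthogonal_singleton_iff_inner_right.mpr ?_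
      rw [inner_tmul]
      exact Submodule.inner_left_of_mem_orthogonal (hσ _ k hk) hh
    exact Submodule.mem_orthogonal_singleton_iff_inner_right.mp (h4 h₁)
  have h5 : ∀ v, inner ℂ z₂ v = 0 := fun v => by
    refine mem_of_tmul_mem (S := LinearMap.ker (innerSL ℂ z₂ : tens E H →ₗ[ℂ] ℂ))
      (ContinuousLinearMap.isClosed_ker _) (fun ξ x => ?_) v
    change inner ℂ z₂ (tmul E H ξ x) = 0
    obtain ⟨x₁, hx₁, x₂, hx₂, rfl⟩ := S.exists_add_mem_mem_orthogonal x
    rw [tmul_add, inner_add_right,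
      Submodule.inner_left_of_mem_orthogonal (tmul_mem_tensSub ξ hx₁) h₂, zero_add,
      ← inner_conj_symm]
    have h6 := hz ξ x₂ hx₂
    rw [inner_add_right, h3 ξ x₂ hx₂, zero_add] at h6
    rw [h6, map_zero]
  rw [inner_self_eq_zero.mp (h5 z₂), add_zero]
  exact h₁

theorem mem_powSub_top : ∀ n (z : pow E H n), z ∈ powSub E H n ⊤
  | 0, z => Submodule.le_topologicalClosure _ (Submodule.subset_span (Set.mem_univ z))
  | n + 1, z => by
    refine mem_of_tmul_mem (Submodule.isClosed_topologicalClosure _) (fun ξ y => ?_) z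
    refine map_mem_closure (tmulL ξ).continuous (mem_powSub_top n y) fun w hw => ?_
    refine Submodule.span_induction (p := fun w _ => tmulL ξ w ∈
      Submodule.span ℂ (powSet E H (⊤ : Submodule ℂ H) (n + 1))) ?_ ?_ ?_ ?_ hw
    · exact fun w hw => Submodule.subset_span ⟨ξ, w, hw, rfl⟩
    · rw [map_zero]; exact zero_mem _
    · intro x y _ _ hx hy; rw [map_add]; exact add_mem hx hy
    · intro c x _ hx; rw [map_smul]; exact Submodule.smul_mem _ c hx

theorem powSet_range_le {T : tens E H →L[ℂ] H} (hT : Intertwines T) :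
    ∀ n, ∀ w ∈ powSet E H (LinearMap.range (T : tens E H →ₗ[ℂ] H)) n, ∃ z, down T n z = w
  | 0, w, hw => hw
  | n + 1, w, hw => by
    obtain ⟨ξ, w', hw', rfl⟩ := hw
    obtain ⟨z, rfl⟩ := powSet_range_le hT n w' hw'
    exact ⟨tmul E _ ξ z, amp_tmul E _ (hT.down n) ξ z⟩

end HRep

namespace CovRep
open HRep
variable {E : Corr.{u} A} {H : HRep.{u} A} (V : CovRep E H)

theorem mem_products_iff (S : Set H) :
    ∀ n y, y ∈ V.products S n ↔ ∃ w ∈ powSet E H S n, y = V.tildePow n w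
  | 0, y => ⟨fun h => ⟨y, h, rfl⟩, fun ⟨w, hw, h⟩ => h ▸ hw⟩
  | n + 1, y => by
    constructor
    · rintro ⟨ξ, w, hw, rfl⟩
      obtain ⟨z, hz, rfl⟩ := (mem_products_iff S n w).mp hw
      exact ⟨_, ⟨ξ, z, hz, rfl⟩, (V.tildePow_succ_tmul n ξ z).symm⟩
    · rintro ⟨_, ⟨ξ, z, hz, rfl⟩, rfl⟩
      exact ⟨ξ, _, (mem_products_iff S n _).mpr ⟨z, hz, rfl⟩, V.tildePow_succ_tmul n ξ z⟩

theorem frak_le {n : ℕ} {S S' : Submodule ℂ H} (hS' : IsClosed (S' : Set H))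
    (h : ∀ y ∈ V.products S n, y ∈ S') : V.frak n S ≤ S' :=
  Submodule.topologicalClosure_minimal _ (Submodule.span_le.mpr h) hS'

theorem products_subset_frak (n : ℕ) (S : Submodule ℂ H) {y : H} (hy : y ∈ V.products S n) :
    y ∈ V.frak n S :=
  Submodule.le_topologicalClosure _ (Submodule.subset_span hy)

theorem mem_orthogonal_frak_iff (n : ℕ) (S : Submodule ℂ H) (x : H) :
    x ∈ (V.frak n S)ᗮ ↔ ∀ y ∈ V.products S n, inner ℂ y x = 0 := by
  constructor
  · exact fun hx y hy => hx y (V.products_subset_frak n S hy)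
  · intro hx
    rw [Submodule.mem_orthogonal]
    have h1 : V.frak n S ≤ (ℂ ∙ x)ᗮ := V.frak_le (Submodule.isClosed_orthogonal _) fun y hy =>
      Submodule.mem_orthogonal_singleton_iff_inner_left.mpr (hx y hy)
    exact fun y hy => Submodule.mem_orthogonal_singleton_iff_inner_left.mp (h1 hy)

theorem op_mem_frak_succ {n : ℕ} {S : Submodule ℂ H} (ξ : E) {h : H} (hh : h ∈ V.frak n S) :
    V.op ξ h ∈ V.frak (n + 1) S := by
  have h1 : V.frak n S ≤ (V.frak (n + 1) S).comap (V.op ξ : H →ₗ[ℂ] H) :=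
    V.frak_le ((Submodule.isClosed_topologicalClosure _).preimage (V.op ξ).continuous)
      fun y hy => V.products_subset_frak _ _ ⟨ξ, y, hy, rfl⟩
  exact h1 hh

theorem orthGen_iff (x : H) :
    OrthGen V.tilde x ↔ x ∈ (⨆ n, V.frak n V.wandering)ᗮ := by
  rw [← Submodule.iInf_orthogonal, Submodule.mem_iInf]
  refine forall_congr' fun n => ?_
  rw [mem_orthogonal_frak_iff]
  constructor
  · intro hx y hy
    obtain ⟨w, hw, rfl⟩ := (V.mem_products_iff _ n y).mp hy
    rw [tildePow_eq]
    exact hx w hw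
  · intro hx w hw
    rw [← tildePow_eq]
    exact hx _ ((V.mem_products_iff _ n _).mpr ⟨w, hw, rfl⟩)

theorem exists_leftInverse (hV : V.LeftInvertible) : ∃ L, IsLeftInverse V.tilde L := by
  obtain ⟨δ, hδ, h⟩ := hV
  exact exists_isLeftInverse V.intertwines_tilde hδ h

/-- The range condition puts `Ãₙ*Ãₙ₊₁z` in `E^{⊗ n} ⊗ ran Ã`, which is orthogonal to the wandering
tensors. That condition starts at `n = 1`; for `n = 0` the claim is the definition of the wandering
subspace. -/
theorem inner_tildePow_of_nearIsometric (hV : V.NearIsometric) {n : ℕ} {w : pow E H n}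
    (hw : w ∈ powSub E H n V.wandering) (z : pow E H (n + 1)) :
    inner ℂ (V.tildePow n w) (V.tildePow (n + 1) z) = 0 := by
  rcases n with _ | n
  · rw [tildePow_eq, tildePow_eq, tpow_succ V.intertwines_tilde]
    exact inner_down_of_wand V.intertwines_tilde hw z
  · rw [← ContinuousLinearMap.adjoint_inner_right, ← inner_conj_symm]
    refine (map_eq_zero _).mpr (inner_eq_zero_of_powSub (fun y hy => ?_) (hV.2 (n + 1) (by omega) z))
    obtain ⟨v, rfl⟩ := powSet_range_le V.intertwines_tilde (n + 1) y hy
    rw [← inner_conj_symm]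
    exact (map_eq_zero _).mpr (inner_down_of_wand V.intertwines_tilde hw v)

theorem woldOrth_of_nearIsometric {L : H →L[ℂ] tens E H} (h : IsLeftInverse V.tilde L)
    (hV : V.NearIsometric) : WoldOrth V.tilde := by
  have hin : ∀ n, ∀ w ∈ powSub E H n (wand V.tilde), ∀ z,
      inner ℂ (tpow V.tilde n w) (tpow V.tilde (n + 1) z) = 0 := fun n w hw z => by
    rw [← tildePow_eq, ← tildePow_eq]
    exact V.inner_tildePow_of_nearIsometric hV hw z
  intro x
  constructor
  · intro hx
    refine (Submodule.mem_iInf _).mpr fun n => ?_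
    induction n with
    | zero => exact ⟨x, rfl⟩
    | succ n ih =>
      obtain ⟨z, hz⟩ := ih
      have hz' : tpow V.tilde n z = x := hz
      have h1 := h.sub_mem_wand n z
      -- `p` is the wandering part of `z`. Its image `Tₙp` is orthogonal to `x` and to `x - Tₙp`,
      -- which lies in the range of `Tₙ₊₁`; hence `Tₙp = 0` and `x` is itself in that range.
      set p := z - down V.tilde n (up L n z) with hp
      have h2 : tpow V.tilde (n + 1) (up L n z) = x - tpow V.tilde n p := by
        rw [tpow_succ h.map, hp, map_sub, hz', sub_sub_cancel]; rfl
      have h3 : inner ℂ (tpow V.tilde n p) x = 0 := by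
        rw [← ContinuousLinearMap.adjoint_inner_right]
        refine inner_eq_zero_of_powSub (fun w hw => ?_) h1
        rw [ContinuousLinearMap.adjoint_inner_right]
        exact hx n w hw
      have h4 := hin n p h1 (up L n z)
      rw [h2, inner_sub_right, h3, zero_sub, neg_eq_zero, inner_self_eq_zero] at h4
      rw [h4, sub_zero] at h2
      exact ⟨_, h2⟩
  · intro hx n w hw
    obtain ⟨z, rfl⟩ := (Submodule.mem_iInf _).mp hx (n + 1)
    exact hin n w (Submodule.le_topologicalClosure _ (Submodule.subset_span hw)) z

theorem range_tildePow_eq {L : H →L[ℂ] tens E H} (h : IsLeftInverse V.tilde L) (n : ℕ) :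
    LinearMap.range (V.tildePow n : pow E H n →ₗ[ℂ] H) = V.frak n ⊤ := by
  refine le_antisymm ?_ (V.frak_le ?_ fun y hy => ?_)
  · rintro _ ⟨z, rfl⟩
    have h1 : powSub E H n ⊤ ≤ (V.frak n ⊤).comap (V.tildePow n : pow E H n →ₗ[ℂ] H) := by
      refine Submodule.topologicalClosure_minimal _ (Submodule.span_le.mpr fun w hw => ?_)
        ((Submodule.isClosed_topologicalClosure _).preimage (V.tildePow n).continuous)
      exact V.products_subset_frak n ⊤ ((V.mem_products_iff _ n _).mpr ⟨w, hw, rfl⟩)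
    exact h1 (mem_powSub_top n z)
  · rw [tildePow_eq]; exact h.isClosed_range n
  · obtain ⟨w, _, rfl⟩ := (V.mem_products_iff _ n y).mp hy
    exact ⟨w, rfl⟩

theorem core_eq_iInf_frak (hV : V.LeftInvertible) : V.core = ⨅ n, V.frak n ⊤ := by
  obtain ⟨L, h⟩ := V.exists_leftInverse hV
  simp only [core, V.range_tildePow_eq h]

theorem wandering_eq : V.wandering = (V.frak 1 ⊤)ᗮ := by
  ext x
  rw [mem_orthogonal_frak_iff, wandering, Submodule.mem_orthogonal]
  constructor
  · rintro hx _ ⟨ξ, w, _, rfl⟩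
    exact hx _ ⟨tmul E H ξ w, V.tilde_tmul ξ w⟩
  · rintro hx _ ⟨z, rfl⟩
    have h1 : ∀ z, V.tilde z ∈ (ℂ ∙ x)ᗮ := map_mem_of_tmul V.tilde
      (Submodule.isClosed_orthogonal _) fun ξ y => by
        rw [tilde_tmul]
        exact Submodule.mem_orthogonal_singleton_iff_inner_left.mpr (hx _ ⟨ξ, y, trivial, rfl⟩)
    exact Submodule.mem_orthogonal_singleton_iff_inner_left.mp (h1 z)

theorem σ_mem_frak {n : ℕ} {S : Submodule ℂ H} (hS : ∀ a, ∀ h ∈ S, H.σ a h ∈ S) (a : A) {h : H}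
    (hh : h ∈ V.frak n S) : H.σ a h ∈ V.frak n S := by
  have h1 : V.frak n S ≤ (V.frak n S).comap (H.σ a : H →ₗ[ℂ] H) := by
    refine V.frak_le ((Submodule.isClosed_topologicalClosure _).preimage (H.σ a).continuous)
      fun y hy => V.products_subset_frak n S ?_
    cases n with
    | zero => exact hS a y hy
    | succ n =>
      obtain ⟨ξ, w, hw, rfl⟩ := hy
      exact ⟨E.left a ξ, w, hw, by rw [V.op_left]; rfl⟩
  exact h1 hh

theorem le_frak_one_of_invertibleOn {S : Submodule ℂ H} (hS : V.InvertibleOn S) :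
    S ≤ V.frak 1 S := by
  intro x hx
  obtain ⟨z, hz, rfl⟩ := hS.surjOn hx
  exact map_tensSub_le (Submodule.isClosed_topologicalClosure _) V.tilde (fun ξ y hy => by
    rw [tilde_tmul]; exact V.products_subset_frak 1 S ⟨ξ, y, hy, rfl⟩) hz

/-- Injectivity is global, from the left inverse. For surjectivity, each vector of the closed
subspace `𝔄₁(S)` is in the range of `Ã` and is sent by `L` into `E ⊗ S`. -/
theorem invertibleOn_of_le_frak_one (hV : V.LeftInvertible) {S : Submodule ℂ H}
    (hS : V.Reduces S) (h : S ≤ V.frak 1 S) : V.InvertibleOn S := by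
  obtain ⟨L, hL⟩ := V.exists_leftInverse hV
  refine ⟨fun z hz => map_tensSub_le hS.1 V.tilde (fun ξ y hy => by
    rw [tilde_tmul]; exact (hS.2.2 ξ).1 y hy) hz, fun z _ w _ hzw => ?_, fun x hx => ?_⟩
  · rw [← hL.left_inv z, hzw, hL.left_inv]
  · have h1 : V.frak 1 S ≤ (tensSub E H S).comap (L : H →ₗ[ℂ] tens E H) ⊓
        LinearMap.range (V.tildePow 1 : pow E H 1 →ₗ[ℂ] H) := by
      refine V.frak_le ?_ ?_
      · refine IsClosed.inter ?_ ?_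
        · exact (Submodule.isClosed_topologicalClosure _).preimage L.continuous
        · rw [tildePow_eq]; exact hL.isClosed_range 1
      · rintro _ ⟨ξ, w, hw, rfl⟩
        refine ⟨?_, ⟨tmul E H ξ w, V.tildePow_succ_tmul 0 ξ w⟩⟩
        change L (V.op ξ w) ∈ tensSub E H S
        rw [← tilde_tmul, hL.left_inv]
        exact tmul_mem_tensSub ξ hw
    obtain ⟨h2, z, hz⟩ := h1 (h hx)
    have hz' : V.tilde (amp E (ContinuousLinearMap.id ℂ H) z) = x := hz
    refine ⟨L x, h2, ?_⟩
    rw [← hz', hL.left_inv]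

/-- The core is invariant as an intersection of the `𝔄ₙ(H)`, and its complement is invariant because
it is generated by the wandering subspace. Invertibility on the core amounts to `L` mapping the core
into `E ⊗ core`. -/
theorem admitsWold_of_woldOrth (hV : V.LeftInvertible) (h : WoldOrth V.tilde) : V.AdmitsWold := by
  obtain ⟨L, hL⟩ := V.exists_leftInverse hV
  have hcl : IsClosed (V.core : Set H) := by rw [core_eq]; exact hL.isClosed_coreSub
  have hcore : V.core = (⨆ n, V.frak n V.wandering)ᗮ := by
    ext x
    rw [← orthGen_iff, h, core_eq]
  have hgen : (⨆ n, V.frak n V.wandering).topologicalClosure = V.coreᗮ := by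
    rw [hcore, Submodule.orthogonal_orthogonal_eq_closure]
  have hfr := V.core_eq_iInf_frak hV
  have hσ : ∀ a, ∀ h ∈ V.core, H.σ a h ∈ V.core := fun a h hh => by
    rw [hfr, Submodule.mem_iInf] at hh ⊢
    exact fun n => V.σ_mem_frak (S := ⊤) (fun _ _ _ => Submodule.mem_top) a (hh n)
  have hred : V.Reduces V.core := by
    refine ⟨hcl, hσ, fun ξ => ⟨fun h hh => ?_, fun h hh => ?_⟩⟩
    · rw [hfr, Submodule.mem_iInf] at hh ⊢
      intro n
      cases n with
      | zero => exact V.products_subset_frak 0 ⊤ trivial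
      | succ n => exact V.op_mem_frak_succ ξ (hh n)
    · rw [← hgen] at hh ⊢
      refine map_mem_closure (V.op ξ).continuous hh fun y hy => ?_
      refine Submodule.iSup_induction _ (motive := fun y => V.op ξ y ∈ ⨆ n, V.frak n V.wandering)
        hy (fun n y hy => ?_) ?_ fun y z hy hz => ?_
      · exact Submodule.mem_iSup_of_mem (n + 1) (V.op_mem_frak_succ ξ hy)
      · rw [map_zero]; exact zero_mem _
      · rw [map_add]; exact add_mem hy hz
  refine ⟨hred, V.invertibleOn_of_le_frak_one hV hred fun x hx => ?_, hgen⟩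
  have hx' : ∀ n, x ∈ LinearMap.range (tpow V.tilde n : pow E H n →ₗ[ℂ] H) := by
    rw [core_eq] at hx
    exact (Submodule.mem_iInf _).mp hx
  have hTL : V.tilde (L x) = x := by
    obtain ⟨z, rfl⟩ := hx' 1
    have : V.tilde (L (V.tilde (amp E (ContinuousLinearMap.id ℂ H) z))) =
      V.tilde (amp E (ContinuousLinearMap.id ℂ H) z) := by rw [hL.left_inv]
    exact this
  have hLx : L x ∈ tensSub E H V.core := by
    refine mem_tensSub_of_inner hcl hσ fun ξ y hy => ?_
    -- It suffices to test against `ξ ⊗ y` with `y` orthogonal to the range of some `Tₙ`. Writing `x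
    -- = Tₙ₊₁w` gives `Lx = (I ⊗ Tₙ)w`, and `Tₙ*y = 0`.
    have h1 : V.coreᗮ ≤ LinearMap.ker (((innerSL ℂ (L x)) ∘L tmulL ξ : H →L[ℂ] ℂ) : H →ₗ[ℂ] ℂ) := by
      rw [core_eq, hL.coreSub_orthogonal]
      refine Submodule.topologicalClosure_minimal _ (iSup_le fun n y hy => ?_)
        (ContinuousLinearMap.isClosed_ker _)
      change inner ℂ (L x) (tmul E H ξ y) = 0
      obtain ⟨w, hw⟩ := hx' (n + 1)
      have hw' : V.tilde (amp E (tpow V.tilde n) w) = x := hw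
      have h2 : ContinuousLinearMap.adjoint (tpow V.tilde n) y = 0 :=
        ext_inner_left ℂ fun v => by
          rw [ContinuousLinearMap.adjoint_inner_right, inner_zero_right]
          exact hy _ ⟨v, rfl⟩
      have h3 := inner_amp (hL.map.tpow n) w (tmul E H ξ y)
      rw [amp_tmul E _ (hL.map.tpow n).adjoint, h2] at h3
      rw [← hw', hL.left_inv, h3]
      have : tmul E (pow E H n) ξ 0 = 0 := map_zero (tmulL ξ)
      rw [this]
      exact inner_zero_right _
    have h2 : inner ℂ (L x) (tmul E H ξ y) = 0 := h1 hy
    rw [← inner_conj_symm, h2, map_zero]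
  rw [← hTL]
  exact map_tensSub_le (Submodule.isClosed_topologicalClosure _) V.tilde (fun ξ y hy => by
    rw [tilde_tmul]; exact V.products_subset_frak 1 _ ⟨ξ, y, hy, rfl⟩) hLx

theorem WoldHypothesis.admitsWold {V : CovRep E H} (hV : V.WoldHypothesis) : V.AdmitsWold := by
  obtain ⟨hl, hV⟩ := hV
  obtain ⟨L, h⟩ := V.exists_leftInverse hl
  rcases hV with hV | hV | ⟨hE, hV | hV | hV⟩ | hV
  · exact hV
  · exact V.admitsWold_of_woldOrth hl (V.woldOrth_of_nearIsometric h hV)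
  · exact V.admitsWold_of_woldOrth hl (h.woldOrth_of_concave hE hV)
  · exact V.admitsWold_of_woldOrth hl (V.woldOrth_of_shimorinCondition h hE hV)
  · exact V.admitsWold_of_woldOrth hl (V.woldOrth_of_dualCondition h hE hV)
  · exact V.admitsWold_of_woldOrth hl (V.woldOrth_of_growthCondition h hV)

/-- For `n < n'` the second subspace lies in the range of `Ãₙ₊₁`, to which `Ãₙ` of the wandering
tensors is orthogonal. -/
theorem frak_wandering_orthogonal {V : CovRep E H} (hV : V.NearIsometric) {n n' : ℕ}
    (hn : n < n') : V.frak n V.wandering ⟂ V.frak n' V.wandering := by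
  have hl : V.LeftInvertible := hV.1.imp fun δ h => ⟨h.1, fun x => (h.2 x).1⟩
  obtain ⟨L, h⟩ := V.exists_leftInverse hl
  rw [Submodule.isOrtho_iff_le]
  refine V.frak_le (Submodule.isClosed_orthogonal _) fun y hy => ?_
  rw [mem_orthogonal_frak_iff]
  intro x hx
  obtain ⟨w, hw, rfl⟩ := (V.mem_products_iff _ _ _).mp hy
  obtain ⟨w', _, rfl⟩ := (V.mem_products_iff _ _ _).mp hx
  rw [V.tildePow_eq n']
  obtain ⟨z, hz⟩ := h.range_antitone (by omega : n + 1 ≤ n') ⟨w', rfl⟩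
  rw [← inner_conj_symm]
  refine (map_eq_zero _).mpr (Eq.trans ?_ (V.inner_tildePow_of_nearIsometric hV
    (Submodule.le_topologicalClosure _ (Submodule.subset_span hw)) z))
  rw [V.tildePow_eq (n + 1)]
  exact congrArg (inner ℂ _) hz.symm

end CovRep

/-! ### Reducing subspaces and their projections. -/

/-- `P` is the orthogonal projection onto `S`. -/
structure IsProj {H : Type*} [NormedAddCommGroup H] [InnerProductSpace ℂ H] (S : Submodule ℂ H)
    (P : H →L[ℂ] H) : Prop where
  mem : ∀ h, P h ∈ S
  sub_mem : ∀ h, h - P h ∈ Sᗮ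

namespace IsProj
variable {H : Type*} [NormedAddCommGroup H] [InnerProductSpace ℂ H] {S : Submodule ℂ H}
  {P : H →L[ℂ] H}

theorem exists_of_isClosed [CompleteSpace H] (hS : IsClosed (S : Set H)) :
    ∃ P : H →L[ℂ] H, IsProj S P := by
  have := hS.completeSpace_coe
  exact ⟨S.starProjection, fun h => S.starProjection_apply_mem h,
    fun h => S.sub_starProjection_mem_orthogonal h⟩

theorem eq_of_mem (hP : IsProj S P) {x y : H} (hy : y ∈ S) (hxy : x - y ∈ Sᗮ) : P x = y := by
  have h1 : P x - y ∈ S := Submodule.sub_mem _ (hP.mem x) hy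
  have h2 : P x - y ∈ Sᗮ := by
    have := Submodule.sub_mem _ hxy (hP.sub_mem x)
    rwa [sub_sub_sub_cancel_left] at this
  exact sub_eq_zero.mp (inner_self_eq_zero.mp (h2 _ h1 : inner ℂ (P x - y) (P x - y) = 0))

theorem apply_of_mem (hP : IsProj S P) {x : H} (hx : x ∈ S) : P x = x :=
  hP.eq_of_mem hx (by rw [sub_self]; exact zero_mem _)

theorem inner_apply (hP : IsProj S P) (x y : H) : inner ℂ (P x) y = inner ℂ x (P y) := by
  have h1 : inner ℂ (P x) (y - P y) = 0 := hP.sub_mem y _ (hP.mem x)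
  have h2 : inner ℂ (x - P x) (P y) = 0 :=
    Submodule.inner_left_of_mem_orthogonal (hP.mem y) (hP.sub_mem x)
  rw [inner_sub_right, sub_eq_zero] at h1
  rw [inner_sub_left, sub_eq_zero] at h2
  rw [h1, h2]

theorem map_orthogonal (hP : IsProj S P) {C : Submodule ℂ H} (hC : ∀ x ∈ C, P x ∈ C) {x : H}
    (hx : x ∈ Cᗮ) : P x ∈ Cᗮ := fun y hy => by
  rw [← hP.inner_apply]
  exact hx _ (hC y hy)

end IsProj

namespace CovRep
variable {E : Corr.{u} A} {H : HRep.{u} A} {V : CovRep E H}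

/-- For closed subspaces, the complement of the intersection is the closed span of the complements,
and invariance passes to closed spans. -/
theorem reduces_iInf {ι : Sort*} {S : ι → Submodule ℂ H} (h : ∀ i, V.Reduces (S i)) :
    V.Reduces (⨅ i, S i) := by
  have horth : (⨅ i, S i)ᗮ = (⨆ i, (S i)ᗮ).topologicalClosure := by
    rw [← Submodule.orthogonal_orthogonal_eq_closure]
    refine congrArg _ (le_antisymm ?_ (le_iInf fun i => ?_))
    · refine (Submodule.le_orthogonal_orthogonal _).trans (Submodule.orthogonal_le ?_)
      exact iSup_le fun i => Submodule.orthogonal_le (iInf_le S i)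
    · have := (h i).1.completeSpace_coe
      conv_rhs => rw [← (S i).orthogonal_orthogonal]
      exact Submodule.orthogonal_le (le_iSup (fun i => (S i)ᗮ) i)
  refine ⟨?_, fun a x hx => ?_, fun ξ => ⟨fun x hx => ?_, fun x hx => ?_⟩⟩
  · rw [Submodule.coe_iInf]
    exact isClosed_iInter fun i => (h i).1
  · rw [Submodule.mem_iInf] at hx ⊢
    exact fun i => (h i).2.1 a x (hx i)
  · rw [Submodule.mem_iInf] at hx ⊢
    exact fun i => ((h i).2.2 ξ).1 x (hx i)
  · rw [horth] at hx ⊢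
    have h1 : (⨆ i, (S i)ᗮ) ≤ (⨆ i, (S i)ᗮ).comap (V.op ξ : H →ₗ[ℂ] H) :=
      iSup_le fun i y hy => Submodule.mem_iSup_of_mem i (((h i).2.2 ξ).2 y hy)
    exact map_mem_closure (V.op ξ).continuous hx fun y hy => h1 hy

theorem reduces_inf {S S' : Submodule ℂ H} (h : V.Reduces S) (h' : V.Reduces S') :
    V.Reduces (S ⊓ S') := by
  rw [inf_eq_iInf]
  exact reduces_iInf fun b => by cases b <;> assumption

theorem σ_mem_orthogonal {S : Submodule ℂ H} (hS : ∀ a, ∀ h ∈ S, H.σ a h ∈ S) (a : A) {h : H}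
    (hh : h ∈ Sᗮ) : H.σ a h ∈ Sᗮ := fun y hy => by
  rw [← star_star a, ← H.act_adj]
  exact hh _ (hS _ y hy)

theorem reduces_orthogonal {S : Submodule ℂ H} (h : V.Reduces S) : V.Reduces Sᗮ := by
  refine ⟨Submodule.isClosed_orthogonal S, fun a x hx => σ_mem_orthogonal h.2.1 a hx,
    fun ξ => ⟨(h.2.2 ξ).2, ?_⟩⟩
  have := h.1.completeSpace_coe
  rw [Submodule.orthogonal_orthogonal]
  exact (h.2.2 ξ).1

theorem Reduces.proj_op {S : Submodule ℂ H} (h : V.Reduces S) {P : H →L[ℂ] H} (hP : IsProj S P)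
    (ξ : E) (x : H) : P (V.op ξ x) = V.op ξ (P x) := by
  refine hP.eq_of_mem ((h.2.2 ξ).1 _ (hP.mem x)) ?_
  rw [← map_sub]
  exact (h.2.2 ξ).2 _ (hP.sub_mem x)

/-- An operator that commutes with the operators of the representation maps `𝔄ₙ(S)` into
`𝔄ₙ(S')` if it maps `S` into `S'`. -/
theorem map_frak {B : H →L[ℂ] H} (hB : ∀ ξ x, B (V.op ξ x) = V.op ξ (B x)) {S S' : Submodule ℂ H}
    (hS : ∀ x ∈ S, B x ∈ S') {n : ℕ} {x : H} (hx : x ∈ V.frak n S) : B x ∈ V.frak n S' := by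
  have h1 : ∀ n, ∀ y ∈ V.products S n, B y ∈ V.products S' n := by
    intro n
    induction n with
    | zero => exact hS
    | succ n ih =>
      rintro _ ⟨ξ, w, hw, rfl⟩
      exact ⟨ξ, B w, ih w hw, hB ξ w⟩
  have h2 : V.frak n S ≤ (V.frak n S').comap (B : H →ₗ[ℂ] H) :=
    V.frak_le ((Submodule.isClosed_topologicalClosure _).preimage B.continuous)
      fun y hy => V.products_subset_frak n S' (h1 n y hy)
  exact h2 hx

theorem frak_mono {S S' : Submodule ℂ H} (h : S ≤ S') (n : ℕ) : V.frak n S ≤ V.frak n S' :=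
  fun _ hx => map_frak (B := ContinuousLinearMap.id ℂ H) (fun _ _ => rfl) (fun _ hx => h hx) hx

theorem Reduces.proj_mem_frak_top {S : Submodule ℂ H} (h : V.Reduces S) {P : H →L[ℂ] H}
    (hP : IsProj S P) {n : ℕ} {x : H} (hx : x ∈ V.frak n ⊤) : P x ∈ V.frak n ⊤ :=
  map_frak (h.proj_op hP) (fun _ _ => Submodule.mem_top) hx

theorem Reduces.proj_mem_wandering {S : Submodule ℂ H} (h : V.Reduces S) {P : H →L[ℂ] H}
    (hP : IsProj S P) {x : H} (hx : x ∈ V.wandering) : P x ∈ V.wandering := by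
  rw [wandering_eq] at hx ⊢
  exact hP.map_orthogonal (fun _ hy => h.proj_mem_frak_top hP hy) hx

theorem Reduces.proj_mem_core (hV : V.LeftInvertible) {S : Submodule ℂ H} (h : V.Reduces S)
    {P : H →L[ℂ] H} (hP : IsProj S P) {x : H} (hx : x ∈ V.core) : P x ∈ V.core := by
  rw [V.core_eq_iInf_frak hV, Submodule.mem_iInf] at hx ⊢
  exact fun n => h.proj_mem_frak_top hP (hx n)

theorem Reduces.frak_le {S : Submodule ℂ H} (h : V.Reduces S) (n : ℕ) : V.frak n S ≤ S := by
  refine V.frak_le h.1 ?_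
  induction n with
  | zero => exact fun y hy => hy
  | succ n ih =>
    rintro _ ⟨ξ, w, hw, rfl⟩
    exact (h.2.2 ξ).1 w (ih w hw)

/-- A reducing subspace on which the representation is pure is generated by its intersection with
the wandering subspace. -/
theorem Reduces.le_iSup_frak (hW : V.AdmitsWold) {S : Submodule ℂ H} (h : V.Reduces S)
    (hS : S ≤ V.coreᗮ) : S ≤ (⨆ n, V.frak n (S ⊓ V.wandering)).topologicalClosure := by
  obtain ⟨P, hP⟩ := IsProj.exists_of_isClosed h.1
  intro x hx
  have h1 := hS hx
  rw [← hW.2.2] at h1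
  rw [← hP.apply_of_mem hx]
  refine map_mem_closure P.continuous h1 fun y hy => ?_
  have h2 : (⨆ n, V.frak n V.wandering) ≤
      (⨆ n, V.frak n (S ⊓ V.wandering)).comap (P : H →ₗ[ℂ] H) :=
    iSup_le fun n y hy => Submodule.mem_iSup_of_mem n
      (map_frak (S' := S ⊓ V.wandering) (h.proj_op hP)
        (fun z hz => ⟨hP.mem z, h.proj_mem_wandering hP hz⟩) hy)
  exact h2 hy

/-- Invertibility on the core puts the core inside its own `𝔄₁`; the projection onto `S` commutes
with the representation and carries this over to `S`. -/
theorem Reduces.le_frak_one (hW : V.AdmitsWold) {S : Submodule ℂ H} (h : V.Reduces S)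
    (hS : S ≤ V.core) : S ≤ V.frak 1 S := by
  obtain ⟨P, hP⟩ := IsProj.exists_of_isClosed h.1
  intro x hx
  rw [← hP.apply_of_mem hx]
  exact map_frak (h.proj_op hP) (fun z _ => hP.mem z)
    (V.le_frak_one_of_invertibleOn hW.2.1 (hS hx))

theorem wandering_le (hW : V.AdmitsWold) : V.wandering ≤ V.coreᗮ := by
  rw [← hW.2.2]
  refine le_trans ?_ (Submodule.le_topologicalClosure _)
  exact le_trans (fun x hx => V.products_subset_frak 0 _ hx)
    (le_iSup (fun n => V.frak n V.wandering) 0)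

theorem isClosed_wandering : IsClosed (V.wandering : Set H) := Submodule.isClosed_orthogonal _

/-- Identifies the wandering subspace of a restriction. The image of the component of a vector in
`Sᗮ` stays in `Sᗮ`, so only the component in `S` can pair with a vector of `S`. -/
theorem Reduces.inf_orthogonal_frak_one {S : Submodule ℂ H} (h : V.Reduces S) :
    S ⊓ (V.frak 1 S)ᗮ = S ⊓ V.wandering := by
  refine le_antisymm (le_inf inf_le_left fun x hx => ?_) (inf_le_inf le_rfl ?_)
  · rw [wandering_eq, mem_orthogonal_frak_iff]
    rintro _ ⟨ξ, w, _, rfl⟩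
    obtain ⟨P, hP⟩ := IsProj.exists_of_isClosed h.1
    have h1 : V.op ξ w = V.op ξ (P w) + V.op ξ (w - P w) := by rw [← map_add, add_sub_cancel]
    rw [h1, inner_add_left,
      (V.mem_orthogonal_frak_iff 1 S x).mp hx.2 _ ⟨ξ, P w, hP.mem w, rfl⟩, zero_add]
    exact Submodule.inner_left_of_mem_orthogonal hx.1 ((h.2.2 ξ).2 _ (hP.sub_mem w))
  · rw [wandering_eq]
    exact Submodule.orthogonal_le (frak_mono le_top 1)

end CovRep

/-! ### Consequences of the twisted and doubly twisted relations. -/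

namespace DoublyTwistedRep
open HRep
variable {k : ℕ} {X : ProductSystem.{u} A k} {H : HRep.{u} A} (R : DoublyTwistedRep X H)

theorem U_op {i j : Fin k} (hij : i ≠ j) (l : Fin k) (ξ : X.E l) (h : H) :
    R.U i j ((R.V l).op ξ h) = (R.V l).op ξ (R.U i j h) := by
  have h1 := congrArg (fun T => T (tmul (X.E l) H ξ h)) (R.U_tilde i j hij l)
  simp only [ContinuousLinearMap.comp_apply] at h1
  rw [amp_tmul _ _ fun a x => congrArg (fun T : H →L[ℂ] H => T x) (R.U_σ i j hij a),
    CovRep.tilde_tmul, CovRep.tilde_tmul] at h1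
  exact h1.symm

theorem inner_U {i j : Fin k} (hij : i ≠ j) (x y : H) :
    inner ℂ (R.U i j x) y = inner ℂ x (R.U j i y) := by
  rw [R.U_star i j hij, ContinuousLinearMap.star_eq_adjoint,
    ContinuousLinearMap.adjoint_inner_right]

theorem U_mem_wandering {i j : Fin k} (hij : i ≠ j) (l : Fin k) {x : H}
    (hx : x ∈ (R.V l).wandering) : R.U i j x ∈ (R.V l).wandering := by
  rw [CovRep.wandering_eq] at hx ⊢
  intro y hy
  rw [← R.inner_U hij.symm]
  exact hx _ (CovRep.map_frak (R.U_op hij.symm l) (fun _ _ => Submodule.mem_top) hy)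

/-- The twisted commutation relation on elementary tensors. -/
theorem op_op_mem {i j : Fin k} (hij : i ≠ j) {M : Submodule ℂ H} (hM : IsClosed (M : Set H))
    (hU : ∀ x ∈ M, R.U i j x ∈ M) {h : H}
    (h1 : ∀ η ξ, (R.V j).op η ((R.V i).op ξ h) ∈ M) (ξ : X.E i) (η : X.E j) :
    (R.V i).op ξ ((R.V j).op η h) ∈ M := by
  have h2 := congrArg (fun T => T (tmul (X.E i) _ ξ (tmul (X.E j) H η h))) (R.twisted i j hij)
  simp only [ContinuousLinearMap.comp_apply] at h2
  rw [amp_tmul _ _ (R.V j).intertwines_tilde, CovRep.tilde_tmul, CovRep.tilde_tmul] at h2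
  rw [h2]
  refine hU _ ?_
  have h3 : flipIso (X.u i j) H (tmul (X.E i) _ ξ (tmul (X.E j) H η h)) =
      assoc (X.E j) (X.E i) H (tmul _ H ((X.u i j).toEquiv (Corr.tmul _ _ ξ η)) h) := by
    rw [← ampIso_tmul, ← assoc_tmul]
    change assoc _ _ H (ampIso _ H ((assoc _ _ H).symm (assoc _ _ H _))) = _
    rw [LinearIsometryEquiv.symm_apply_apply]
  -- The image of `ξ ⊗ η` under the isomorphism is only a limit of sums of elementary tensors, so
  -- the relation cannot be stated for single operators. Membership in a closed subspace survives
  -- linear combinations and limits, which explains the form of the statement.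
  have h4 : ∀ z : (X.E j).tens (X.E i), (R.V j).tilde (amp (X.E j) (R.V i).tilde
      (assoc (X.E j) (X.E i) H (tmul _ H z h))) ∈ M := by
    intro z
    refine (Corr.dense_tensMap (X.E j) (X.E i)).induction_on (p := fun z =>
      (R.V j).tilde (amp (X.E j) (R.V i).tilde (assoc (X.E j) (X.E i) H (tmul _ H z h))) ∈ M)
      z ?_ fun t => ?_
    · refine hM.preimage ?_
      exact (R.V j).tilde.continuous.comp ((amp (X.E j) (R.V i).tilde).continuous.comp
        ((assoc (X.E j) (X.E i) H).continuous.comp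
          (ContinuousLinearMap.flip (tmulL (E := (X.E j).tens (X.E i)) (H := H)) h).continuous))
    · have h5 : (⊤ : Submodule ℂ (X.E j ⊗[ℂ] X.E i)) ≤ M.comap
          (((R.V j).tilde : tens (X.E j) H →ₗ[ℂ] H) ∘ₗ
          (amp (X.E j) (R.V i).tilde : tens (X.E j) (tens (X.E i) H) →ₗ[ℂ] tens (X.E j) H) ∘ₗ
          ((assoc (X.E j) (X.E i) H).toLinearEquiv :
            tens ((X.E j).tens (X.E i)) H →ₗ[ℂ] tens (X.E j) (tens (X.E i) H)) ∘ₗ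
          ((ContinuousLinearMap.flip (tmulL (E := (X.E j).tens (X.E i)) (H := H)) h :
            (X.E j).tens (X.E i) →L[ℂ] tens ((X.E j).tens (X.E i)) H) :
            (X.E j).tens (X.E i) →ₗ[ℂ] tens ((X.E j).tens (X.E i)) H) ∘ₗ
          Corr.tensMap (X.E j) (X.E i)) := by
        rw [← TensorProduct.span_tmul_eq_top, Submodule.span_le]
        rintro _ ⟨η', ξ', rfl⟩
        change (R.V j).tilde (amp (X.E j) (R.V i).tilde
          (assoc (X.E j) (X.E i) H (tmul _ H (Corr.tmul (X.E j) (X.E i) η' ξ') h))) ∈ M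
        rw [assoc_tmul, amp_tmul _ _ (R.V i).intertwines_tilde, CovRep.tilde_tmul,
          CovRep.tilde_tmul]
        exact h1 η' ξ'
      exact h5 (Submodule.mem_top (x := t))
  have h5 := h4 ((X.u i j).toEquiv (Corr.tmul _ _ ξ η))
  rw [← h3] at h5
  exact h5

/-- The wandering subspace is the kernel of `Ã⁽ʲ⁾*`, and the doubly twisted relation expresses
`Ã⁽ʲ⁾*Ã⁽ⁱ⁾(ξ ⊗ h)` through `ξ ⊗ Ã⁽ʲ⁾*h`. -/
theorem op_mem_wandering {i j : Fin k} (hij : i ≠ j) (ξ : X.E i) {h : H}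
    (hh : h ∈ (R.V j).wandering) : (R.V i).op ξ h ∈ (R.V j).wandering := by
  have h0 : ∀ x, x ∈ (R.V j).wandering ↔ ContinuousLinearMap.adjoint (R.V j).tilde x = 0 :=
    fun x => by
      refine (mem_wand_iff (R.V j).tilde x).trans ⟨fun hx => ?_, fun hx z => ?_⟩
      · refine ext_inner_right ℂ fun v => ?_
        rw [ContinuousLinearMap.adjoint_inner_left, hx, inner_zero_left]
      · rw [← ContinuousLinearMap.adjoint_inner_left, hx, inner_zero_left]
  rw [h0] at hh ⊢
  have h1 := congrArg (fun T => T (tmul (X.E i) H ξ h)) (R.doubly i j hij)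
  simp only [ContinuousLinearMap.comp_apply] at h1
  rw [CovRep.tilde_tmul, amp_tmul _ _ (R.V j).intertwines_tilde.adjoint, hh] at h1
  have h2 : tmul (X.E i) (tens (X.E j) H) ξ 0 = 0 := map_zero (tmulL ξ)
  rw [h1, h2, map_zero, map_zero, map_zero]

/-- The subspaces `𝔄⁽ⁱ⁾ₚ(S)` are invariant under the operators with index `j ≠ i` if `S` is. -/
theorem op_mem_frak {i j : Fin k} (hij : j ≠ i) {S : Submodule ℂ H}
    (hSU : ∀ x ∈ S, R.U j i x ∈ S) (hSj : ∀ η, ∀ x ∈ S, (R.V j).op η x ∈ S) (p : ℕ) :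
    ∀ (η : X.E j), ∀ x ∈ (R.V i).frak p S, (R.V j).op η x ∈ (R.V i).frak p S := by
  have key : (∀ (η : X.E j), ∀ x ∈ (R.V i).products S p, (R.V j).op η x ∈ (R.V i).frak p S) →
      ∀ (η : X.E j), ∀ x ∈ (R.V i).frak p S, (R.V j).op η x ∈ (R.V i).frak p S := by
    intro h η
    have h1 : (R.V i).frak p S ≤ ((R.V i).frak p S).comap ((R.V j).op η : H →ₗ[ℂ] H) :=
      (R.V i).frak_le ((Submodule.isClosed_topologicalClosure _).preimage
        ((R.V j).op η).continuous) (h η)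
    exact fun x hx => h1 hx
  refine key ?_
  clear key
  induction p with
  | zero => exact fun η x hx => (R.V i).products_subset_frak 0 S (hSj η x hx)
  | succ p ih =>
    rintro η _ ⟨ξ, w, hw, rfl⟩
    exact R.op_op_mem hij (Submodule.isClosed_topologicalClosure _)
      (fun x hx => CovRep.map_frak (R.U_op hij i) hSU hx)
      (fun ξ' η' => (R.V i).op_mem_frak_succ ξ' (ih η' w hw)) η ξ

theorem op_mem_frak_top {i j : Fin k} (hij : j ≠ i) (p : ℕ) (η : X.E j) {x : H}
    (hx : x ∈ (R.V i).frak p ⊤) : (R.V j).op η x ∈ (R.V i).frak p ⊤ :=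
  R.op_mem_frak hij (fun _ _ => Submodule.mem_top)
    (fun _ _ _ => Submodule.mem_top) p η x hx

theorem op_mem_frak_wandering {i j : Fin k} (hij : j ≠ i) (p : ℕ) (η : X.E j) {x : H}
    (hx : x ∈ (R.V i).frak p (R.V i).wandering) :
    (R.V j).op η x ∈ (R.V i).frak p (R.V i).wandering :=
  R.op_mem_frak hij (fun _ hx => R.U_mem_wandering hij i hx)
    (fun η _ hx => R.op_mem_wandering hij η hx) p η x hx

/-- The subspace is invariant by the doubly twisted relation, its complement `𝔄⁽ⁱ⁾₁(H)` by the
twisted one. -/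
theorem reduces_wandering {i j : Fin k} (hij : j ≠ i) : (R.V j).Reduces (R.V i).wandering := by
  refine ⟨CovRep.isClosed_wandering, fun a h hh => ?_,
    fun ξ => ⟨fun h hh => R.op_mem_wandering hij ξ hh, fun h hh => ?_⟩⟩
  · rw [CovRep.wandering_eq] at hh ⊢
    exact CovRep.σ_mem_orthogonal
      (fun a h hh => (R.V i).σ_mem_frak (S := ⊤) (fun _ _ _ => Submodule.mem_top) a hh) a hh
  · have : IsClosed ((R.V i).frak 1 ⊤ : Set H) := Submodule.isClosed_topologicalClosure _
    have := this.completeSpace_coe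
    rw [CovRep.wandering_eq, Submodule.orthogonal_orthogonal] at hh ⊢
    exact R.op_mem_frak_top hij 1 ξ hh

/-- The fact that makes the single decompositions compatible. For `j ≠ i`, the core is the
intersection of the invariant subspaces `𝔄⁽ⁱ⁾ₙ(H)`, and its complement is spanned by the subspaces
`𝔄⁽ⁱ⁾ₙ` of the wandering subspace, which are invariant too. -/
theorem reduces_core {i : Fin k} (hR : (R.V i).WoldHypothesis) (j : Fin k) :
    (R.V j).Reduces (R.V i).core := by
  have hW := hR.admitsWold
  rcases eq_or_ne j i with rfl | hij
  · exact hW.1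
  refine ⟨hW.1.1, hW.1.2.1, fun ξ => ⟨fun h hh => ?_, fun h hh => ?_⟩⟩
  · rw [(R.V i).core_eq_iInf_frak hR.1, Submodule.mem_iInf] at hh ⊢
    exact fun n => R.op_mem_frak_top hij n ξ (hh n)
  · rw [← hW.2.2] at hh ⊢
    have h1 : (⨆ n, (R.V i).frak n (R.V i).wandering) ≤
        (⨆ n, (R.V i).frak n (R.V i).wandering).comap ((R.V j).op ξ : H →ₗ[ℂ] H) :=
      iSup_le fun n y hy => Submodule.mem_iSup_of_mem n (R.op_mem_frak_wandering hij n ξ hy)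
    exact map_mem_closure ((R.V j).op ξ).continuous hh fun y hy => h1 hy

end DoublyTwistedRep

/-! ### Products along words and joint generation. -/

namespace DoublyTwistedRep
open HRep
variable {k : ℕ} {X : ProductSystem.{u} A k} {H : HRep.{u} A} (R : DoublyTwistedRep X H)

/-- The closed span of the vectors obtained from `S` by applying the products along a word. -/
def wordFrak (w : List (Fin k)) (S : Submodule ℂ H) : Submodule ℂ H :=
  (Submodule.span ℂ (R.products S w)).topologicalClosure

theorem frak_eq_wordFrak (β : Finset (Fin k)) (m : Fin k → ℕ) (S : Submodule ℂ H) :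
    R.frak β m S = R.wordFrak (word β m) S := rfl

theorem isClosed_wordFrak (w : List (Fin k)) (S : Submodule ℂ H) :
    IsClosed (R.wordFrak w S : Set H) := Submodule.isClosed_topologicalClosure _

theorem products_subset_wordFrak (w : List (Fin k)) (S : Submodule ℂ H) {y : H}
    (hy : y ∈ R.products S w) : y ∈ R.wordFrak w S :=
  Submodule.le_topologicalClosure _ (Submodule.subset_span hy)

theorem wordFrak_le {w : List (Fin k)} {S S' : Submodule ℂ H} (hS' : IsClosed (S' : Set H))
    (h : ∀ y ∈ R.products S w, y ∈ S') : R.wordFrak w S ≤ S' :=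
  Submodule.topologicalClosure_minimal _ (Submodule.span_le.mpr h) hS'

theorem wordFrak_mono (w : List (Fin k)) {S S' : Submodule ℂ H} (h : S ≤ S') :
    R.wordFrak w S ≤ R.wordFrak w S' := by
  have h1 : ∀ w, R.products S w ⊆ R.products S' w := by
    intro w
    induction w with
    | nil => exact h
    | cons i w ih =>
      rintro _ ⟨ξ, y, hy, rfl⟩
      exact ⟨ξ, y, ih hy, rfl⟩
  exact R.wordFrak_le (R.isClosed_wordFrak _ _) fun y hy =>
    R.products_subset_wordFrak _ _ (h1 w hy)

theorem op_mem_wordFrak {w : List (Fin k)} {S : Submodule ℂ H} (i : Fin k) (ξ : X.E i) {h : H}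
    (hh : h ∈ R.wordFrak w S) : (R.V i).op ξ h ∈ R.wordFrak (i :: w) S := by
  have h1 : R.wordFrak w S ≤ (R.wordFrak (i :: w) S).comap ((R.V i).op ξ : H →ₗ[ℂ] H) :=
    R.wordFrak_le ((R.isClosed_wordFrak _ _).preimage ((R.V i).op ξ).continuous)
      fun y hy => R.products_subset_wordFrak _ _ ⟨ξ, y, hy, rfl⟩
  exact h1 hh

theorem wordFrak_nil {S : Submodule ℂ H} (hS : IsClosed (S : Set H)) : R.wordFrak [] S = S :=
  le_antisymm (R.wordFrak_le hS fun _ hy => hy) fun _ hy => R.products_subset_wordFrak [] S hy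

/-- A closed subspace invariant under the operators occurring in a word contains the products. -/
theorem wordFrak_le_of_invariant {w : List (Fin k)} {S S' : Submodule ℂ H}
    (hS' : IsClosed (S' : Set H)) (hS : S ≤ S')
    (h : ∀ i ∈ w, ∀ ξ, ∀ x ∈ S', (R.V i).op ξ x ∈ S') : R.wordFrak w S ≤ S' := by
  refine R.wordFrak_le hS' ?_
  induction w with
  | nil => exact fun y hy => hS hy
  | cons i w ih =>
    rintro _ ⟨ξ, y, hy, rfl⟩
    exact h i List.mem_cons_self ξ y (ih (fun j hj => h j (List.mem_cons_of_mem _ hj)) y hy)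

/-- Each letter lets `S` be replaced by `𝔄₁(S)`, so the inclusions can be iterated along the word.
-/
theorem le_wordFrak {w : List (Fin k)} {S : Submodule ℂ H}
    (h : ∀ i ∈ w, S ≤ (R.V i).frak 1 S) : S ≤ R.wordFrak w S := by
  induction w with
  | nil => exact fun y hy => R.products_subset_wordFrak [] S hy
  | cons i w ih =>
    have h1 := ih fun j hj => h j (List.mem_cons_of_mem _ hj)
    refine (h i List.mem_cons_self).trans ((R.V i).frak_le (R.isClosed_wordFrak _ _) ?_)
    rintro _ ⟨ξ, y, hy, rfl⟩
    exact R.op_mem_wordFrak i ξ (h1 hy)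

theorem products_replicate (i : Fin k) (S : Set H) (n : ℕ) :
    R.products S (List.replicate n i) = (R.V i).products S n := by
  induction n with
  | zero => rfl
  | succ n ih =>
    change {z | ∃ ξ : X.E i, ∃ y ∈ R.products S (List.replicate n i), z = (R.V i).op ξ y} = _
    rw [ih]; rfl

theorem wordFrak_replicate (i : Fin k) (S : Submodule ℂ H) (n : ℕ) :
    R.wordFrak (List.replicate n i) S = (R.V i).frak n S := by
  rw [wordFrak, products_replicate]; rfl

omit R in
theorem mem_of_mem_word {β : Finset (Fin k)} {m : Fin k → ℕ} {i : Fin k} (h : i ∈ word β m) :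
    i ∈ β := by
  obtain ⟨j, hj, hi⟩ := List.mem_flatMap.mp h
  rw [List.eq_of_mem_replicate hi]
  exact (Finset.mem_sort _).mp hj

omit R in
theorem word_zero (β : Finset (Fin k)) : word β (fun _ => 0) = [] := by
  simp [word]

omit R in
theorem word_insert {β : Finset (Fin k)} {i : Fin k} (hi : ∀ j ∈ β, i < j) (m : Fin k → ℕ) :
    word (insert i β) m = List.replicate (m i) i ++ word β m := by
  rw [word, Finset.sort_insert _ (fun j hj => (hi j hj).le) fun h => lt_irrefl i (hi i h),
    List.flatMap_cons]
  rfl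

omit R in
theorem word_congr {β : Finset (Fin k)} {m m' : Fin k → ℕ} (h : ∀ i ∈ β, m i = m' i) :
    word β m = word β m' := by
  refine List.flatMap_congr fun i hi => ?_
  rw [h i ((Finset.mem_sort _).mp hi)]

omit R in
theorem count_word {β : Finset (Fin k)} {i : Fin k} (hi : i ∈ β) (m : Fin k → ℕ) :
    (word β m).count i = m i := by
  induction β using Finset.induction_on_min with
  | empty => simp at hi
  | insert j β hj ih =>
    rw [word_insert hj, List.count_append, List.count_replicate]
    rcases Finset.mem_insert.mp hi with rfl | h
    · have : i ∉ word β m := fun h => lt_irrefl i (hj i (mem_of_mem_word h))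
      simp [List.count_eq_zero_of_not_mem this]
    · have : j ≠ i := (hj i h).ne
      simp [this, ih h]

/-- Only the letters `i` of a word matter for the level reached in the filtration `𝔄⁽ⁱ⁾ₚ(S)`. -/
theorem wordFrak_le_frak_count {i : Fin k} {S : Submodule ℂ H}
    (hS : ∀ j, j ≠ i → ∀ p (η : X.E j), ∀ x ∈ (R.V i).frak p S,
      (R.V j).op η x ∈ (R.V i).frak p S) (w : List (Fin k)) :
    R.wordFrak w S ≤ (R.V i).frak (w.count i) S := by
  refine R.wordFrak_le (Submodule.isClosed_topologicalClosure _) ?_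
  induction w with
  | nil => exact fun y hy => (R.V i).products_subset_frak 0 S hy
  | cons j w ih =>
    rintro _ ⟨ξ, y, hy, rfl⟩
    rcases eq_or_ne j i with rfl | hij
    · rw [List.count_cons_self]
      exact (R.V j).op_mem_frak_succ ξ (ih y hy)
    · rw [List.count_cons_of_ne hij]
      exact hS j hij _ ξ y (ih y hy)

theorem wandering_insert (i : Fin k) (β : Finset (Fin k)) :
    R.wandering (insert i β) = (R.V i).wandering ⊓ R.wandering β := by
  simp only [wandering, Finset.iInf_insert]

theorem wandering_le {i : Fin k} {β : Finset (Fin k)} (hi : i ∈ β) :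
    R.wandering β ≤ (R.V i).wandering := iInf₂_le i hi

theorem reduces_wandering_finset {β : Finset (Fin k)} {j : Fin k} (hj : j ∉ β) :
    (R.V j).Reduces (R.wandering β) :=
  CovRep.reduces_iInf fun _ => CovRep.reduces_iInf fun hi =>
    R.reduces_wandering fun h => hj (h ▸ hi)

theorem op_mem_closure_iSup {ι : Type*} {w : ι → List (Fin k)} {S : Submodule ℂ H} (i : Fin k)
    (ξ : X.E i) {h : H} (hh : h ∈ (⨆ m, R.wordFrak (w m) S).topologicalClosure) :
    (R.V i).op ξ h ∈ (⨆ m, R.wordFrak (i :: w m) S).topologicalClosure := by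
  have h1 : (⨆ m, R.wordFrak (w m) S) ≤
      (⨆ m, R.wordFrak (i :: w m) S).comap ((R.V i).op ξ : H →ₗ[ℂ] H) :=
    iSup_le fun m y hy => Submodule.mem_iSup_of_mem m (R.op_mem_wordFrak i ξ hy)
  exact map_mem_closure ((R.V i).op ξ).continuous hh fun y hy => h1 hy

/-- Representations that are pure on a common reducing subspace are jointly generated there by
their joint wandering subspace. -/
theorem le_iSup_frak (β : Finset (Fin k)) (hR : ∀ i ∈ β, (R.V i).WoldHypothesis) :
    ∀ S : Submodule ℂ H, IsClosed (S : Set H) → (∀ i ∈ β, (R.V i).Reduces S) →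
      (∀ i ∈ β, S ≤ (R.V i).coreᗮ) →
      S ≤ (⨆ m : Fin k → ℕ, R.frak β m (S ⊓ R.wandering β)).topologicalClosure := by
  -- The indices in a word increase from left to right, so the least index is applied last. It is
  -- split off first: `S` is generated by `S ⊓ 𝒩ᵢ`, which still reduces the remaining
  -- representations, and the induction hypothesis generates that subspace.
  induction β using Finset.induction_on_min with
  | empty =>
    intro S hS _ _
    refine le_trans ?_ (Submodule.le_topologicalClosure _)
    refine le_trans ?_ (le_iSup _ fun _ => 0)
    rw [frak_eq_wordFrak, word_zero]
    intro x hx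
    exact R.products_subset_wordFrak [] _ ⟨hx, by simp [wandering]⟩
  | insert i β hi ih =>
    intro S hS hred hpure
    have hi' : i ∉ β := fun h => lt_irrefl i (hi i h)
    have h1 := (hred i (Finset.mem_insert_self i β)).le_iSup_frak
      (hR i (Finset.mem_insert_self i β)).admitsWold (hpure i (Finset.mem_insert_self i β))
    refine h1.trans (Submodule.topologicalClosure_minimal _ (iSup_le fun n => ?_)
      (Submodule.isClosed_topologicalClosure _))
    set S' := S ⊓ (R.V i).wandering with hS'
    have h2 := ih (fun j hj => hR j (Finset.mem_insert_of_mem hj)) S'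
      (hS.inter CovRep.isClosed_wandering)
      (fun j hj => CovRep.reduces_inf (hred j (Finset.mem_insert_of_mem hj))
        (R.reduces_wandering (hi j hj).ne'))
      (fun j hj => inf_le_left.trans (hpure j (Finset.mem_insert_of_mem hj)))
    have h3 : S' ⊓ R.wandering β = S ⊓ R.wandering (insert i β) := by
      rw [wandering_insert, hS', inf_assoc]
    rw [h3] at h2
    set W := S ⊓ R.wandering (insert i β)
    have h4 : ∀ n, (R.V i).frak n S' ≤
        (⨆ m : Fin k → ℕ, R.wordFrak (List.replicate n i ++ word β m) W).topologicalClosure := by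
      intro n
      refine (R.V i).frak_le (Submodule.isClosed_topologicalClosure _) ?_
      induction n with
      | zero => exact fun y hy => h2 hy
      | succ n ihn =>
        rintro _ ⟨ξ, y, hy, rfl⟩
        exact R.op_mem_closure_iSup i ξ (ihn y hy)
    refine (h4 n).trans (Submodule.topologicalClosure_mono (iSup_le fun m => ?_))
    refine le_trans (le_of_eq ?_) (le_iSup _ (Function.update m i n))
    rw [frak_eq_wordFrak, word_insert hi, Function.update_self]
    congr 2
    exact word_congr fun j hj => by
      rw [Function.update_of_ne (hi j hj).ne']

theorem wanderingIn_eq {β : Finset (Fin k)} {S : Submodule ℂ H}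
    (h : ∀ i ∈ β, (R.V i).Reduces S) : R.wanderingIn β S = S ⊓ R.wandering β := by
  ext x
  simp only [wanderingIn, wandering, Submodule.mem_inf, Submodule.mem_iInf]
  refine and_congr_right fun hx => forall₂_congr fun i hi => ?_
  have h1 := (h i hi).inf_orthogonal_frak_one
  have h2 := congrArg (fun T : Submodule ℂ H => x ∈ T) h1
  simpa [hx] using h2

theorem iSup_frak_le {β : Finset (Fin k)} {S S' : Submodule ℂ H}
    (h : ∀ i ∈ β, (R.V i).Reduces S) (hS : IsClosed (S : Set H)) (hS' : S' ≤ S) :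
    (⨆ m : Fin k → ℕ, R.frak β m S').topologicalClosure ≤ S :=
  Submodule.topologicalClosure_minimal _ (iSup_le fun _ => R.wordFrak_le_of_invariant hS hS'
    fun i hi ξ x hx => ((h i (mem_of_mem_word hi)).2.2 ξ).1 x hx) hS

theorem generatedOn_of_pure {β : Finset (Fin k)} (hR : ∀ i ∈ β, (R.V i).WoldHypothesis)
    {S : Submodule ℂ H} (hS : IsClosed (S : Set H)) (h : ∀ i ∈ β, (R.V i).Reduces S)
    (hp : ∀ i ∈ β, S ≤ (R.V i).coreᗮ) : R.GeneratedOn β S := by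
  rw [GeneratedOn, R.wanderingIn_eq h]
  exact le_antisymm (R.iSup_frak_le h hS inf_le_left) (R.le_iSup_frak β hR S hS h hp)

/-- Iterating the inclusion gives `S ≤ 𝔄ₙ(S) ≤ 𝔄ₙ(H)` for every `n`. -/
theorem le_core_of_le_frak_one (i : Fin k) (hR : (R.V i).WoldHypothesis) {S : Submodule ℂ H}
    (h : S ≤ (R.V i).frak 1 S) : S ≤ (R.V i).core := by
  rw [(R.V i).core_eq_iInf_frak hR.1]
  refine le_iInf fun n => ?_
  rw [← wordFrak_replicate]
  refine (R.le_wordFrak fun j hj => ?_).trans (R.wordFrak_mono _ le_top)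
  rw [List.eq_of_mem_replicate hj]
  exact h

/-! ### The joint Wold-type decomposition. -/

section
variable (hR : ∀ i, (R.V i).WoldHypothesis)
include hR

/-- Replaces the multi-index intersection by cores. The right side reduces each representation with
index in `J ∖ β` and lies in its core, hence in its own `𝔄₁`, so it is contained in all the `𝔄`. -/
theorem innerSpace_eq (J β : Finset (Fin k)) :
    R.innerSpace J β = R.wandering β ⊓ ⨅ i ∈ J \ β, (R.V i).core := by
  have hcl : IsClosed (R.wandering β : Set H) := by
    rw [wandering]
    simp only [Submodule.coe_iInf]
    exact isClosed_iInter fun i => isClosed_iInter fun _ => CovRep.isClosed_wandering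
  refine le_antisymm (le_inf ?_ (le_iInf₂ fun i hi => ?_)) (le_iInf fun n => ?_)
  · refine (iInf_le _ fun _ => 0).trans ?_
    rw [frak_eq_wordFrak, word_zero, R.wordFrak_nil hcl]
  · rw [(R.V i).core_eq_iInf_frak (hR i).1]
    -- The constant multi-index `n` suffices: its word contains the letter `i` exactly `n` times,
    -- and other letters preserve `𝔄⁽ⁱ⁾ₙ(H)`.
    refine le_iInf fun n => (iInf_le _ fun _ => n).trans ?_
    rw [frak_eq_wordFrak]
    refine (R.wordFrak_mono _ le_top).trans
      ((R.wordFrak_le_frak_count (i := i) (fun j hij p η x hx => R.op_mem_frak_top hij p η hx)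
        _).trans ?_)
    rw [count_word hi]
  · rw [frak_eq_wordFrak]
    refine le_trans (R.le_wordFrak fun i hi => ?_) (R.wordFrak_mono _ inf_le_left)
    have hi' := mem_of_mem_word hi
    refine CovRep.Reduces.le_frak_one (hR i).admitsWold ?_ (inf_le_right.trans (iInf₂_le i hi'))
    exact CovRep.reduces_inf (R.reduces_wandering_finset (Finset.mem_sdiff.mp hi').2)
      (CovRep.reduces_iInf fun j => CovRep.reduces_iInf fun _ => R.reduces_core (hR j) i)

omit hR in
/-- The subspace on which exactly the representations with index in `β` are pure. -/
def part (J β : Finset (Fin k)) : Submodule ℂ H :=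
  ⨅ i ∈ J, if i ∈ β then (R.V i).coreᗮ else (R.V i).core

theorem reduces_part (J β : Finset (Fin k)) (j : Fin k) : (R.V j).Reduces (R.part J β) :=
  CovRep.reduces_iInf fun i => CovRep.reduces_iInf fun _ => by
    split_ifs
    · exact CovRep.reduces_orthogonal (R.reduces_core (hR i) j)
    · exact R.reduces_core (hR i) j

omit hR in
theorem isClosed_part (J β : Finset (Fin k)) (hR : ∀ i, (R.V i).WoldHypothesis) :
    IsClosed (R.part J β : Set H) := by
  simp only [part, Submodule.coe_iInf]
  refine isClosed_iInter fun i => isClosed_iInter fun _ => ?_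
  split_ifs
  · exact Submodule.isClosed_orthogonal _
  · exact (hR i).admitsWold.1.1

omit hR in
theorem part_le_orthogonal_core {J β : Finset (Fin k)} {i : Fin k} (hi : i ∈ J) (hβ : i ∈ β) :
    R.part J β ≤ (R.V i).coreᗮ :=
  (iInf₂_le i hi).trans (by rw [if_pos hβ])

omit hR in
theorem part_le_core {J β : Finset (Fin k)} {i : Fin k} (hi : i ∈ J) (hβ : i ∉ β) :
    R.part J β ≤ (R.V i).core :=
  (iInf₂_le i hi).trans (by rw [if_neg hβ])

/-- The generating subspace of `𝒦_β` lies in the reducing subspace `part J β`, because wandering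
vectors are orthogonal to the core. Conversely `part J β` is pure for `β`, hence generated by its
joint wandering vectors, and these belong to `innerSpace`. -/
theorem woldSpace_eq {J β : Finset (Fin k)} (hβ : β ⊆ J) : R.woldSpace J β = R.part J β := by
  rw [woldSpace, R.innerSpace_eq hR]
  refine le_antisymm (R.iSup_frak_le (fun i _ => R.reduces_part hR J β i)
    (R.isClosed_part J β hR) (le_iInf₂ fun i hi => ?_)) ?_
  · split_ifs with h
    · exact inf_le_left.trans ((R.wandering_le h).trans (CovRep.wandering_le (hR i).admitsWold))
    · exact inf_le_right.trans (iInf₂_le i (Finset.mem_sdiff.mpr ⟨hi, h⟩))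
  · refine (R.le_iSup_frak β (fun i _ => hR i) _ (R.isClosed_part J β hR)
      (fun i _ => R.reduces_part hR J β i)
      (fun i hi => R.part_le_orthogonal_core (hβ hi) hi)).trans
      (Submodule.topologicalClosure_mono (iSup_mono fun m => R.wordFrak_mono _ ?_))
    refine le_inf inf_le_right (inf_le_left.trans (le_iInf₂ fun i hi => ?_))
    exact R.part_le_core (Finset.mem_sdiff.mp hi).1 (Finset.mem_sdiff.mp hi).2

theorem part_orthogonal {J β γ : Finset (Fin k)} (hβ : β ⊆ J) (hγ : γ ⊆ J) (h : β ≠ γ) :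
    R.part J β ⟂ R.part J γ := by
  have key : ∀ β γ : Finset (Fin k), β ⊆ J → ∀ i ∈ β, i ∉ γ → R.part J β ⟂ R.part J γ :=
    fun β γ hβ i hi hi' => Submodule.isOrtho_iff_le.mpr
      ((R.part_le_orthogonal_core (hβ hi) hi).trans
        (Submodule.orthogonal_le (R.part_le_core (hβ hi) hi')))
  by_cases h1 : β ⊆ γ
  · obtain ⟨i, hi, hi'⟩ := Finset.not_subset.mp fun h2 => h (h1.antisymm h2)
    exact (key γ β hγ i hi hi').symm
  · obtain ⟨i, hi, hi'⟩ := Finset.not_subset.mp h1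
    exact key β γ hβ i hi hi'

/-- Adding an index `i` splits each piece in two: the projection onto the core of `i` preserves the
other cores and their complements, as that core reduces all representations. -/
theorem iSup_part (J : Finset (Fin k)) : (⨆ β ∈ J.powerset, R.part J β) = ⊤ := by
  induction J using Finset.induction_on with
  | empty =>
    refine top_le_iff.mp (le_trans ?_ (le_iSup₂ ∅ (Finset.mem_powerset_self ∅)))
    simp [part]
  | insert i J hi ih =>
    rw [← top_le_iff, ← ih]
    refine iSup₂_le fun β hβ x hx => ?_
    have hβJ := Finset.mem_powerset.mp hβ
    have hiβ : i ∉ β := fun h => hi (hβJ h)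
    obtain ⟨P, hP⟩ := IsProj.exists_of_isClosed (hR i).admitsWold.1.1
    have hPx : P x ∈ R.part J β := by
      simp only [part, Submodule.mem_iInf] at hx ⊢
      intro j hj
      have h1 := hx j hj
      have h2 : ∀ y ∈ (R.V j).core, P y ∈ (R.V j).core := fun y hy =>
        CovRep.Reduces.proj_mem_core (hR j).1 (R.reduces_core (hR i) j) hP hy
      split_ifs at h1 ⊢
      · exact hP.map_orthogonal h2 h1
      · exact h2 _ h1
    have hx' : x - P x ∈ R.part J β := sub_mem hx hPx
    have e1 : P x ∈ R.part (insert i J) β := by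
      rw [part, Finset.iInf_insert, if_neg hiβ]
      exact ⟨hP.mem x, hPx⟩
    have e2 : x - P x ∈ R.part (insert i J) (insert i β) := by
      rw [part, Finset.iInf_insert, if_pos (Finset.mem_insert_self i β)]
      refine ⟨hP.sub_mem x, ?_⟩
      simp only [part, SetLike.mem_coe, Submodule.mem_iInf] at hx' ⊢
      intro j hj
      have h1 := hx' j hj
      have hji : j ≠ i := fun h => hi (h ▸ hj)
      simpa [Finset.mem_insert, hji] using h1
    rw [← add_sub_cancel (P x) x]
    refine add_mem ?_ ?_
    · exact Submodule.mem_iSup_of_mem β (Submodule.mem_iSup_of_mem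
        (Finset.mem_powerset.mpr (hβJ.trans (Finset.subset_insert i J))) e1)
    · exact Submodule.mem_iSup_of_mem (insert i β) (Submodule.mem_iSup_of_mem
        (Finset.mem_powerset.mpr (Finset.insert_subset_insert i hβJ)) e2)

theorem isWoldDecomposition_part (J : Finset (Fin k)) :
    R.IsWoldDecomposition J (R.part J) := by
  refine ⟨fun β _ i _ => R.reduces_part hR J β i,
    fun β hβ γ hγ h => R.part_orthogonal hR hβ hγ h, R.iSup_part hR J, fun β hβ => ⟨?_, ?_, ?_⟩⟩
  · exact R.generatedOn_of_pure (fun i _ => hR i) (R.isClosed_part J β hR)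
      (fun i _ => R.reduces_part hR J β i) fun i hi => R.part_le_orthogonal_core (hβ hi) hi
  · intro i hi
    refine ⟨R.generatedOn_of_pure (fun i _ => hR i) (R.isClosed_part J β hR)
      (fun i _ => R.reduces_part hR J β i) fun j hj => ?_, ?_⟩
    · rw [Finset.mem_singleton.mp hj]
      exact R.part_le_orthogonal_core (hβ hi) hi
    · have h1 : ⨅ n, (R.V i).frak n (R.part J β) ≤ (R.V i).core := by
        rw [(R.V i).core_eq_iInf_frak (hR i).1]
        exact iInf_mono fun n => CovRep.frak_mono le_top n
      have h2 : ⨅ n, (R.V i).frak n (R.part J β) ≤ (R.V i).coreᗮ :=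
        (iInf_le _ 0).trans (((R.reduces_part hR J β i).frak_le 0).trans
          (R.part_le_orthogonal_core (hβ hi) hi))
      exact le_bot_iff.mp ((le_inf h1 h2).trans (Submodule.inf_orthogonal_eq_bot _).le)
  · intro i hi
    rw [Finset.mem_sdiff] at hi
    exact (R.V i).invertibleOn_of_le_frak_one (hR i).1 (R.reduces_part hR J β i)
      ((R.reduces_part hR J β i).le_frak_one (hR i).admitsWold (R.part_le_core hi.1 hi.2))

/-- The maximality of `𝒦_β`. -/
theorem le_woldSpace {J β : Finset (Fin k)} (hβ : β ⊆ J) {S : Submodule ℂ H}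
    (hS : ∀ i ∈ J, (R.V i).Reduces S) (hg : R.GeneratedOn β S)
    (hi : ∀ i ∈ J \ β, (R.V i).InvertibleOn S) : S ≤ R.woldSpace J β := by
  rw [← hg, woldSpace, R.innerSpace_eq hR, R.wanderingIn_eq fun i h => hS i (hβ h)]
  refine Submodule.topologicalClosure_mono (iSup_mono fun m => R.wordFrak_mono _ ?_)
  refine le_inf inf_le_right (inf_le_left.trans (le_iInf₂ fun i h => ?_))
  exact R.le_core_of_le_frak_one i (hR i) ((R.V i).le_frak_one_of_invertibleOn (hi i h))

/-- By maximality `L γ ≤ 𝒦_γ` for all `γ`. The part of a vector of `𝒦_β` orthogonal to `L β` is then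
orthogonal to every `L γ`, since the `𝒦_γ` are mutually orthogonal, and so it vanishes. -/
theorem eq_woldSpace {J : Finset (Fin k)} {L : Finset (Fin k) → Submodule ℂ H}
    (hL : R.IsWoldDecomposition J L) {β : Finset (Fin k)} (hβ : β ⊆ J) (hJ : J.Nonempty) : L β = R.woldSpace J β := by
  have hle : ∀ γ ⊆ J, L γ ≤ R.woldSpace J γ := fun γ hγ =>
    R.le_woldSpace hR hγ (hL.1 γ hγ) (hL.2.2.2 γ hγ).1 (hL.2.2.2 γ hγ).2.2
  refine le_antisymm (hle β hβ) fun x hx => ?_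
  -- An index is needed because closedness of `L β` is part of the reducing property.
  obtain ⟨j, hj⟩ := hJ
  obtain ⟨P, hP⟩ := IsProj.exists_of_isClosed (hL.1 β hβ j hj).1
  have h1 : x - P x ∈ R.woldSpace J β := sub_mem hx (hle β hβ (hP.mem x))
  have h2 : (⨆ γ ∈ J.powerset, L γ) ≤ (ℂ ∙ (x - P x))ᗮ := by
    refine iSup₂_le fun γ hγ y hy => Submodule.mem_orthogonal_singleton_iff_inner_left.mpr ?_
    have hγJ := Finset.mem_powerset.mp hγ
    rcases eq_or_ne γ β with rfl | hne
    · exact hP.sub_mem x y hy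
    · have h3 := hle γ hγJ hy
      rw [R.woldSpace_eq hR hγJ] at h3
      rw [R.woldSpace_eq hR hβ] at h1
      exact (R.part_orthogonal hR hγJ hβ hne).inner_eq h3 h1
  rw [hL.2.2.1] at h2
  have h4 := Submodule.mem_orthogonal_singleton_iff_inner_left.mp
    (h2 (Submodule.mem_top (x := x - P x)))
  rw [sub_eq_zero.mp (inner_self_eq_zero.mp h4)]
  exact hP.mem x

/-- One differing exponent is enough: counting the letters `i` places the two subspaces in different
levels `𝔄⁽ⁱ⁾` of the wandering subspace of `i`, and these are orthogonal in the near-isometric case.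
-/
theorem frak_innerSpace_orthogonal {J β : Finset (Fin k)} {i : Fin k} (hi : i ∈ β)
    (hn : (R.V i).NearIsometric) {n n' : Fin k → ℕ} (hne : n i ≠ n' i) :
    R.frak β n (R.innerSpace J β) ⟂ R.frak β n' (R.innerSpace J β) := by
  have h1 : ∀ n : Fin k → ℕ, R.frak β n (R.innerSpace J β) ≤
      (R.V i).frak (n i) (R.V i).wandering := fun n => by
    have h2 := R.wordFrak_le_frak_count (i := i) (S := (R.V i).wandering)
      (fun j hij p η x hx => R.op_mem_frak_wandering hij p η hx) (word β n)
    rw [count_word hi] at h2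
    refine (R.wordFrak_mono _ ?_).trans h2
    rw [R.innerSpace_eq hR]
    exact inf_le_left.trans (R.wandering_le hi)
  rcases lt_or_gt_of_ne hne with h | h
  · exact (CovRep.frak_wandering_orthogonal hn h).mono (h1 n) (h1 n')
  · exact (CovRep.frak_wandering_orthogonal hn h).symm.mono (h1 n) (h1 n')

end

end DoublyTwistedRep

end DTCR

end

theorem theorem4p1 {A : Type v} [NonUnitalCStarAlgebra A] [PartialOrder A] [StarOrderedRing A]
    {k : ℕ} (X : DTCR.ProductSystem.{u} A k) (H : DTCR.HRep.{u} A)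
    (R : DTCR.DoublyTwistedRep X H) (hR : ∀ i, (R.V i).WoldHypothesis)
    (m : ℕ) (h2 : 2 ≤ m) (hm : m ≤ k) (J : Finset (Fin k))
    (hJ : J = Finset.univ.filter fun i : Fin k => (i : ℕ) < m) :
    R.IsWoldDecomposition J (R.woldSpace J) ∧
    (∀ L : Finset (Fin k) → Submodule ℂ H, R.IsWoldDecomposition J L →
      ∀ β ⊆ J, L β = R.woldSpace J β) ∧
    (∀ β ⊆ J, ∀ S : Submodule ℂ H, (∀ i ∈ J, (R.V i).Reduces S) → R.GeneratedOn β S →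
      (∀ i ∈ J \ β, (R.V i).InvertibleOn S) → S ≤ R.woldSpace J β) ∧
    (∀ β ⊆ J, (∀ i ∈ β, (R.V i).NearIsometric) → ∀ n n' : Fin k → ℕ, (∃ i ∈ β, n i ≠ n' i) →
      R.frak β n (R.innerSpace J β) ⟂ R.frak β n' (R.innerSpace J β)) := by
  have hne : J.Nonempty := ⟨⟨0, by omega⟩, by rw [hJ]; simp; omega⟩
  refine ⟨?_, fun L hL β hβ => R.eq_woldSpace hR hL hβ hne,
    fun β hβ S hS hg hi => R.le_woldSpace hR hβ hS hg hi,
    fun β _ hn n n' ⟨i, hi, hin⟩ => R.frak_innerSpace_orthogonal hR hi (hn i hi) hin⟩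
  obtain ⟨h1, h3, h4, h5⟩ := R.isWoldDecomposition_part hR J
  refine ⟨fun β hβ => ?_, fun β hβ γ hγ => ?_, ?_, fun β hβ => ?_⟩
  · rw [R.woldSpace_eq hR hβ]; exact h1 β hβ
  · rw [R.woldSpace_eq hR hβ, R.woldSpace_eq hR hγ]; exact h3 β hβ γ hγ
  · rw [← h4]
    exact iSup_congr fun β => iSup_congr fun hβ => R.woldSpace_eq hR (Finset.mem_powerset.mp hβ)
  · rw [R.woldSpace_eq hR hβ]; exact h5 β hβ
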